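/- Let $M$ be the figure-eight knot complement, $\pi_1(M)=\langle x,y\mid ax=ya\rangle$ with $a=xy^{-1}x^{-1}y$, and put $b=xy^{-1}$, $l=b^{-1}a^{-1}ba$. Then $\pi_1(F)=\langle a,b\rangle$ is the group of the once-punctured torus fiber $F$ of $M\to S^1$, $\pi_1(\partial F)=\langle l\rangle$, and $x$ (the monodromy) normalizes $\langle a,b\rangle$ and commutes with $l$. A pair $(z_1,z_2)$ of complex numbers with positive imaginary parts is called a shape if $$2\log z_1+\log\tfrac1{1-z_1}+\log z_2+2\log\bigl(1-\tfrac1{z_2}\bigr)=2\pi i,\qquad \log\tfrac1{1-z_1}+2\log\bigl(1-\tfrac1{z_1}\bigr)+\log z_2+2\log\tfrac1{1-z_2}=2\pi i$$ (principal logarithms). Its parameter is $u=\log\bigl(z_1(1-z_2)\bigr)$, the complex length of $x$; it determines the shape. Let $U\subset\mathbb C$ be the set of all parameters; $u=0$ is the parameter of the complete structure $z_1=z_2=e^{\pi i/3}$. For $u\in U$ let $\rho_u:\pi_1(M)\to \mathrm{PSL}(2,\mathbb C)\cong \mathrm{PSO}(3,1)$ be the holonomy, given with $m=z_1(1-z_2)$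 by the Möbius maps $x(p)=(p-1)/m$ and $y(p)=mp/(1-z_2p)$. Let $\mathfrak v$ be the orthogonal complement of $\mathfrak{so}(3,1)$ in $\mathfrak{sl}(4,\mathbb R)$ for the Killing form, and let $\mathfrak v_u$ be $\mathfrak v$ with the action of $\pi_1(M)$ by $\mathrm{Ad}\,\rho_u$. Let $H^1(F;\mathfrak v_u)$, $H^1(\partial F;\mathfrak v_u)=H^1(l;\mathfrak v_u)$ and $H^1(F,\partial F;\mathfrak v_u)$ be the group cohomology of $\langle a,b\rangle$, of $\langle l\rangle$ and of the pair, each with the action of $\langle x\rangle$ induced by $(xf)(h)=x\,f(x^{-1}hx)$ on cocycles; an $x$-module is a real vector space with an action of $\langle x\rangle$, and $W^x$ is the space of fixed vectors. 1. For every $u\in U$ let $I_u$ be the image of the map of $x$-modules $H^1(F,\partial F;\mathfrak v_u)\to H^1(F;\mathfrak v_u)$. Then $$0\to I_u\to H^1(F;\mathfrak v_u)\to H^1(\partial F;\mathfrak v_u)\to 0$$ is a short exact sequence of $x$-modules. 2. There is an open neighborhood $V\subset U$ of $0$ in $\mathbb C$ such that for every $u\in V$ the vector spaces $H^1(F;\mathfrak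 v_u)^x$ and $H^1(l;\mathfrak v_u)^x$ are isomorphic and $\dim H^1(F;\mathfrak v_u)^x=1$. 3. At the complete structure $u=0$, on both $H^1(F,\partial F;\mathfrak v_0)$ and $H^1(F;\mathfrak v_0)$, $$\det(x-t)=-(t-1)^3\left(t^6-15t^5+27t^4-42t^3+27t^2-15t+1\right).$$ -/

import Mathlib

open Matrix

noncomputable section

namespace FigureEight

/-! ### First cohomology of a subgroup, as a module over a normalizing subgroup -/

section Cohomology

variable {G V : Type} [Group G] [AddCommGroup V] [Module ℝ V] (ρ : Representation ℝ G V)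

/-- The restriction of the `G`-module `V` to a subgroup `H`. -/
abbrev coeff (H : Subgroup G) : Rep ℝ H := Rep.res H.subtype (Rep.of ρ)

/-- The group cohomology `H¹(H; V)`. -/
abbrev H1 (H : Subgroup G) : Type := groupCohomology.H1 (coeff ρ H)

/-- For `L ≤ H`, the relative cohomology `H¹(H, L; V)`, that is, the first cohomology of the
complex of inhomogeneous cochains of `H` that vanish on `L`. The relative `1`-cocycles are the
crossed homomorphisms on `H` that vanish on `L`. A relative `0`-cochain is a `0`-cochain of `H`,
i.e. a vector of `V`, whose restriction to `L` (the same vector) is zero; so there are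
no nonzero relative coboundaries in degree one. -/
def H1rel (H L : Subgroup G) : Submodule ℝ (H → V) where
  carrier := {f | (∀ g h : H, f (g * h) = f g + ρ g (f h)) ∧ ∀ h : H, (h : G) ∈ L → f h = 0}
  zero_mem' := by simp
  add_mem' {f f'} hf hf' := by
    refine ⟨fun g h => ?_, fun h hh => ?_⟩
    · simp only [Pi.add_apply, hf.1 g h, hf'.1 g h, map_add]
      abel
    · simp only [Pi.add_apply, hf.2 h hh, hf'.2 h hh, add_zero]
  smul_mem' c f hf := by
    refine ⟨fun g h => ?_, fun h hh => ?_⟩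
    · simp only [Pi.smul_apply, hf.1 g h, map_smul, smul_add]
    · simp only [Pi.smul_apply, hf.2 h hh, smul_zero]

lemma mem_cocycles_of_mem_H1rel {H L : Subgroup G} {f : H → V} (hf : f ∈ H1rel ρ H L) :
    f ∈ groupCohomology.cocycles₁ (coeff ρ H) :=
  (groupCohomology.mem_cocycles₁_iff (A := coeff ρ H) f).mpr fun g h =>
    (hf.1 g h).trans (add_comm _ _)

/-- The map `H¹(H, L; V) → H¹(H; V)`. -/
def relToH1 (H L : Subgroup G) : H1rel ρ H L →ₗ[ℝ] H1 ρ H where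
  toFun f := groupCohomology.H1π (coeff ρ H) ⟨f.1, mem_cocycles_of_mem_H1rel ρ f.2⟩
  map_add' f g := map_add (groupCohomology.H1π (coeff ρ H)).hom
    ⟨f.1, mem_cocycles_of_mem_H1rel ρ f.2⟩ ⟨g.1, mem_cocycles_of_mem_H1rel ρ g.2⟩
  map_smul' c f := map_smul (groupCohomology.H1π (coeff ρ H)).hom c
    ⟨f.1, mem_cocycles_of_mem_H1rel ρ f.2⟩

/-- The restriction map `H¹(H; V) → H¹(L; V)` for `L ≤ H`. -/
def res {H L : Subgroup G} (hLH : L ≤ H) : H1 ρ H →ₗ[ℝ] H1 ρ L :=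
  (groupCohomology.map (A := coeff ρ H) (B := coeff ρ L) (Subgroup.inclusion hLH)
    (Rep.ofHom ⟨LinearMap.id, fun _ => rfl⟩) 1).hom

variable {K H L : Subgroup G}

/-- The homomorphism `h ↦ k⁻¹ h k` of a subgroup `H` normalized by `k`. -/
def conjHom (hK : K ≤ Subgroup.normalizer (H : Set G)) (k : K) : H →* H where
  toFun h := ⟨(k : G)⁻¹ * h * k,
    (Subgroup.mem_normalizer_iff''.mp (hK k.2) (h : G)).mp h.2⟩
  map_one' := by ext; simp
  map_mul' a b := by ext; simp [mul_assoc]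

/-- The action of `k` on `V`, as a morphism from `V` with the `H`-action twisted by
`h ↦ k⁻¹ h k` to `V`. -/
def conjCoeff (hK : K ≤ Subgroup.normalizer (H : Set G)) (k : K) :
    Rep.res (conjHom hK k) (coeff ρ H) ⟶ coeff ρ H :=
  Rep.ofHom ⟨ρ k, fun h => by
    change ρ k ∘ₗ ρ ((k : G)⁻¹ * h * k) = ρ h ∘ₗ ρ k
    rw [← Module.End.mul_eq_comp, ← Module.End.mul_eq_comp, ← map_mul, ← map_mul]
    congr 1
    group⟩

/-- The action of `K` on `H¹(H; V)` induced by `(k f)(h) = k f(k⁻¹ h k)` on crossed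
homomorphisms `f`. -/
def H1rep (hK : K ≤ Subgroup.normalizer (H : Set G)) : Representation ℝ K (H1 ρ H) where
  toFun k := (groupCohomology.map (conjHom hK k) (conjCoeff ρ hK k) 1).hom
  map_one' := by
    ext c : 1
    induction c using groupCohomology.H1_induction_on with
    | h f =>
      refine (groupCohomology.H1π_comp_map_apply (conjHom hK 1) (conjCoeff ρ hK 1) f).trans ?_
      refine congrArg (groupCohomology.H1π (coeff ρ H))
        (groupCohomology.cocycles₁_ext fun h => ?_)
      change ρ (((1 : K) : G)) (f ⟨(((1 : K) : G))⁻¹ * h * ((1 : K) : G), _⟩) = f h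
      simp
  map_mul' k k' := by
    ext c : 1
    induction c using groupCohomology.H1_induction_on with
    | h f =>
      have h1 := groupCohomology.H1π_comp_map_apply (conjHom hK (k * k'))
        (conjCoeff ρ hK (k * k')) f
      have h2 := groupCohomology.H1π_comp_map_apply (conjHom hK k') (conjCoeff ρ hK k') f
      have h3 := groupCohomology.H1π_comp_map_apply (conjHom hK k) (conjCoeff ρ hK k)
        (groupCohomology.mapCocycles₁ (conjHom hK k') (conjCoeff ρ hK k') f)
      refine h1.trans (Eq.trans ?_ (h3.symm.trans (congrArg
        (groupCohomology.map (conjHom hK k) (conjCoeff ρ hK k) 1).hom h2.symm)))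
      refine congrArg (groupCohomology.H1π (coeff ρ H))
        (groupCohomology.cocycles₁_ext fun h => ?_)
      change ρ ((k * k' : K) : G) (f ⟨((k * k' : K) : G)⁻¹ * h * ((k * k' : K) : G), _⟩) =
        ρ k (ρ k' (f ⟨(k' : G)⁻¹ * ((k : G)⁻¹ * h * k) * k', _⟩))
      simp [mul_assoc]

/-- The action `(k f)(h) = k f(k⁻¹ h k)` of `K` on `H¹(H, L; V)`, where `K` normalizes both `H`
and `L`. -/
def H1relRep (hK : K ≤ Subgroup.normalizer (H : Set G))
    (hK' : K ≤ Subgroup.normalizer (L : Set G)) : Representation ℝ K (H1rel ρ H L) where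
  toFun k :=
    { toFun := fun f => ⟨fun h => ρ k (f.1 (conjHom hK k h)), by
        refine ⟨fun g h => ?_, fun h hh => ?_⟩
        · change ρ k (f.1 (conjHom hK k (g * h))) =
            ρ k (f.1 (conjHom hK k g)) + ρ g (ρ k (f.1 (conjHom hK k h)))
          rw [map_mul, f.2.1, map_add, ← Module.End.mul_apply, ← Module.End.mul_apply, ← map_mul,
            ← map_mul]
          congr 3
          simp only [conjHom, MonoidHom.coe_mk, OneHom.coe_mk]
          group
        · change ρ k (f.1 (conjHom hK k h)) = 0
          rw [f.2.2 (conjHom hK k h) ((Subgroup.mem_normalizer_iff''.mp (hK' k.2) (h : G)).mp hh),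
            map_zero]⟩
      map_add' := fun f f' => by
        ext h
        exact map_add (ρ k) _ _
      map_smul' := fun c f => by
        ext h
        exact map_smul (ρ k) _ _ }
  map_one' := by
    ext f h
    change ρ (((1 : K) : G)) (f.1 ⟨(((1 : K) : G))⁻¹ * h * ((1 : K) : G), _⟩) = f.1 h
    simp
  map_mul' k k' := by
    ext f h
    change ρ ((k * k' : K) : G) (f.1 ⟨((k * k' : K) : G)⁻¹ * h * ((k * k' : K) : G), _⟩) =
      ρ k (ρ k' (f.1 ⟨(k' : G)⁻¹ * ((k : G)⁻¹ * h * k) * k', _⟩))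
    simp [mul_assoc]

lemma relToH1_equivariant (hK : K ≤ Subgroup.normalizer (H : Set G))
    (hK' : K ≤ Subgroup.normalizer (L : Set G)) (k : K) (f : H1rel ρ H L) :
    relToH1 ρ H L (H1relRep ρ hK hK' k f) = H1rep ρ hK k (relToH1 ρ H L f) :=
  (groupCohomology.H1π_comp_map_apply (conjHom hK k) (conjCoeff ρ hK k)
    ⟨f.1, mem_cocycles_of_mem_H1rel ρ f.2⟩).symm

/-- The image of `H¹(H, L; V) → H¹(H; V)`, with its action of `K`. -/
def imageSubrep (hK : K ≤ Subgroup.normalizer (H : Set G))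
    (hK' : K ≤ Subgroup.normalizer (L : Set G)) : Subrepresentation (H1rep ρ hK) :=
  ⟨LinearMap.range (relToH1 ρ H L), by
    rintro k _ ⟨f, rfl⟩
    exact ⟨H1relRep ρ hK hK' k f, relToH1_equivariant ρ hK hK' k f⟩⟩

/-- `0 → A → B → C → 0` is a short exact sequence of `K`-modules. -/
structure IsShortExact {K A B C : Type} [Group K] [AddCommGroup A] [AddCommGroup B]
    [AddCommGroup C] [Module ℝ A] [Module ℝ B] [Module ℝ C] (α : Representation ℝ K A)
    (β : Representation ℝ K B) (γ : Representation ℝ K C) (f : A →ₗ[ℝ] B) (g : B →ₗ[ℝ] C) :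
    Prop where
  equivariant_left : Representation.IsIntertwiningMap α β f
  equivariant_right : Representation.IsIntertwiningMap β γ g
  injective : Function.Injective f
  exact : Function.Exact f g
  surjective : Function.Surjective g

end Cohomology

/-! ### The group of the figure-eight knot -/

inductive Gen
  | x
  | y

/-- The relator of `⟨x, y | a x = y a⟩`, where `a = x y⁻¹ x⁻¹ y`. -/
def relator : FreeGroup Gen :=
  let x := FreeGroup.of Gen.x
  let y := FreeGroup.of Gen.y
  let a := x * y⁻¹ * x⁻¹ * y
  a * x * (y * a)⁻¹

/-- The fundamental group of the figure-eight knot complement `M`. -/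
abbrev Pi : Type := PresentedGroup ({relator} : Set (FreeGroup Gen))

/-- The meridian, which is also the monodromy of the bundle `F → M → S¹`. -/
def x : Pi := PresentedGroup.of Gen.x

def y : Pi := PresentedGroup.of Gen.y

def a : Pi := x * y⁻¹ * x⁻¹ * y

def b : Pi := x * y⁻¹

/-- The longitude, commuting with `x`. -/
def l : Pi := b⁻¹ * a⁻¹ * b * a

/-- The fundamental group `⟨a, b⟩` of the fiber `F`, a once-punctured torus. -/
def F : Subgroup Pi := Subgroup.closure {a, b}

/-- The fundamental group `⟨l⟩` of the boundary circle of `F`. -/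
def dF : Subgroup Pi := Subgroup.zpowers l

/-- The cyclic group `⟨x⟩`; an `x`-module is a module over this group. -/
abbrev X : Subgroup Pi := Subgroup.zpowers x

lemma a_mul_x : a * x = y * a := by
  have h : (PresentedGroup.mk ({relator} : Set (FreeGroup Gen)) relator : Pi) = 1 :=
    PresentedGroup.one_of_mem (Set.mem_singleton _)
  have h' : a * x * (y * a)⁻¹ = 1 := h
  exact mul_inv_eq_one.mp h'

lemma x_conj_a : x * a * x⁻¹ = b * a := by
  have h : a = y * a * x⁻¹ := by rw [← a_mul_x]; group
  calc x * a * x⁻¹ = x * y⁻¹ * (y * a * x⁻¹) := by group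
    _ = b * a := by rw [← h, b]

lemma x_conj_b : x * b * x⁻¹ = b * a * b := by
  calc x * b * x⁻¹ = x * a * y⁻¹ := by simp only [a, b]; group
    _ = x * y⁻¹ * (y * a) * y⁻¹ := by group
    _ = x * y⁻¹ * (a * x) * y⁻¹ := by rw [a_mul_x]
    _ = b * a * b := by simp only [b]; group

lemma x_conj_l : x * l * x⁻¹ = l := by
  calc x * l * x⁻¹
      = (x * b * x⁻¹)⁻¹ * (x * a * x⁻¹)⁻¹ * (x * b * x⁻¹) * (x * a * x⁻¹) := by
        simp only [l]; group
    _ = l := by rw [x_conj_a, x_conj_b, l]; group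

lemma X_le_normalizer_F : X ≤ Subgroup.normalizer (F : Set Pi) := by
  rw [Subgroup.zpowers_le, Subgroup.mem_normalizer_iff_map_conj_eq]
  have ha : a ∈ F := Subgroup.subset_closure (by simp)
  have hb : b ∈ F := Subgroup.subset_closure (by simp)
  apply le_antisymm
  · rw [F, MonoidHom.map_closure, Subgroup.closure_le]
    rintro _ ⟨g, (rfl | rfl), rfl⟩
    · change x * a * x⁻¹ ∈ F
      rw [x_conj_a]
      exact mul_mem hb ha
    · change x * b * x⁻¹ ∈ F
      rw [x_conj_b]
      exact mul_mem (mul_mem hb ha) hb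
  · rw [F, Subgroup.closure_le, ← F]
    rintro g (rfl | rfl)
    · refine ⟨b⁻¹ * a * a, mul_mem (mul_mem (inv_mem hb) ha) ha, ?_⟩
      have : x * (b⁻¹ * a * a) * x⁻¹
          = (x * b * x⁻¹)⁻¹ * (x * a * x⁻¹) * (x * a * x⁻¹) := by group
      simp only [MonoidHom.coe_coe, MulAut.conj_apply, this, x_conj_a, x_conj_b]
      group
    · refine ⟨a⁻¹ * b, mul_mem (inv_mem ha) hb, ?_⟩
      have : x * (a⁻¹ * b) * x⁻¹ = (x * a * x⁻¹)⁻¹ * (x * b * x⁻¹) := by group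
      simp only [MonoidHom.coe_coe, MulAut.conj_apply, this, x_conj_a, x_conj_b]
      group

lemma X_le_normalizer_dF : X ≤ Subgroup.normalizer (dF : Set Pi) := by
  rw [Subgroup.zpowers_le, Subgroup.mem_normalizer_iff_map_conj_eq, dF, MonoidHom.map_zpowers]
  simp [x_conj_l]

lemma dF_le_F : dF ≤ F := by
  have ha : a ∈ F := Subgroup.subset_closure (by simp)
  have hb : b ∈ F := Subgroup.subset_closure (by simp)
  rw [dF, Subgroup.zpowers_le]
  exact mul_mem (mul_mem (mul_mem (inv_mem hb) (inv_mem ha)) hb) ha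

/-! ### The Lorentz group and the module `𝔳` -/

/-- The matrix of the Lorentzian inner product. -/
def J : Matrix (Fin 4) (Fin 4) ℝ := diagonal ![1, 1, 1, -1]

def SO31 : Subgroup (GL (Fin 4) ℝ) where
  carrier := {g | g.1.det = 1 ∧ g.1ᵀ * J * g.1 = J}
  one_mem' := by simp
  mul_mem' {g h} hg hh := by
    refine ⟨by simp [hg.1, hh.1], ?_⟩
    calc (g.1 * h.1)ᵀ * J * (g.1 * h.1) = h.1ᵀ * (g.1ᵀ * J * g.1) * h.1 := by
          rw [transpose_mul]; simp only [Matrix.mul_assoc]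
      _ = J := by rw [hg.2, hh.2]
  inv_mem' {g} hg := by
    have h1 : g.1 * (g⁻¹).1 = 1 := g.mul_inv
    refine ⟨?_, ?_⟩
    · have := congrArg det h1
      rwa [det_mul, hg.1, one_mul, det_one] at this
    · calc (g⁻¹).1ᵀ * J * (g⁻¹).1 = (g⁻¹).1ᵀ * (g.1ᵀ * J * g.1) * (g⁻¹).1 := by rw [hg.2]
        _ = (g.1 * (g⁻¹).1)ᵀ * J * (g.1 * (g⁻¹).1) := by
          rw [transpose_mul]; simp only [Matrix.mul_assoc]
        _ = J := by rw [h1]; simp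

/-- The Lie algebra of `SO(3,1)`. -/
def so31 : Submodule ℝ (Matrix (Fin 4) (Fin 4) ℝ) where
  carrier := {B | B.trace = 0 ∧ Bᵀ * J = -(J * B)}
  zero_mem' := by simp
  add_mem' {A B} hA hB := by
    refine ⟨by simp [hA.1, hB.1], ?_⟩
    rw [transpose_add, add_mul, hA.2, hB.2, mul_add, neg_add]
  smul_mem' c A hA := by
    refine ⟨by simp [hA.1], ?_⟩
    rw [transpose_smul, smul_mul, hA.2, Matrix.mul_smul, smul_neg]

/-- The orthogonal complement of `𝔰𝔬(3,1)` in `𝔰𝔩(4,ℝ)` for the Killing form, which is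
`8 tr(AB)`. -/
def 𝔳 : Submodule ℝ (Matrix (Fin 4) (Fin 4) ℝ) where
  carrier := {A | A.trace = 0 ∧ ∀ B ∈ so31, (A * B).trace = 0}
  zero_mem' := by simp
  add_mem' {A B} hA hB := by
    refine ⟨by simp [hA.1, hB.1], fun C hC => ?_⟩
    rw [add_mul, trace_add, hA.2 C hC, hB.2 C hC, add_zero]
  smul_mem' c A hA := by
    refine ⟨by simp [hA.1], fun C hC => ?_⟩
    rw [smul_mul, trace_smul, hA.2 C hC, smul_zero]

lemma conj_mem_so31 (g : SO31) {B : Matrix (Fin 4) (Fin 4) ℝ} (hB : B ∈ so31) :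
    (g⁻¹ : SO31).1.1 * B * g.1.1 ∈ so31 := by
  have h1 : g.1.1 * (g⁻¹ : SO31).1.1 = 1 := g.1.mul_inv
  have hg : g.1.1ᵀ * J * g.1.1 = J := g.2.2
  have h2 : J * (g⁻¹ : SO31).1.1 = g.1.1ᵀ * J := by
    calc J * (g⁻¹ : SO31).1.1 = g.1.1ᵀ * J * g.1.1 * (g⁻¹ : SO31).1.1 := by rw [hg]
      _ = g.1.1ᵀ * J := by rw [Matrix.mul_assoc _ g.1.1, h1, Matrix.mul_one]
  have h3 : (g⁻¹ : SO31).1.1ᵀ * J = J * g.1.1 := by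
    have hJ : Jᵀ = J := by simp [J]
    have := congrArg transpose h2
    simpa [transpose_mul, hJ] using this
  refine ⟨?_, ?_⟩
  · rw [trace_mul_cycle, h1, Matrix.one_mul, hB.1]
  · calc ((g⁻¹ : SO31).1.1 * B * g.1.1)ᵀ * J
        = g.1.1ᵀ * (Bᵀ * ((g⁻¹ : SO31).1.1ᵀ * J)) := by
          simp only [transpose_mul, Matrix.mul_assoc]
      _ = g.1.1ᵀ * ((Bᵀ * J) * g.1.1) := by rw [h3, Matrix.mul_assoc]
      _ = -((g.1.1ᵀ * J) * B * g.1.1) := by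
          rw [hB.2]; simp only [Matrix.mul_assoc, Matrix.neg_mul, Matrix.mul_neg]
      _ = -(J * ((g⁻¹ : SO31).1.1 * B * g.1.1)) := by
          rw [← h2]; simp only [Matrix.mul_assoc]

lemma conj_mem_𝔳 (g : SO31) {A : Matrix (Fin 4) (Fin 4) ℝ} (hA : A ∈ 𝔳) :
    g.1.1 * A * (g⁻¹ : SO31).1.1 ∈ 𝔳 := by
  have h1 : (g⁻¹ : SO31).1.1 * g.1.1 = 1 := g.1.inv_mul
  refine ⟨?_, fun B hB => ?_⟩
  · rw [trace_mul_cycle, h1, Matrix.one_mul, hA.1]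
  · have := hA.2 _ (conj_mem_so31 g hB)
    rw [Matrix.mul_assoc, Matrix.mul_assoc, trace_mul_comm]
    simpa only [Matrix.mul_assoc] using this

/-- The adjoint action of `g` on `𝔳`, `A ↦ g A g⁻¹`. -/
def conjMap (g : SO31) : 𝔳 →ₗ[ℝ] 𝔳 where
  toFun A := ⟨g.1.1 * A.1 * (g⁻¹ : SO31).1.1, conj_mem_𝔳 g A.2⟩
  map_add' A B := by ext1; simp [mul_add, add_mul]
  map_smul' c A := by ext1; simp

/-- The vector space `𝔳`, as a type of its own. -/
def VSpace : Type := 𝔳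

instance : AddCommGroup VSpace := inferInstanceAs (AddCommGroup 𝔳)

instance : Module ℝ VSpace := inferInstanceAs (Module ℝ 𝔳)

/-- The adjoint representation of `SO(3,1)` on `𝔳`. -/
def Ad : Representation ℝ SO31 VSpace where
  toFun g := conjMap g
  map_one' := by
    refine LinearMap.ext fun A => Subtype.ext ?_
    change ((1 : SO31).1.1 * (A : 𝔳).1 * ((1 : SO31)⁻¹ : SO31).1.1 = (A : 𝔳).1)
    simp
  map_mul' g h := by
    refine LinearMap.ext fun A => Subtype.ext ?_
    change (g * h).1.1 * (A : 𝔳).1 * ((g * h)⁻¹ : SO31).1.1 =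
      g.1.1 * (h.1.1 * (A : 𝔳).1 * (h⁻¹ : SO31).1.1) * (g⁻¹ : SO31).1.1
    simp [Matrix.mul_assoc]

/-! ### Hyperbolic structures and their holonomy -/

/-- Shape parameters of two positively oriented ideal tetrahedra that satisfy the gluing equations
of the figure-eight knot complement. -/
structure Shape where
  z₁ : ℂ
  z₂ : ℂ
  im_pos₁ : 0 < z₁.im
  im_pos₂ : 0 < z₂.im
  gluing₁ : 2 * Complex.log z₁ + Complex.log (1 / (1 - z₁)) + Complex.log z₂
    + 2 * Complex.log (1 - 1 / z₂) = 2 * Real.pi * Complex.I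
  gluing₂ : Complex.log (1 / (1 - z₁)) + 2 * Complex.log (1 - 1 / z₁) + Complex.log z₂
    + 2 * Complex.log (1 / (1 - z₂)) = 2 * Real.pi * Complex.I

namespace Shape

variable (s : Shape)

/-- The exponential `z₁ (1 - z₂)` of the complex length of the meridian. -/
def m : ℂ := s.z₁ * (1 - s.z₂)

/-- The complex length of the meridian. On all shapes `z₁ (1 - z₂)` lies off the
negative real axis, so that the principal branch is the continuous one. -/
def u : ℂ := Complex.log s.m

/-- The image of `x`, normalized to lie in `SO(3,1)`. -/
def matX : Matrix (Fin 4) (Fin 4) ℝ :=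
  (8 * ‖s.m‖)⁻¹ •
    !![8 * s.m.re, 8 * s.m.im, -4 * s.m.re, -4 * s.m.re;
      -8 * s.m.im, 8 * s.m.re, 4 * s.m.im, 4 * s.m.im;
      4, 0, 3 + 4 * ‖s.m‖ ^ 2, -5 + 4 * ‖s.m‖ ^ 2;
      -4, 0, -3 + 4 * ‖s.m‖ ^ 2, 5 + 4 * ‖s.m‖ ^ 2]

/-- The image of `y`, normalized to lie in `SO(3,1)`. -/
def matY : Matrix (Fin 4) (Fin 4) ℝ :=
  let q := s.m * (starRingEnd ℂ) s.z₂
  (2 * ‖s.m‖)⁻¹ •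
    !![2 * s.m.re, -2 * s.m.im, 4 * q.re, -4 * q.re;
      2 * s.m.im, 2 * s.m.re, 4 * q.im, -4 * q.im;
      -4 * s.z₂.re, 4 * s.z₂.im, 1 - 4 * ‖s.z₂‖ ^ 2 + ‖s.m‖ ^ 2, 1 + 4 * ‖s.z₂‖ ^ 2 - ‖s.m‖ ^ 2;
      -4 * s.z₂.re, 4 * s.z₂.im, 1 - 4 * ‖s.z₂‖ ^ 2 - ‖s.m‖ ^ 2, 1 + 4 * ‖s.z₂‖ ^ 2 + ‖s.m‖ ^ 2]

lemma im_pos_ne (z : ℂ) (hz : 0 < z.im) : z ≠ 0 ∧ 1 - z ≠ 0 := by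
  constructor
  · rintro rfl
    simp at hz
  · intro h
    have := congrArg Complex.im h
    simp at this
    exact hz.ne' this

lemma m_ne_zero : s.m ≠ 0 :=
  mul_ne_zero (im_pos_ne _ s.im_pos₁).1 (im_pos_ne _ s.im_pos₂).2

/-- The gluing equation in multiplicative form. -/
lemma m_sq : s.m ^ 2 = (1 - s.z₁) * s.z₂ := by
  obtain ⟨h1, h1'⟩ := im_pos_ne _ s.im_pos₁
  obtain ⟨h2, h2'⟩ := im_pos_ne _ s.im_pos₂
  have h3 : 1 - 1 / s.z₂ ≠ 0 := by
    intro h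
    apply h2'
    field_simp at h
    linear_combination -h
  have h := congrArg Complex.exp s.gluing₁
  rw [Complex.exp_two_pi_mul_I, Complex.exp_add, Complex.exp_add, Complex.exp_add, two_mul,
    two_mul, Complex.exp_add, Complex.exp_add, Complex.exp_log h1,
    Complex.exp_log (one_div_ne_zero h1'), Complex.exp_log h2, Complex.exp_log h3] at h
  field_simp at h
  rw [m]
  linear_combination h

/-- The gluing equation in terms of `m` and `z₂`. -/
lemma m_rel : s.m ^ 2 * (1 - s.z₂) = s.z₂ * (1 - s.z₂) - s.m * s.z₂ := by
  rw [m_sq]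
  simp only [m]
  ring

/-- The action `A ↦ g A g*` of `g` on Hermitian `2 × 2` matrices, in the coordinates
`(4 Re A₁₂, 4 Im A₁₂, 4 A₂₂ - A₁₁, 4 A₂₂ + A₁₁)`. -/
def klein (g : Matrix (Fin 2) (Fin 2) ℂ) : Matrix (Fin 4) (Fin 4) ℝ :=
  let α := g 0 0
  let β := g 0 1
  let γ := g 1 0
  let δ := g 1 1
  let c := starRingEnd ℂ
  let n := Complex.normSq
  !![(α * c δ + β * c γ).re, -(α * c δ - β * c γ).im,
      (β * c δ).re / 2 - 2 * (α * c γ).re, (β * c δ).re / 2 + 2 * (α * c γ).re;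
    (α * c δ + β * c γ).im, (α * c δ - β * c γ).re,
      (β * c δ).im / 2 - 2 * (α * c γ).im, (β * c δ).im / 2 + 2 * (α * c γ).im;
    2 * (γ * c δ).re - (α * c β).re / 2, -2 * (γ * c δ).im + (α * c β).im / 2,
      -2 * n γ + n δ / 2 + n α / 2 - n β / 8, 2 * n γ + n δ / 2 - n α / 2 - n β / 8;
    2 * (γ * c δ).re + (α * c β).re / 2, -2 * (γ * c δ).im - (α * c β).im / 2,
      -2 * n γ + n δ / 2 - n α / 2 + n β / 8, 2 * n γ + n δ / 2 + n α / 2 + n β / 8]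

lemma klein_mul (g h : Matrix (Fin 2) (Fin 2) ℂ) : klein (g * h) = klein g * klein h := by
  rw [eta_fin_two g, eta_fin_two h, mul_fin_two]
  ext i j
  rw [Matrix.mul_apply, Fin.sum_univ_four]
  fin_cases i <;> fin_cases j <;>
    (simp only [klein, of_apply, cons_val, cons_val_zero, cons_val_one, Fin.zero_eta, Fin.mk_one,
      Fin.reduceFinMk, Complex.normSq_apply, Complex.add_re, Complex.add_im, Complex.sub_re,
      Complex.sub_im, Complex.mul_re, Complex.mul_im, Complex.conj_re, Complex.conj_im]; ring)

lemma klein_scalar (c : ℂ) : klein !![c, 0; 0, c] = Complex.normSq c • 1 := by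
  ext i j
  fin_cases i <;> fin_cases j <;> simp [klein, Complex.normSq_apply] <;> ring

def x₂ : Matrix (Fin 2) (Fin 2) ℂ := !![1, -1; 0, s.m]
def x₂' : Matrix (Fin 2) (Fin 2) ℂ := !![s.m, 1; 0, 1]
def y₂ : Matrix (Fin 2) (Fin 2) ℂ := !![s.m, 0; -s.z₂, 1]
def y₂' : Matrix (Fin 2) (Fin 2) ℂ := !![1, 0; s.z₂, s.m]

lemma matX_eq : s.matX = ‖s.m‖⁻¹ • klein s.x₂ := by
  have h : ‖s.m‖ ^ 2 = s.m.re * s.m.re + s.m.im * s.m.im := by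
    rw [← Complex.normSq_eq_norm_sq, Complex.normSq_apply]
  rw [matX, mul_inv, mul_comm, mul_smul]
  congr 1
  ext i j
  fin_cases i <;> fin_cases j <;> simp [klein, x₂, Complex.normSq_apply, h] <;> ring

lemma matY_eq : s.matY = ‖s.m‖⁻¹ • klein s.y₂ := by
  have h : ‖s.m‖ ^ 2 = s.m.re * s.m.re + s.m.im * s.m.im := by
    rw [← Complex.normSq_eq_norm_sq, Complex.normSq_apply]
  have h' : ‖s.z₂‖ ^ 2 = s.z₂.re * s.z₂.re + s.z₂.im * s.z₂.im := by
    rw [← Complex.normSq_eq_norm_sq, Complex.normSq_apply]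
  simp only [matY]
  rw [mul_inv, mul_comm, mul_smul]
  congr 1
  ext i j
  fin_cases i <;> fin_cases j <;> simp [klein, y₂, Complex.normSq_apply, h, h'] <;> ring

lemma klein_inv {g h : Matrix (Fin 2) (Fin 2) ℂ} (hgh : g * h = !![s.m, 0; 0, s.m]) :
    (‖s.m‖⁻¹ • klein g) * (‖s.m‖⁻¹ • klein h) = 1 := by
  have h0 : ‖s.m‖ ≠ 0 := norm_ne_zero_iff.mpr s.m_ne_zero
  rw [Matrix.smul_mul, Matrix.mul_smul, ← klein_mul, hgh, klein_scalar, smul_smul, smul_smul,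
    Complex.normSq_eq_norm_sq]
  convert one_smul ℝ (1 : Matrix (Fin 4) (Fin 4) ℝ) using 2
  field_simp

/-- The image of `x` in `GL(4,ℝ)`. -/
def glX : GL (Fin 4) ℝ where
  val := s.matX
  inv := ‖s.m‖⁻¹ • klein s.x₂'
  val_inv := by
    rw [matX_eq]
    exact s.klein_inv (by ext i j; fin_cases i <;> fin_cases j <;> simp [x₂, x₂'])
  inv_val := by
    rw [matX_eq]
    exact s.klein_inv (by ext i j; fin_cases i <;> fin_cases j <;> simp [x₂, x₂'])

/-- The image of `y` in `GL(4,ℝ)`. -/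
def glY : GL (Fin 4) ℝ where
  val := s.matY
  inv := ‖s.m‖⁻¹ • klein s.y₂'
  val_inv := by
    rw [matY_eq]
    exact s.klein_inv (by
      ext i j; fin_cases i <;> fin_cases j <;> simp [y₂, y₂'])
  inv_val := by
    rw [matY_eq]
    exact s.klein_inv (by
      ext i j; fin_cases i <;> fin_cases j <;> simp [y₂, y₂']; ring)

lemma klein_lorentz (g : Matrix (Fin 2) (Fin 2) ℂ) :
    (klein g)ᵀ * J * klein g = Complex.normSq g.det • J := by
  ext i j
  rw [J, Matrix.mul_apply, Fin.sum_univ_four, det_fin_two]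
  simp only [Matrix.mul_diagonal, transpose_apply, Matrix.smul_apply, diagonal_apply,
    smul_eq_mul]
  fin_cases i <;> fin_cases j <;>
    (simp [klein, of_apply, cons_val, cons_val_zero, cons_val_one, Fin.zero_eta, Fin.mk_one,
      Fin.reduceFinMk, Complex.normSq_apply, Complex.add_re, Complex.add_im, Complex.sub_re,
      Complex.sub_im, Complex.mul_re, Complex.mul_im, Complex.conj_re, Complex.conj_im]; ring)

lemma glX_mem : s.glX ∈ SO31 := by
  have h0 : ‖s.m‖ ≠ 0 := norm_ne_zero_iff.mpr s.m_ne_zero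
  refine ⟨?_, ?_⟩
  · change s.matX.det = 1
    rw [matX_eq, det_smul]
    have h : (klein s.x₂).det = Complex.normSq s.m ^ 2 := by
      simp [klein, x₂, det_succ_row_zero, Fin.sum_univ_succ, Fin.succAbove, Complex.normSq_apply]
      ring
    rw [h, Complex.normSq_eq_norm_sq]
    simp only [Fintype.card_fin]
    field_simp
  · change s.matXᵀ * J * s.matX = J
    rw [matX_eq, transpose_smul, Matrix.smul_mul, Matrix.smul_mul, Matrix.mul_smul, klein_lorentz,
      smul_smul, smul_smul, Complex.normSq_eq_norm_sq]
    convert one_smul ℝ J using 2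
    simp [x₂, det_fin_two]
    field_simp

lemma glY_mem : s.glY ∈ SO31 := by
  have h0 : ‖s.m‖ ≠ 0 := norm_ne_zero_iff.mpr s.m_ne_zero
  refine ⟨?_, ?_⟩
  · change s.matY.det = 1
    rw [matY_eq, det_smul]
    have h : (klein s.y₂).det = Complex.normSq s.m ^ 2 := by
      simp [klein, y₂, det_succ_row_zero, Fin.sum_univ_succ, Fin.succAbove, Complex.normSq_apply]
      ring
    rw [h, Complex.normSq_eq_norm_sq]
    simp only [Fintype.card_fin]
    field_simp
  · change s.matYᵀ * J * s.matY = J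
    rw [matY_eq, transpose_smul, Matrix.smul_mul, Matrix.smul_mul, Matrix.mul_smul, klein_lorentz,
      smul_smul, smul_smul, Complex.normSq_eq_norm_sq]
    convert one_smul ℝ J using 2
    simp [y₂, det_fin_two]
    field_simp

lemma word_rel : s.x₂ * s.y₂' * s.x₂' * s.y₂ * s.x₂ = s.y₂ * (s.x₂ * s.y₂' * s.x₂' * s.y₂) := by
  have h := s.m_rel
  ext i j
  fin_cases i <;> fin_cases j <;> simp [x₂, y₂, x₂', y₂', Matrix.mul_apply, Fin.sum_univ_succ]
  · linear_combination (1 - s.m) * h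
  · linear_combination -h
  · right
    linear_combination h
  · linear_combination (s.m - 1) * h

lemma gl_rel : s.glX * s.glY⁻¹ * s.glX⁻¹ * s.glY * s.glX =
    s.glY * (s.glX * s.glY⁻¹ * s.glX⁻¹ * s.glY) := by
  ext1
  change s.matX * (‖s.m‖⁻¹ • klein s.y₂') * (‖s.m‖⁻¹ • klein s.x₂') * s.matY * s.matX =
    s.matY * (s.matX * (‖s.m‖⁻¹ • klein s.y₂') * (‖s.m‖⁻¹ • klein s.x₂') * s.matY)
  simp only [matX_eq, matY_eq, Matrix.smul_mul, Matrix.mul_smul, ← klein_mul, word_rel]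

/-- The holonomy representation, lifted from `PSO(3,1)` to `SO(3,1)`. -/
def holonomy : Pi →* SO31 :=
  PresentedGroup.toGroup (f := fun g => match g with
    | Gen.x => ⟨s.glX, s.glX_mem⟩
    | Gen.y => ⟨s.glY, s.glY_mem⟩) (by
    rintro _ rfl
    simp only [relator, map_mul, map_inv, FreeGroup.lift_apply_of]
    rw [← Subtype.val_inj, mul_inv_eq_one.mpr]
    exact Subtype.ext s.gl_rel)

/-- The `π₁(M)`-module `𝔳_u`. -/
def adRep : Representation ℝ Pi VSpace := Ad.comp s.holonomy

/-- The space of complex lengths of the meridian, parametrizing the holonomy representations. -/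
def U : Set ℂ := Set.range u

/-- The shape `exp(π i / 3)` of the regular ideal tetrahedron. -/
def ω : ℂ := Complex.exp ((Real.pi / 3 : ℝ) * Complex.I)

lemma ω_eq : ω = 1 / 2 + (Real.sqrt 3 / 2 : ℝ) * Complex.I := by
  rw [ω, Complex.exp_mul_I, ← Complex.ofReal_cos, ← Complex.ofReal_sin, Real.cos_pi_div_three,
    Real.sin_pi_div_three]
  push_cast
  rfl

lemma ω_sq : ω ^ 2 = ω - 1 := by
  have h : ((Real.sqrt 3 : ℝ) : ℂ) ^ 2 = 3 := by
    rw [← Complex.ofReal_pow, Real.sq_sqrt (by norm_num)]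
    norm_num
  rw [ω_eq]
  push_cast
  linear_combination (Complex.I ^ 2 / 4) * h + (3 / 4) * Complex.I_sq

lemma ω_im_pos : 0 < ω.im := by
  rw [ω_eq]
  simp

lemma log_ω : Complex.log ω = (Real.pi / 3 : ℝ) * Complex.I := by
  have := Real.pi_pos
  rw [ω, Complex.log_exp] <;> simp <;> linarith

lemma ω_identities : 1 / (1 - ω) = ω ∧ 1 - 1 / ω = ω := by
  obtain ⟨h, h'⟩ := im_pos_ne _ ω_im_pos
  constructor
  · rw [div_eq_iff h']
    linear_combination ω_sq
  · rw [sub_eq_iff_eq_add, ← sub_eq_iff_eq_add', eq_div_iff h]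
    linear_combination -ω_sq

/-- The complete structure, `z₁ = z₂ = exp(π i / 3)`. -/
def complete : Shape where
  z₁ := ω
  z₂ := ω
  im_pos₁ := ω_im_pos
  im_pos₂ := ω_im_pos
  gluing₁ := by
    rw [ω_identities.1, ω_identities.2, log_ω]
    push_cast
    ring
  gluing₂ := by
    rw [ω_identities.1, ω_identities.2, log_ω]
    push_cast
    ring

/-- `H¹(F; 𝔳_u)`. -/
abbrev H1F : Type := H1 s.adRep F

/-- `H¹(∂F; 𝔳_u) = H¹(l; 𝔳_u)`. -/
abbrev H1dF : Type := H1 s.adRep dF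

/-- `H¹(F, ∂F; 𝔳_u)`. -/
abbrev H1FdF : Type := H1rel s.adRep F dF

/-- The `x`-module structure of `H¹(F; 𝔳_u)`. -/
abbrev repF : Representation ℝ X s.H1F := H1rep s.adRep X_le_normalizer_F

/-- The `x`-module structure of `H¹(∂F; 𝔳_u)`. -/
abbrev repdF : Representation ℝ X s.H1dF := H1rep s.adRep X_le_normalizer_dF

/-- The `x`-module structure of `H¹(F, ∂F; 𝔳_u)`. -/
abbrev repFdF : Representation ℝ X s.H1FdF :=
  H1relRep s.adRep X_le_normalizer_F X_le_normalizer_dF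

/-- The `x`-module `I_u`, the image of `H¹(F, ∂F; 𝔳_u) → H¹(F; 𝔳_u)`. -/
abbrev I : Subrepresentation s.repF := imageSubrep s.adRep X_le_normalizer_F X_le_normalizer_dF

end Shape

/-- The generator of `⟨x⟩`. -/
def xGen : X := ⟨x, Subgroup.mem_zpowers x⟩

end FigureEight

end

noncomputable section

namespace FigureEight

/-! The group ⟨a, b⟩ is free, so a crossed homomorphism on it is an arbitrary pair of values in 𝔳 ×
𝔳. Coboundaries, the action of x and the value at l become the linear maps `delta`, `twist` and
`boundary`, and the cohomology becomes linear algebra on 𝔳 × 𝔳.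

The short exact sequence depends on restriction to the boundary being onto. Up to an invertible
factor `boundary` is (p, q) ↦ (b - 1)p + (1 - a)q, so the requirement is (a - 1)𝔳 + (b - 1)𝔳 = 𝔳.
The trace form makes 𝔳 self-dual, which turns this into the absence of nonzero vectors fixed by a
and b (`Shape.eq_zero_of_fiber_invariant`). Now 𝔳 is the space of Hermitian forms on Sym² ℂ², and
Sym² ℂ² is the adjoint representation, so a fixed vector gives an intertwiner between that
representation of the fiber group and its complex conjugate. It must vanish unless certain
invariants of the holonomy are all real. These are functions of r = m / z₂, and positivity of the
tetrahedra keeps r off the real line.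

For the fixed spaces of x, note that x - 1 has kernel and cokernel of equal dimension. The vector x
+ x⁻¹ - scalar of 𝔳 is fixed by x and l; pairing with it gives a nonzero functional on the cokernel
for H¹(l), hence on that for H¹(F), so both dimensions are at least 1 for every shape. They are at
most 1 if a single class spans the cokernel (`finrank_invariants_eq_one`). That is an open
condition, so it is enough to check it at u = 0 and to know that shapes with small u are close to
the complete one. Solving a quadratic equation for z₂ shows that every small u is a parameter.

At u = 0 the holonomy has entries in ℤ[ω], so 𝔳 carries an integral structure and the action of x is
computed exactly. A cyclic vector in each of the two cohomology groups yields the characteristic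
polynomial. Cyclicity also makes the cokernel of x - 1 one-dimensional, although 1 is a triple root.
-/

/-! ### The fiber group is free -/

/-- The monodromy, as an automorphism of the free group on `a = of false` and `b = of true`. -/
def monodromy : FreeGroup Bool ≃* FreeGroup Bool :=
  MonoidHom.toMulEquiv
    (FreeGroup.lift fun i => cond i
      (FreeGroup.of true * FreeGroup.of false * FreeGroup.of true)
      (FreeGroup.of true * FreeGroup.of false))
    (FreeGroup.lift fun i => cond i
      ((FreeGroup.of false)⁻¹ * FreeGroup.of true)
      ((FreeGroup.of true)⁻¹ * FreeGroup.of false * FreeGroup.of false))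
    (by ext i; cases i <;> simp [mul_assoc])
    (by ext i; cases i <;> simp [mul_assoc])

lemma monodromy_of_false :
    monodromy (FreeGroup.of false) = FreeGroup.of true * FreeGroup.of false := by
  simp [monodromy, MonoidHom.toMulEquiv]

lemma monodromy_symm_of_true :
    monodromy.symm (FreeGroup.of true) = (FreeGroup.of false)⁻¹ * FreeGroup.of true := by
  simp [monodromy, MonoidHom.toMulEquiv]

/-- The action of `π₁(M)` on the free group in which `x` acts by the monodromy and `b` by left
translation. -/
def freeAction : Pi →* Equiv.Perm (FreeGroup Bool) :=
  PresentedGroup.toGroup (f := fun g => match g with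
    | Gen.x => monodromy.toEquiv
    -- Forced by y = b⁻¹ x.
    | Gen.y => (Equiv.mulLeft (FreeGroup.of true))⁻¹ * monodromy.toEquiv) (by
    rintro _ rfl
    simp only [relator, map_mul, map_inv, FreeGroup.lift_apply_of]
    rw [mul_inv_eq_one]
    ext g
    simp [Equiv.Perm.mul_apply, Equiv.Perm.inv_def, monodromy_of_false,
      monodromy_symm_of_true, mul_assoc])

lemma freeAction_x (g : FreeGroup Bool) : freeAction x g = monodromy g := rfl

lemma freeAction_y (g : FreeGroup Bool) :
    freeAction y g = (FreeGroup.of true)⁻¹ * monodromy g := rfl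

lemma freeAction_x_inv (g : FreeGroup Bool) : freeAction x⁻¹ g = monodromy.symm g := rfl

lemma freeAction_y_inv (g : FreeGroup Bool) :
    freeAction y⁻¹ g = monodromy.symm (FreeGroup.of true * g) := by
  rw [map_inv, Equiv.Perm.inv_eq_iff_eq, freeAction_y]
  simp

lemma freeAction_b (g : FreeGroup Bool) : freeAction b g = FreeGroup.of true * g := by
  rw [b, map_mul, Equiv.Perm.mul_apply, freeAction_y_inv, freeAction_x]
  simp

lemma freeAction_a (g : FreeGroup Bool) : freeAction a g = FreeGroup.of false * g := by
  rw [a, map_mul, map_mul, Equiv.Perm.mul_apply, Equiv.Perm.mul_apply, freeAction_y,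
    freeAction_x_inv]
  refine (freeAction_b _).trans ?_
  simp [monodromy_symm_of_true, mul_assoc]

/-- The generator `a` of the fiber group. -/
def aF : F := ⟨a, Subgroup.subset_closure (by simp)⟩

/-- The generator `b` of the fiber group. -/
def bF : F := ⟨b, Subgroup.subset_closure (by simp)⟩

/-- The boundary loop in the fiber group. -/
def lF : F := ⟨l, dF_le_F (Subgroup.mem_zpowers l)⟩

lemma lF_eq : lF = bF⁻¹ * aF⁻¹ * bF * aF := rfl

lemma closure_aF_bF : Subgroup.closure {aF, bF} = (⊤ : Subgroup F) := by
  rw [eq_top_iff]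
  rintro ⟨g, hg⟩ -
  have h : (Subgroup.closure {aF, bF}).map F.subtype = F := by
    rw [MonoidHom.map_closure, Set.image_pair]
    rfl
  have hg' := hg
  rw [← h] at hg'
  obtain ⟨k, hk, hkg⟩ := hg'
  rwa [show (⟨g, hg⟩ : F) = k from Subtype.ext hkg.symm]

/-- The homomorphism from the free group on `a`, `b` to the fiber group. -/
def freeToF : FreeGroup Bool →* F := FreeGroup.lift fun i => cond i bF aF

/-- Evaluating the translation at 1 recovers the word w from its image in π₁(M), so a and b satisfy
no relation. -/
lemma freeAction_freeToF (w g : FreeGroup Bool) : freeAction (freeToF w : Pi) g = w * g := by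
  induction w using FreeGroup.induction_on generalizing g with
  | C1 => simp
  | of i =>
    cases i
    · simpa [freeToF, aF] using freeAction_a g
    · simpa [freeToF, bF] using freeAction_b g
  | inv_of i ih =>
    rw [map_inv, Subgroup.coe_inv, map_inv, Equiv.Perm.inv_eq_iff_eq, ih]
    simp
  | mul u v hu hv => rw [map_mul, Subgroup.coe_mul, map_mul, Equiv.Perm.mul_apply, hv, hu, mul_assoc]

lemma freeToF_bijective : Function.Bijective freeToF := by
  constructor
  · intro w w' h
    have := freeAction_freeToF w 1
    rw [h, freeAction_freeToF] at this
    simpa using this.symm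
  · rw [← MonoidHom.range_eq_top, eq_top_iff, ← closure_aF_bF, Subgroup.closure_le]
    rintro g (rfl | rfl)
    · exact ⟨FreeGroup.of false, by simp [freeToF]⟩
    · exact ⟨FreeGroup.of true, by simp [freeToF]⟩

/-- The fiber group is free on `a` and `b`. -/
def freeEquivF : FreeGroup Bool ≃* F := MulEquiv.ofBijective freeToF freeToF_bijective

lemma freeEquivF_symm_aF : freeEquivF.symm aF = FreeGroup.of false := by
  rw [MulEquiv.symm_apply_eq]
  simp [freeEquivF, freeToF]

lemma freeEquivF_symm_bF : freeEquivF.symm bF = FreeGroup.of true := by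
  rw [MulEquiv.symm_apply_eq]
  simp [freeEquivF, freeToF]

/-! ### Crossed homomorphisms on the fiber group -/

section Cocycles

variable {V : Type} [AddCommGroup V] [Module ℝ V] (ρ : Representation ℝ Pi V)

/-- The affine bijection `v ↦ ρ g v + w`. -/
def affinePerm (g : Pi) (w : V) : Equiv.Perm V where
  toFun v := ρ g v + w
  invFun v := ρ g⁻¹ (v - w)
  left_inv v := by simp
  right_inv v := by simp

/-- The affine action of the free group whose linear part is `ρ` and in which the generators
translate by `p.1` and `p.2`. -/
def affineAction (p : V × V) : FreeGroup Bool →* Equiv.Perm V :=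
  FreeGroup.lift fun i => cond i (affinePerm ρ b p.2) (affinePerm ρ a p.1)

/-- The orbit map of the origin under an affine action is a crossed homomorphism for the linear
part. This produces cocycles with prescribed values at the generators. -/
lemma affineAction_apply (p : V × V) (w : FreeGroup Bool) (v : V) :
    affineAction ρ p w v = ρ (freeEquivF w : Pi) v + affineAction ρ p w 0 := by
  induction w using FreeGroup.induction_on generalizing v with
  | C1 => simp
  | of i =>
    cases i <;> simp [affineAction, affinePerm, freeEquivF, freeToF, aF, bF]
  | inv_of i ih =>
    have key : ∀ u, affineAction ρ p (FreeGroup.of i)⁻¹ u =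
        ρ (freeEquivF (FreeGroup.of i) : Pi)⁻¹ (u - affineAction ρ p (FreeGroup.of i) 0) := by
      intro u
      rw [map_inv, Equiv.Perm.inv_eq_iff_eq, ih]
      simp
    rw [key v, key 0, map_inv freeEquivF, Subgroup.coe_inv, ← map_add, zero_sub, sub_eq_add_neg]
  | mul u w hu hw =>
    simp only [map_mul, Equiv.Perm.mul_apply]
    rw [hu, hw, hu (affineAction ρ p w 0)]
    simp [add_assoc]

lemma cocycle_mul {H : Subgroup Pi} (f : groupCohomology.cocycles₁ (coeff ρ H)) (g h : H) :
    f (g * h) = ρ g (f h) + f g :=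
  (groupCohomology.mem_cocycles₁_iff (A := coeff ρ H) f).mp f.2 g h

lemma cocycle_inv {H : Subgroup Pi} (f : groupCohomology.cocycles₁ (coeff ρ H)) (g : H) :
    f g⁻¹ = -ρ (g : Pi)⁻¹ (f g) := by
  have h := cocycle_mul ρ f g⁻¹ g
  rw [inv_mul_cancel, groupCohomology.cocycles₁_map_one] at h
  rw [eq_neg_iff_add_eq_zero, add_comm]
  exact h.symm

/-- The values of a crossed homomorphism at the two generators of the fiber group. -/
def evalGens : groupCohomology.cocycles₁ (coeff ρ F) →ₗ[ℝ] V × V where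
  toFun f := (f aF, f bF)
  map_add' _ _ := rfl
  map_smul' _ _ := rfl

lemma evalGens_bijective : Function.Bijective (evalGens ρ) := by
  constructor
  · rw [injective_iff_map_eq_zero]
    intro f hf
    have ha : f aF = 0 := congrArg Prod.fst hf
    have hb : f bF = 0 := congrArg Prod.snd hf
    refine groupCohomology.cocycles₁_ext fun g => ?_
    change f g = 0
    have hg : g ∈ Subgroup.closure {aF, bF} := by rw [closure_aF_bF]; trivial
    induction hg using Subgroup.closure_induction with
    | mem g hg =>
      rcases hg with rfl | rfl
      exacts [ha, hb]
    | one => exact groupCohomology.cocycles₁_map_one f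
    | mul g h _ _ hg hh => rw [cocycle_mul, hg, hh]; simp
    | inv g _ hg => rw [cocycle_inv, hg]; simp
  · intro p
    refine ⟨⟨fun g => affineAction ρ p (freeEquivF.symm g) 0, ?_⟩, ?_⟩
    · refine (groupCohomology.mem_cocycles₁_iff (A := coeff ρ F) _).mpr fun g h => ?_
      rw [map_mul, map_mul, Equiv.Perm.mul_apply, affineAction_apply]
      simp
    · refine Prod.ext ?_ ?_
      · change affineAction ρ p (freeEquivF.symm aF) 0 = p.1
        rw [freeEquivF_symm_aF]
        simp [affineAction, affinePerm]
      · change affineAction ρ p (freeEquivF.symm bF) 0 = p.2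
        rw [freeEquivF_symm_bF]
        simp [affineAction, affinePerm]

/-- A crossed homomorphism on the free group `⟨a, b⟩` is determined by its arbitrary values at
`a` and `b`. -/
def evalEquiv : groupCohomology.cocycles₁ (coeff ρ F) ≃ₗ[ℝ] V × V :=
  LinearEquiv.ofBijective (evalGens ρ) (evalGens_bijective ρ)

/-- The coboundary of a vector, by its values at `a` and `b`. -/
def delta : V →ₗ[ℝ] V × V := (ρ a - 1).prod (ρ b - 1)

/-- The action of `x` on crossed homomorphisms, by their values at `a` and `b`. -/
def twist : V × V →ₗ[ℝ] V × V :=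
  (ρ (x * b⁻¹) ∘ₗ (((1 + ρ a) ∘ₗ LinearMap.fst ℝ V V) - LinearMap.snd ℝ V V)).prod
    (ρ (x * a⁻¹) ∘ₗ (LinearMap.snd ℝ V V - LinearMap.fst ℝ V V))

lemma twist_apply (p : V × V) : twist ρ p =
    (ρ (x * b⁻¹) (p.1 + ρ a p.1 - p.2), ρ (x * a⁻¹) (p.2 - p.1)) := rfl

/-- The value at the boundary loop of a crossed homomorphism, by its values at `a` and `b`. -/
def boundary : V × V →ₗ[ℝ] V :=
  ρ (b⁻¹ * a⁻¹) ∘ₗ ((ρ b - 1) ∘ₗ LinearMap.fst ℝ V V + (1 - ρ a) ∘ₗ LinearMap.snd ℝ V V)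

/-- Expansion of the cocycle rule along b⁻¹a⁻¹ba; after the common factor b⁻¹a⁻¹ is taken out, the
Fox derivatives of the commutator are b - 1 and 1 - a. -/
lemma apply_lF (f : groupCohomology.cocycles₁ (coeff ρ F)) :
    f lF = boundary ρ (evalGens ρ f) := by
  rw [lF_eq, cocycle_mul, cocycle_mul, cocycle_mul, cocycle_inv, cocycle_inv]
  simp only [boundary, evalGens, aF, bF, LinearMap.coe_mk, AddHom.coe_mk, LinearMap.comp_apply,
    LinearMap.add_apply, LinearMap.sub_apply, LinearMap.fst_apply, LinearMap.snd_apply, map_mul,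
    Module.End.mul_apply, Module.End.one_apply, map_add, map_sub, map_neg, Subgroup.coe_mul,
    Subgroup.coe_inv, Representation.inv_self_apply]
  abel

lemma boundary_surjective (h : LinearMap.range (ρ a - 1) ⊔ LinearMap.range (ρ b - 1) = ⊤) :
    Function.Surjective (boundary ρ) := by
  intro v
  -- The factor `ρ (a * b)` cancels the outer `ρ (b⁻¹ * a⁻¹)` of `boundary`.
  have hv : ρ (a * b) v ∈ LinearMap.range (ρ a - 1) ⊔ LinearMap.range (ρ b - 1) := by
    rw [h]; trivial
  obtain ⟨_, ⟨p, rfl⟩, _, ⟨q, rfl⟩, hpq⟩ := Submodule.mem_sup.mp hv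
  refine ⟨(q, -p), ?_⟩
  have : (ρ b - 1) q + (1 - ρ a) (-p) = ρ (a * b) v := by
    rw [← hpq]
    simp only [LinearMap.sub_apply, map_neg, Module.End.one_apply]
    abel
  change ρ (b⁻¹ * a⁻¹) ((ρ b - 1) q + (1 - ρ a) (-p)) = v
  rw [this, ← _root_.mul_inv_rev, Representation.inv_self_apply]

/-- The class in `H¹(F; V)` of the crossed homomorphism with given values at `a` and `b`. -/
def classOf : V × V →ₗ[ℝ] H1 ρ F :=
  (groupCohomology.H1π (coeff ρ F)).hom ∘ₗ (evalEquiv ρ).symm.toLinearMap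

lemma classOf_evalGens (f : groupCohomology.cocycles₁ (coeff ρ F)) :
    classOf ρ (evalGens ρ f) = groupCohomology.H1π (coeff ρ F) f :=
  congrArg (groupCohomology.H1π (coeff ρ F)) ((evalEquiv ρ).symm_apply_apply f)

lemma classOf_surjective : Function.Surjective (classOf ρ) := by
  intro c
  induction c using groupCohomology.H1_induction_on with
  | h f => exact ⟨_, classOf_evalGens ρ f⟩

lemma ker_classOf : LinearMap.ker (classOf ρ) = LinearMap.range (delta ρ) := by
  ext p
  obtain ⟨f, rfl⟩ := (evalGens_bijective ρ).2 p
  rw [LinearMap.mem_ker, classOf_evalGens, groupCohomology.H1π_eq_zero_iff]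
  constructor
  · rintro ⟨v, hv⟩
    exact ⟨v, Prod.ext (congrFun hv aF) (congrFun hv bF)⟩
  · rintro ⟨v, hv⟩
    refine ⟨v, ?_⟩
    have : (⟨_, groupCohomology.d₀₁_apply_mem_cocycles₁ (A := coeff ρ F) v⟩ :
        groupCohomology.cocycles₁ (coeff ρ F)) = f := (evalGens_bijective ρ).1 hv
    exact congrArg Subtype.val this

/-- The action of `x` on crossed homomorphisms on the fiber group, at the generators. -/
lemma twist_spec (f f' : groupCohomology.cocycles₁ (coeff ρ F))
    (h : ∀ g : F, f' g = ρ x (f (conjHom X_le_normalizer_F xGen g))) :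
    evalGens ρ f' = twist ρ (evalGens ρ f) := by
  -- The action of x on cocycles evaluates f at x⁻¹gx, so it is the inverse monodromy a ↦ b⁻¹aa, b ↦
  -- a⁻¹b that enters.
  have ha : conjHom X_le_normalizer_F xGen aF = bF⁻¹ * aF * aF := by
    apply Subtype.ext
    change x⁻¹ * a * x = b⁻¹ * a * a
    have : x * (b⁻¹ * a * a) * x⁻¹ = a := by
      calc x * (b⁻¹ * a * a) * x⁻¹
          = (x * b * x⁻¹)⁻¹ * (x * a * x⁻¹) * (x * a * x⁻¹) := by group
        _ = a := by rw [x_conj_a, x_conj_b]; group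
    calc x⁻¹ * a * x = x⁻¹ * (x * (b⁻¹ * a * a) * x⁻¹) * x := by rw [this]
      _ = b⁻¹ * a * a := by group
  have hb : conjHom X_le_normalizer_F xGen bF = aF⁻¹ * bF := by
    apply Subtype.ext
    change x⁻¹ * b * x = a⁻¹ * b
    have : x * (a⁻¹ * b) * x⁻¹ = b := by
      calc x * (a⁻¹ * b) * x⁻¹ = (x * a * x⁻¹)⁻¹ * (x * b * x⁻¹) := by group
        _ = b := by rw [x_conj_a, x_conj_b]; group
    calc x⁻¹ * b * x = x⁻¹ * (x * (a⁻¹ * b) * x⁻¹) * x := by rw [this]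
      _ = a⁻¹ * b := by group
  refine Prod.ext ?_ ?_
  · change f' aF = _
    rw [h, ha, cocycle_mul, cocycle_mul, cocycle_inv]
    simp only [twist_apply, evalGens, aF, bF, LinearMap.coe_mk, AddHom.coe_mk, map_mul,
      Module.End.mul_apply, map_add, map_sub, map_neg, Subgroup.coe_mul, Subgroup.coe_inv]
    abel
  · change f' bF = _
    rw [h, hb, cocycle_mul, cocycle_inv]
    simp only [twist_apply, evalGens, aF, bF, LinearMap.coe_mk, AddHom.coe_mk, map_mul,
      Module.End.mul_apply, map_add, map_sub, map_neg, Subgroup.coe_inv]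
    abel

lemma H1rep_classOf (p : V × V) :
    H1rep ρ X_le_normalizer_F xGen (classOf ρ p) = classOf ρ (twist ρ p) := by
  obtain ⟨f, rfl⟩ := (evalGens_bijective ρ).2 p
  rw [classOf_evalGens]
  refine (groupCohomology.H1π_comp_map_apply (conjHom X_le_normalizer_F xGen)
    (conjCoeff ρ X_le_normalizer_F xGen) f).trans ?_
  refine (classOf_evalGens ρ _).symm.trans (congrArg (classOf ρ) ?_)
  exact twist_spec ρ f _ fun g => rfl

/-! ### Relative crossed homomorphisms -/

lemma cocycle_zpow_eq_zero {H : Subgroup Pi} (f : groupCohomology.cocycles₁ (coeff ρ H)) {h : H}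
    (hf : f h = 0) (n : ℤ) : f (h ^ n) = 0 := by
  induction n using Int.induction_on with
  | zero => simp
  | succ n ih => rw [_root_.zpow_add_one, cocycle_mul, hf, ih]; simp
  | pred n ih => rw [_root_.zpow_sub_one, cocycle_mul, cocycle_inv, hf, ih]; simp

lemma eq_zero_on_dF_iff (f : groupCohomology.cocycles₁ (coeff ρ F)) :
    (∀ h : F, (h : Pi) ∈ dF → f h = 0) ↔ f lF = 0 := by
  refine ⟨fun h => h lF (Subgroup.mem_zpowers l), fun h => ?_⟩
  rintro ⟨g, hg⟩ ⟨n, hn⟩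
  rw [show (⟨g, hg⟩ : F) = lF ^ n from Subtype.ext hn.symm]
  exact cocycle_zpow_eq_zero ρ f h n

/-- The values at `a` and `b` identify `H¹(F, ∂F; V)` with the kernel of `boundary`. -/
def relEquiv : H1rel ρ F dF ≃ₗ[ℝ] LinearMap.ker (boundary ρ) :=
  LinearEquiv.ofBijective
    (LinearMap.codRestrict (LinearMap.ker (boundary ρ))
      { toFun := fun f => (f.1 aF, f.1 bF)
        map_add' := fun _ _ => rfl
        map_smul' := fun _ _ => rfl }
      fun f => by
        have := apply_lF ρ ⟨f.1, mem_cocycles_of_mem_H1rel ρ f.2⟩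
        exact this.symm.trans (f.2.2 lF (Subgroup.mem_zpowers l))) (by
    constructor
    · intro f f' h
      have h' : (⟨f.1, mem_cocycles_of_mem_H1rel ρ f.2⟩ :
          groupCohomology.cocycles₁ (coeff ρ F)) = ⟨f'.1, mem_cocycles_of_mem_H1rel ρ f'.2⟩ :=
        (evalGens_bijective ρ).1 (congrArg Subtype.val h)
      exact Subtype.ext (congrArg (fun g => (g.1 : F → V)) h')
    · rintro ⟨p, hp⟩
      obtain ⟨f, rfl⟩ := (evalGens_bijective ρ).2 p
      rw [LinearMap.mem_ker, ← apply_lF] at hp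
      exact ⟨⟨f.1, fun g h => (cocycle_mul ρ f g h).trans (add_comm _ _),
        (eq_zero_on_dF_iff ρ f).mpr hp⟩, rfl⟩)

lemma relEquiv_H1relRep (f : H1rel ρ F dF) :
    (relEquiv ρ (H1relRep ρ X_le_normalizer_F X_le_normalizer_dF xGen f) : V × V) =
      twist ρ (relEquiv ρ f) :=
  twist_spec ρ ⟨f.1, mem_cocycles_of_mem_H1rel ρ f.2⟩
    ⟨_, mem_cocycles_of_mem_H1rel ρ
      (H1relRep ρ X_le_normalizer_F X_le_normalizer_dF xGen f).2⟩ fun _ => rfl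

end Cocycles

/-! ### The exact sequence of the pair -/

section ExactSequence

variable {V : Type} [AddCommGroup V] [Module ℝ V] (ρ : Representation ℝ Pi V)

/-- The generator of the boundary group. -/
def lGen : dF := ⟨l, Subgroup.mem_zpowers l⟩

lemma cocycle_dF_ext {f g : groupCohomology.cocycles₁ (coeff ρ dF)} (h : f lGen = g lGen) :
    f = g := by
  rw [← sub_eq_zero]
  refine groupCohomology.cocycles₁_ext fun k => ?_
  obtain ⟨k, n, hn⟩ := k
  rw [show (⟨k, n, hn⟩ : dF) = lGen ^ n from Subtype.ext hn.symm]
  refine cocycle_zpow_eq_zero ρ (f - g) ?_ n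
  change f lGen - g lGen = 0
  rw [h, sub_self]

/-- The restriction to the boundary of a crossed homomorphism on the fiber group. -/
def resCocycle (f : groupCohomology.cocycles₁ (coeff ρ F)) :
    groupCohomology.cocycles₁ (coeff ρ dF) :=
  groupCohomology.mapCocycles₁ (A := coeff ρ F) (B := coeff ρ dF) (Subgroup.inclusion dF_le_F)
    (Rep.ofHom ⟨LinearMap.id, fun _ => rfl⟩) f

lemma res_H1π (f : groupCohomology.cocycles₁ (coeff ρ F)) :
    res ρ dF_le_F (groupCohomology.H1π (coeff ρ F) f) =
      groupCohomology.H1π (coeff ρ dF) (resCocycle ρ f) :=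
  groupCohomology.H1π_comp_map_apply (A := coeff ρ F) (B := coeff ρ dF)
    (Subgroup.inclusion dF_le_F) (Rep.ofHom ⟨LinearMap.id, fun _ => rfl⟩) f

lemma res_H1rep (k : X) (c : H1 ρ F) :
    res ρ dF_le_F (H1rep ρ X_le_normalizer_F k c) =
      H1rep ρ X_le_normalizer_dF k (res ρ dF_le_F c) := by
  induction c using groupCohomology.H1_induction_on with
  | h f =>
    have h1 := groupCohomology.H1π_comp_map_apply (conjHom X_le_normalizer_F k)
      (conjCoeff ρ X_le_normalizer_F k) f
    have h2 := groupCohomology.H1π_comp_map_apply (conjHom X_le_normalizer_dF k)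
      (conjCoeff ρ X_le_normalizer_dF k) (resCocycle ρ f)
    refine (congrArg (res ρ dF_le_F) h1).trans ((res_H1π ρ _).trans ?_)
    refine Eq.trans ?_ (h2.symm.trans
      (congrArg (H1rep ρ X_le_normalizer_dF k) (res_H1π ρ f).symm))
    exact congrArg (groupCohomology.H1π (coeff ρ dF))
      (groupCohomology.cocycles₁_ext fun h => rfl)

lemma res_classOf_eq_zero_iff (p : V × V) :
    res ρ dF_le_F (classOf ρ p) = 0 ↔ ∃ v, boundary ρ p = ρ l v - v := by
  obtain ⟨f, rfl⟩ := (evalGens_bijective ρ).2 p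
  rw [classOf_evalGens, res_H1π, groupCohomology.H1π_eq_zero_iff, ← apply_lF]
  constructor
  · rintro ⟨v, hv⟩
    exact ⟨v, (congrFun hv lGen).symm⟩
  · rintro ⟨v, hv⟩
    refine ⟨v, ?_⟩
    have : (⟨_, groupCohomology.d₀₁_apply_mem_cocycles₁ (A := coeff ρ dF) v⟩ :
        groupCohomology.cocycles₁ (coeff ρ dF)) = resCocycle ρ f := cocycle_dF_ext ρ hv.symm
    exact congrArg Subtype.val this

lemma boundary_delta (v : V) : boundary ρ (delta ρ v) = ρ l v - v := by
  have h := apply_lF ρ ⟨_, groupCohomology.d₀₁_apply_mem_cocycles₁ (A := coeff ρ F) v⟩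
  exact h.symm

/-- Since x commutes with l, the action of x on cocycles acts on the value at l through the
coefficients alone. -/
lemma boundary_twist (p : V × V) : boundary ρ (twist ρ p) = ρ x (boundary ρ p) := by
  obtain ⟨f, rfl⟩ := (evalGens_bijective ρ).2 p
  let f' : groupCohomology.cocycles₁ (coeff ρ F) :=
    groupCohomology.mapCocycles₁ (conjHom X_le_normalizer_F xGen)
      (conjCoeff ρ X_le_normalizer_F xGen) f
  have h : ∀ g : F, f' g = ρ x (f (conjHom X_le_normalizer_F xGen g)) := fun g => rfl
  have hl : conjHom X_le_normalizer_F xGen lF = lF := by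
    apply Subtype.ext
    change x⁻¹ * l * x = l
    calc x⁻¹ * l * x = x⁻¹ * (x * l * x⁻¹) * x := by rw [x_conj_l]
      _ = l := by group
  rw [← twist_spec ρ f f' h, ← apply_lF, ← apply_lF, h, hl]

lemma res_surjective (h : LinearMap.range (ρ a - 1) ⊔ LinearMap.range (ρ b - 1) = ⊤) :
    Function.Surjective (res ρ dF_le_F) := by
  intro c
  induction c using groupCohomology.H1_induction_on with
  | h g =>
    obtain ⟨p, hp⟩ := boundary_surjective ρ h (g lGen)
    obtain ⟨f, rfl⟩ := (evalGens_bijective ρ).2 p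
    refine ⟨groupCohomology.H1π (coeff ρ F) f, (res_H1π ρ f).trans ?_⟩
    refine congrArg (groupCohomology.H1π (coeff ρ dF)) (cocycle_dF_ext ρ ?_)
    rw [← apply_lF] at hp
    exact hp

lemma relToH1_eq (f : H1rel ρ F dF) : relToH1 ρ F dF f = classOf ρ (relEquiv ρ f) :=
  (classOf_evalGens ρ ⟨f.1, mem_cocycles_of_mem_H1rel ρ f.2⟩).symm

/-- If a cocycle restricts on ⟨l⟩ to the coboundary of v, subtracting the coboundary of the same v
on all of F makes it vanish on ⟨l⟩ without changing its class. -/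
lemma exact_relToH1_res : Function.Exact (relToH1 ρ F dF) (res ρ dF_le_F) := by
  intro c
  obtain ⟨p, rfl⟩ := classOf_surjective ρ c
  rw [res_classOf_eq_zero_iff]
  constructor
  · rintro ⟨v, hv⟩
    refine ⟨(relEquiv ρ).symm ⟨p - delta ρ v, ?_⟩, ?_⟩
    · rw [LinearMap.mem_ker, map_sub, boundary_delta, hv, sub_self]
    · rw [relToH1_eq, LinearEquiv.apply_symm_apply, map_sub, sub_eq_self, ← LinearMap.mem_ker,
        ker_classOf]
      exact ⟨v, rfl⟩
  · rintro ⟨f, hf⟩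
    rw [relToH1_eq, ← sub_eq_zero, ← map_sub, ← LinearMap.mem_ker, ker_classOf] at hf
    obtain ⟨v, hv⟩ := hf
    refine ⟨-v, ?_⟩
    have h := congrArg (boundary ρ) hv
    rw [boundary_delta, map_sub, (relEquiv ρ f).2, zero_sub] at h
    rw [map_neg, ← neg_inj, ← h]
    abel

lemma isShortExact (h : LinearMap.range (ρ a - 1) ⊔ LinearMap.range (ρ b - 1) = ⊤) :
    IsShortExact (imageSubrep ρ X_le_normalizer_F X_le_normalizer_dF).toRepresentation
      (H1rep ρ X_le_normalizer_F) (H1rep ρ X_le_normalizer_dF)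
      (imageSubrep ρ X_le_normalizer_F X_le_normalizer_dF).toSubmodule.subtype
      (res ρ dF_le_F) where
  equivariant_left := ⟨fun _ _ => rfl⟩
  equivariant_right := ⟨fun k c => res_H1rep ρ k c⟩
  injective := Subtype.val_injective
  exact := fun c => by
    rw [exact_relToH1_res ρ c]
    change c ∈ LinearMap.range (relToH1 ρ F dF) ↔ _
    exact ⟨fun hc => ⟨⟨c, hc⟩, rfl⟩, fun ⟨d, hd⟩ => hd ▸ d.2⟩
  surjective := res_surjective ρ h

end ExactSequence

/-! ### Dimension counts -/

section Dimension

variable {V : Type} [AddCommGroup V] [Module ℝ V] (ρ : Representation ℝ Pi V)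

instance [Module.Finite ℝ V] : Module.Finite ℝ (H1 ρ F) :=
  Module.Finite.of_surjective (classOf ρ) (classOf_surjective ρ)

instance [Module.Finite ℝ V] : Module.Finite ℝ (H1rel ρ F dF) :=
  Module.Finite.equiv (relEquiv ρ).symm

lemma mem_zpowers_xGen (k : X) : k ∈ Subgroup.zpowers xGen := by
  obtain ⟨k, n, hn⟩ := k
  exact ⟨n, Subtype.ext hn⟩

lemma invariants_eq_ker {W : Type} [AddCommGroup W] [Module ℝ W] (σ : Representation ℝ X W) :
    σ.invariants = LinearMap.ker (σ xGen - 1) := by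
  ext w
  rw [Representation.mem_invariants_iff_of_forall_mem_zpowers σ xGen mem_zpowers_xGen,
    LinearMap.mem_ker, LinearMap.sub_apply, Module.End.one_apply, sub_eq_zero]

/-- Kernel and cokernel of an endomorphism have the same dimension, and e spans the cokernel. -/
lemma finrank_ker_le_one {W : Type} [AddCommGroup W] [Module ℝ W] [Module.Finite ℝ W]
    (f : W →ₗ[ℝ] W) (e : W) (h : LinearMap.range f ⊔ Submodule.span ℝ {e} = ⊤) :
    Module.finrank ℝ (LinearMap.ker f) ≤ 1 := by
  have h1 := f.finrank_range_add_finrank_ker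
  have h2 := Submodule.finrank_add_le_finrank_add_finrank (LinearMap.range f)
    (Submodule.span ℝ {e})
  have h3 : Module.finrank ℝ (Submodule.span ℝ {e}) ≤ 1 := by
    simpa using finrank_span_le_card (R := ℝ) ({e} : Set W)
  rw [h, finrank_top] at h2
  omega

lemma one_le_finrank_ker {W : Type} [AddCommGroup W] [Module ℝ W] [Module.Finite ℝ W]
    (f : W →ₗ[ℝ] W) (h : ¬ Function.Surjective f) : 1 ≤ Module.finrank ℝ (LinearMap.ker f) := by
  rw [Nat.one_le_iff_ne_zero, Ne, Submodule.finrank_eq_zero, LinearMap.ker_eq_bot,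
    LinearMap.injective_iff_surjective]
  exact h

/-- Both bounds are proved for the cokernel of x - 1. The hypothesis on e says that the class of e
spans it for H¹(F), and then its restriction spans it for H¹(l). For the lower bound, H¹(l) is V/(l
- 1)V through the value at l, so φ, being invariant under l and x, descends to a nonzero functional
on the cokernel. -/
lemma finrank_invariants_eq_one [Module.Finite ℝ V]
    (hab : LinearMap.range (ρ a - 1) ⊔ LinearMap.range (ρ b - 1) = ⊤) (e : V × V)
    (he : LinearMap.range (twist ρ - 1) ⊔ LinearMap.range (delta ρ) ⊔ Submodule.span ℝ {e} = ⊤)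
    (φ : V →ₗ[ℝ] ℝ) (hφ : φ ≠ 0) (hl : ∀ v, φ (ρ l v) = φ v) (hx : ∀ v, φ (ρ x v) = φ v) :
    Module.finrank ℝ (H1rep ρ X_le_normalizer_F).invariants = 1 ∧
      Module.finrank ℝ (H1rep ρ X_le_normalizer_dF).invariants = 1 := by
  have hres := res_surjective ρ hab
  have : Module.Finite ℝ (H1 ρ dF) := Module.Finite.of_surjective _ hres
  set f := H1rep ρ X_le_normalizer_F xGen - 1 with hf
  set g := H1rep ρ X_le_normalizer_dF xGen - 1 with hg
  rw [invariants_eq_ker, invariants_eq_ker, ← hf, ← hg]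
  have hfc : ∀ p, f (classOf ρ p) = classOf ρ ((twist ρ - 1) p) := fun p => by
    simp [hf, H1rep_classOf]
  have hgf : ∀ c, g (res ρ dF_le_F c) = res ρ dF_le_F (f c) := fun c => by
    simp [hf, hg, res_H1rep]
  have hF : LinearMap.range f ⊔ Submodule.span ℝ {classOf ρ e} = ⊤ := by
    rw [eq_top_iff]
    rintro c -
    obtain ⟨p, rfl⟩ := classOf_surjective ρ c
    have hp : p ∈ LinearMap.range (twist ρ - 1) ⊔ LinearMap.range (delta ρ) ⊔
        Submodule.span ℝ {e} := by rw [he]; trivial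
    obtain ⟨_, hq, _, hr, rfl⟩ := Submodule.mem_sup.mp hp
    obtain ⟨_, ⟨q, rfl⟩, _, hd, rfl⟩ := Submodule.mem_sup.mp hq
    obtain ⟨r, rfl⟩ := Submodule.mem_span_singleton.mp hr
    rw [← ker_classOf, LinearMap.mem_ker] at hd
    rw [map_add, map_add, hd, add_zero, ← hfc, map_smul]
    exact add_mem (Submodule.mem_sup_left ⟨_, rfl⟩)
      (Submodule.mem_sup_right (Submodule.smul_mem _ _ (Submodule.mem_span_singleton_self _)))
  have hdF : LinearMap.range g ⊔ Submodule.span ℝ {res ρ dF_le_F (classOf ρ e)} = ⊤ := by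
    rw [eq_top_iff]
    rintro c -
    obtain ⟨c, rfl⟩ := hres c
    have hc : c ∈ LinearMap.range f ⊔ Submodule.span ℝ {classOf ρ e} := by rw [hF]; trivial
    obtain ⟨_, ⟨q, rfl⟩, _, hr, rfl⟩ := Submodule.mem_sup.mp hc
    obtain ⟨r, rfl⟩ := Submodule.mem_span_singleton.mp hr
    rw [map_add, ← hgf, map_smul]
    exact add_mem (Submodule.mem_sup_left ⟨_, rfl⟩)
      (Submodule.mem_sup_right (Submodule.smul_mem _ _ (Submodule.mem_span_singleton_self _)))
  -- If every class on the boundary were (x - 1) of another, φ would vanish on all values at l, and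
  -- these fill V.
  have hgns : ¬ Function.Surjective g := by
    intro hs
    apply hφ
    ext w
    obtain ⟨p, rfl⟩ := boundary_surjective ρ hab w
    obtain ⟨c, hc⟩ := hs (res ρ dF_le_F (classOf ρ p))
    obtain ⟨c, rfl⟩ := hres c
    obtain ⟨q, rfl⟩ := classOf_surjective ρ c
    rw [hgf, hfc, ← sub_eq_zero, ← map_sub, ← map_sub, res_classOf_eq_zero_iff] at hc
    obtain ⟨v, hv⟩ := hc
    have := congrArg φ hv
    simp only [LinearMap.sub_apply, Module.End.one_apply, map_sub, boundary_twist, hx, hl,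
      sub_self, zero_sub, neg_eq_zero] at this
    exact this
  -- Surjectivity of x - 1 would pass to the quotient H¹(l) of H¹(F).
  have hfns : ¬ Function.Surjective f := by
    intro hs
    apply hgns
    intro c
    obtain ⟨c, rfl⟩ := hres c
    obtain ⟨d, rfl⟩ := hs c
    exact ⟨_, hgf d⟩
  exact ⟨le_antisymm (finrank_ker_le_one f _ hF) (one_le_finrank_ker f hfns),
    le_antisymm (finrank_ker_le_one g _ hdF) (one_le_finrank_ker g hgns)⟩

end Dimension

/-! ### Characteristic polynomials of cyclic endomorphisms -/

section Cyclic

open Polynomial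

/-- By Cayley–Hamilton the characteristic polynomial annihilates e, as p does. Their difference has
degree below n and annihilates e, which independence of the iterates allows only for the zero
polynomial. It is thus enough that p annihilates the cyclic vector. -/
lemma charpoly_eq_of_cyclic {W : Type} [AddCommGroup W] [Module ℝ W] [Module.Finite ℝ W]
    (f : W →ₗ[ℝ] W) (e : W) {n : ℕ} (hn : Module.finrank ℝ W = n) {p : ℝ[X]} (hp : p.Monic)
    (hdeg : p.natDegree = n) (hind : LinearIndependent ℝ fun i : Fin n => (f ^ (i : ℕ)) e)
    (h0 : aeval f p e = 0) : f.charpoly = p := by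
  have hdeg' : f.charpoly.degree = p.degree := by
    rw [degree_eq_natDegree f.charpoly_monic.ne_zero, degree_eq_natDegree hp.ne_zero,
      f.charpoly_natDegree, hn, hdeg]
  rw [← sub_eq_zero]
  by_contra hne
  have hlt : (f.charpoly - p).natDegree < n := by
    have := degree_sub_lt_left hdeg' f.charpoly_monic.ne_zero
      (f.charpoly_monic.leadingCoeff.trans hp.leadingCoeff.symm)
    rw [hdeg', degree_eq_natDegree hp.ne_zero, degree_eq_natDegree hne, hdeg] at this
    exact_mod_cast this
  have hz : aeval f (f.charpoly - p) e = 0 := by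
    rw [map_sub, LinearMap.aeval_self_charpoly, zero_sub, LinearMap.neg_apply, h0, neg_zero]
  rw [aeval_eq_sum_range' hlt, LinearMap.sum_apply, Finset.sum_range] at hz
  have hc := Fintype.linearIndependent_iff.mp hind (fun i => (f.charpoly - p).coeff i) hz
  refine hne (Polynomial.ext fun i => ?_)
  rw [coeff_zero]
  rcases lt_or_ge i n with hi | hi
  · exact hc ⟨i, hi⟩
  · exact coeff_eq_zero_of_natDegree_lt (hlt.trans_le hi)

lemma det_sub_smul_id {W : Type} [AddCommGroup W] [Module ℝ W] [Module.Finite ℝ W]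
    (f : W →ₗ[ℝ] W) (t : ℝ) :
    LinearMap.det (f - t • (LinearMap.id : W →ₗ[ℝ] W)) =
      (-1) ^ Module.finrank ℝ W * f.charpoly.eval t := by
  rw [LinearMap.eval_charpoly, ← LinearMap.det_smul, neg_one_smul, neg_sub]
  rfl

end Cyclic

/-! ### The module `𝔳` as the space of Hermitian `3 × 3` matrices -/

lemma J_mul_J : J * J = 1 := by
  rw [J, diagonal_mul_diagonal, ← diagonal_one]
  congr 1
  ext i
  fin_cases i <;> simp

/-- The algebra 𝔰𝔬(3,1) consists of the J-antisymmetric matrices, whose complement for the trace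
form is the J-symmetric ones. -/
lemma mem_𝔳_iff (A : Matrix (Fin 4) (Fin 4) ℝ) : A ∈ 𝔳 ↔ A.trace = 0 ∧ (A * J)ᵀ = A * J := by
  have hJ : Jᵀ = J := by simp [J]
  refine and_congr_right fun _ => ⟨fun h => ?_, fun h B hB => ?_⟩
  · ext i j
    -- Pairing with this element isolates the difference of the entries (i, j) and (j, i) of A * J.
    have hB : J * (single i j (1 : ℝ) - single j i 1) ∈ so31 := by
      refine ⟨?_, ?_⟩
      · have : (J * single i j (1 : ℝ)).trace = (J * single j i 1).trace := by
          rw [← trace_transpose, transpose_mul, hJ, transpose_single, trace_mul_comm]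
        rw [mul_sub, trace_sub, this, sub_self]
      · rw [transpose_mul, hJ, Matrix.mul_assoc, J_mul_J, ← Matrix.mul_assoc, J_mul_J, transpose_sub,
          transpose_single, transpose_single]
        simp
    have := h _ hB
    rw [← Matrix.mul_assoc, mul_sub, trace_sub, trace_mul_comm _ (single i j _),
      trace_mul_comm _ (single j i _), trace_single_mul, trace_single_mul] at this
    simp at this
    simp only [transpose_apply]
    linarith
  · have hA : A * B = (A * J) * (J * B) := by
      rw [Matrix.mul_assoc, ← Matrix.mul_assoc J, J_mul_J, Matrix.one_mul]
    have h1 : (J * B)ᵀ = -(J * B) := by rw [transpose_mul, hJ, hB.2]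
    have h2 : (A * B).trace = -(A * B).trace := by
      conv_lhs => rw [hA, ← trace_transpose, transpose_mul, h, h1, trace_mul_comm]
      rw [mul_neg, trace_neg, ← hA]
    linarith

/-- The Hermitian matrix with given real coordinates. -/
def herm (c : Fin 9 → ℝ) : Matrix (Fin 3) (Fin 3) ℂ :=
  !![(c 0 : ℂ), ⟨c 3, c 4⟩, ⟨c 5, c 6⟩;
    ⟨c 3, -c 4⟩, (c 1 : ℂ), ⟨c 7, c 8⟩;
    ⟨c 5, -c 6⟩, ⟨c 7, -c 8⟩, (c 2 : ℂ)]

lemma herm_injective : Function.Injective herm := by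
  intro c d h
  have h' := fun i j => congrFun (congrFun h i) j
  have h00 := congrArg Complex.re (h' 0 0)
  have h11 := congrArg Complex.re (h' 1 1)
  have h22 := congrArg Complex.re (h' 2 2)
  have h01 := h' 0 1
  have h02 := h' 0 2
  have h12 := h' 1 2
  simp [herm, Complex.ext_iff] at h00 h11 h22 h01 h02 h12
  ext i
  fin_cases i <;> simp [*]

/-- The coordinates of the traceless part of the square `A₁₁², A₁₁A₂₂, A₂₂², A₁₁A₁₂, A₁₂², A₁₂A₂₂`
of a Hermitian `2 × 2` matrix `A`, extended linearly to symmetric tensors. -/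
def coords (A : Matrix (Fin 4) (Fin 4) ℝ) : Fin 9 → ℝ :=
  ![(A 2 2 - A 3 3 + 2 * A 2 3) / 4, -(A 2 2 + A 3 3) / 16, (A 2 2 - A 3 3 - 2 * A 2 3) / 64,
    -(A 0 3 + A 0 2) / 8, -(A 1 3 + A 1 2) / 8, (A 0 0 - A 1 1) / 16, A 0 1 / 8,
    (A 0 2 - A 0 3) / 32, (A 1 2 - A 1 3) / 32]

/-- The inverse of `coords`. -/
def ofCoords (c : Fin 9 → ℝ) : Matrix (Fin 4) (Fin 4) ℝ :=
  !![8 * (c 1 + c 5), 8 * c 6, 16 * c 7 - 4 * c 3, -(16 * c 7 + 4 * c 3);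
    8 * c 6, 8 * (c 1 - c 5), 16 * c 8 - 4 * c 4, -(16 * c 8 + 4 * c 4);
    16 * c 7 - 4 * c 3, 16 * c 8 - 4 * c 4, c 0 + 16 * c 2 - 8 * c 1, c 0 - 16 * c 2;
    16 * c 7 + 4 * c 3, 16 * c 8 + 4 * c 4, 16 * c 2 - c 0, -(c 0 + 16 * c 2 + 8 * c 1)]

lemma ofCoords_mem (c : Fin 9 → ℝ) : ofCoords c ∈ 𝔳 := by
  rw [mem_𝔳_iff]
  constructor
  · simp [trace, Fin.sum_univ_four, ofCoords]
    ring
  · ext i j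
    rw [transpose_apply, J, mul_diagonal, mul_diagonal]
    fin_cases i <;> fin_cases j <;> simp [ofCoords]

lemma coords_ofCoords (c : Fin 9 → ℝ) : coords (ofCoords c) = c := by
  ext i
  fin_cases i <;> simp [coords, ofCoords] <;> ring

lemma ofCoords_coords {A : Matrix (Fin 4) (Fin 4) ℝ} (hA : A ∈ 𝔳) : ofCoords (coords A) = A := by
  rw [mem_𝔳_iff] at hA
  obtain ⟨ht, hs⟩ := hA
  have h := fun i j => congrFun (congrFun hs i) j
  simp only [transpose_apply, J, mul_diagonal] at h
  have h01 := h 0 1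
  have h02 := h 0 2
  have h03 := h 0 3
  have h12 := h 1 2
  have h13 := h 1 3
  have h23 := h 2 3
  simp [trace, Fin.sum_univ_four] at ht h01 h02 h03 h12 h13 h23
  ext i j
  fin_cases i <;> fin_cases j <;> simp [coords, ofCoords] <;> linarith

/-- The space `𝔳`, in coordinates. -/
def coordEquiv : VSpace ≃ₗ[ℝ] (Fin 9 → ℝ) where
  toFun A := coords (show 𝔳 from A).1
  invFun c := (⟨ofCoords c, ofCoords_mem c⟩ : 𝔳)
  left_inv A := Subtype.ext (ofCoords_coords (show 𝔳 from A).2)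
  right_inv c := coords_ofCoords c
  map_add' A B := by
    change coords ((show 𝔳 from A).1 + (show 𝔳 from B).1) = _
    ext i
    fin_cases i <;> simp [coords] <;> ring
  map_smul' r A := by
    change coords (r • (show 𝔳 from A).1) = _
    ext i
    fin_cases i <;> simp [coords] <;> ring

instance : Module.Finite ℝ VSpace := Module.Finite.equiv coordEquiv.symm

lemma finrank_VSpace : Module.finrank ℝ VSpace = 9 := by
  rw [coordEquiv.finrank_eq, Module.finrank_fin_fun]

/-- The symmetric square of a `2 × 2` matrix. -/
def symSq (g : Matrix (Fin 2) (Fin 2) ℂ) : Matrix (Fin 3) (Fin 3) ℂ :=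
  !![g 0 0 ^ 2, 2 * g 0 0 * g 0 1, g 0 1 ^ 2;
    g 0 0 * g 1 0, g 0 0 * g 1 1 + g 0 1 * g 1 0, g 0 1 * g 1 1;
    g 1 0 ^ 2, 2 * g 1 0 * g 1 1, g 1 1 ^ 2]

lemma symSq_mul (g h : Matrix (Fin 2) (Fin 2) ℂ) : symSq (g * h) = symSq g * symSq h := by
  ext i j
  fin_cases i <;> fin_cases j <;>
    simp [symSq, Matrix.mul_apply, Fin.sum_univ_succ] <;> ring

namespace Shape

variable (s : Shape)

lemma mul_eq_of_sum_four (A B : Matrix (Fin 4) (Fin 4) ℝ) :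
    A * B = of fun i j => A i 0 * B 0 j + A i 1 * B 1 j + A i 2 * B 2 j + A i 3 * B 3 j := by
  ext i j
  simp only [Matrix.mul_apply, Fin.sum_univ_four, of_apply]

set_option maxHeartbeats 1000000 in
-- Minkowski space is the Hermitian 2 × 2 matrices under A ↦ gAg*, and the traceless part of its
-- symmetric square is the Hermitian forms on Sym² ℂ². Conjugation on 𝔳 therefore becomes h ↦
-- Sym²(g) h Sym²(g)*. Here `x₂'` is the adjugate of `x₂`, hence its inverse up to the scalar m.
lemma herm_klein_x (c : Fin 9 → ℝ) :
    herm (coords (klein s.x₂ * (ofCoords c * klein s.x₂'))) =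
      symSq s.x₂ * herm c * (symSq s.x₂)ᴴ := by
  rw [mul_eq_of_sum_four (ofCoords c)]
  ext i j
  fin_cases i <;> fin_cases j <;>
    (simp only [Fin.zero_eta, Fin.mk_one, Fin.reduceFinMk, herm, coords, Matrix.mul_apply,
      Fin.sum_univ_four, Fin.sum_univ_three, of_apply, cons_val, cons_val_zero, cons_val_one,
      conjTranspose_apply]
     simp only [ofCoords, klein, symSq, x₂, x₂', cons_val, cons_val_zero, cons_val_one, of_apply]
     apply Complex.ext <;> simp [Complex.normSq_apply, pow_two] <;> ring)

set_option maxHeartbeats 1000000 in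
lemma herm_klein_y (c : Fin 9 → ℝ) :
    herm (coords (klein s.y₂ * (ofCoords c * klein s.y₂'))) =
      symSq s.y₂ * herm c * (symSq s.y₂)ᴴ := by
  rw [mul_eq_of_sum_four (ofCoords c)]
  ext i j
  fin_cases i <;> fin_cases j <;>
    (simp only [Fin.zero_eta, Fin.mk_one, Fin.reduceFinMk, herm, coords, Matrix.mul_apply,
      Fin.sum_univ_four, Fin.sum_univ_three, of_apply, cons_val, cons_val_zero, cons_val_one,
      conjTranspose_apply]
     simp only [ofCoords, klein, symSq, y₂, y₂', cons_val, cons_val_zero, cons_val_one, of_apply]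
     apply Complex.ext <;> simp [Complex.normSq_apply, pow_two] <;> ring)

/-- The matrix underlying a vector of `𝔳`. -/
def toMat (v : VSpace) : Matrix (Fin 4) (Fin 4) ℝ := (show 𝔳 from v).1

lemma ofCoords_coordEquiv (v : VSpace) : ofCoords (coordEquiv v) = toMat v :=
  ofCoords_coords (show 𝔳 from v).2

lemma coordEquiv_apply (v : VSpace) : coordEquiv v = coords (toMat v) := rfl

lemma toMat_adRep (g : Pi) (v : VSpace) :
    toMat (s.adRep g v) = (s.holonomy g).1.1 * toMat v * ((s.holonomy g)⁻¹ : SO31).1.1 := rfl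

lemma holonomy_x : s.holonomy x = ⟨s.glX, s.glX_mem⟩ := by
  simp [holonomy, x]

lemma holonomy_y : s.holonomy y = ⟨s.glY, s.glY_mem⟩ := by
  simp [holonomy, y]

lemma toMat_adRep_x (v : VSpace) :
    toMat (s.adRep x v) = s.matX * toMat v * (‖s.m‖⁻¹ • klein s.x₂') := by
  rw [toMat_adRep, holonomy_x]
  rfl

lemma toMat_adRep_y (v : VSpace) :
    toMat (s.adRep y v) = s.matY * toMat v * (‖s.m‖⁻¹ • klein s.y₂') := by
  rw [toMat_adRep, holonomy_y]
  rfl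

lemma coords_smul (r : ℝ) (A : Matrix (Fin 4) (Fin 4) ℝ) : coords (r • A) = r • coords A := by
  ext i
  fin_cases i <;> simp [coords] <;> ring

lemma herm_smul (r : ℝ) (c : Fin 9 → ℝ) : herm (r • c) = (r : ℂ) • herm c := by
  ext i j
  fin_cases i <;> fin_cases j <;> simp [herm, Complex.ext_iff]

lemma herm_adRep_x (v : VSpace) :
    ((‖s.m‖ ^ 2 : ℝ) : ℂ) • herm (coordEquiv (s.adRep x v)) =
      symSq s.x₂ * herm (coordEquiv v) * (symSq s.x₂)ᴴ := by
  have h0 : ‖s.m‖ ≠ 0 := norm_ne_zero_iff.mpr s.m_ne_zero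
  rw [← herm_klein_x, ← herm_smul, coordEquiv_apply, toMat_adRep_x, matX_eq, ofCoords_coordEquiv]
  simp only [Matrix.smul_mul, Matrix.mul_smul, coords_smul, smul_smul, Matrix.mul_assoc]
  congr 1
  convert one_smul ℝ _ using 2
  field_simp

lemma herm_adRep_y (v : VSpace) :
    ((‖s.m‖ ^ 2 : ℝ) : ℂ) • herm (coordEquiv (s.adRep y v)) =
      symSq s.y₂ * herm (coordEquiv v) * (symSq s.y₂)ᴴ := by
  have h0 : ‖s.m‖ ≠ 0 := norm_ne_zero_iff.mpr s.m_ne_zero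
  rw [← herm_klein_y, ← herm_smul, coordEquiv_apply, toMat_adRep_y, matY_eq, ofCoords_coordEquiv]
  simp only [Matrix.smul_mul, Matrix.mul_smul, coords_smul, smul_smul, Matrix.mul_assoc]
  congr 1
  convert one_smul ℝ _ using 2
  field_simp

/-! ### The trace form -/

/-- The trace form on `𝔳`, a multiple of the Killing form. -/
def traceForm : VSpace →ₗ[ℝ] VSpace →ₗ[ℝ] ℝ :=
  LinearMap.mk₂ ℝ (fun v w => (toMat v * toMat w).trace)
    (fun v v' w => by
      change ((toMat v + toMat v') * toMat w).trace = _
      rw [add_mul, trace_add])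
    (fun r v w => by
      change ((r • toMat v) * toMat w).trace = _
      rw [Matrix.smul_mul, trace_smul])
    (fun v w w' => by
      change (toMat v * (toMat w + toMat w')).trace = _
      rw [mul_add, trace_add])
    (fun r v w => by
      change (toMat v * (r • toMat w)).trace = _
      rw [Matrix.mul_smul, trace_smul])

lemma traceForm_adRep (g : Pi) (v w : VSpace) :
    traceForm (s.adRep g v) (s.adRep g w) = traceForm v w := by
  change (toMat _ * toMat _).trace = (toMat _ * toMat _).trace
  rw [toMat_adRep, toMat_adRep]
  have h : ((s.holonomy g)⁻¹ : SO31).1.1 * (s.holonomy g).1.1 = 1 := (s.holonomy g).1.inv_mul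
  calc _ = ((s.holonomy g).1.1 * (toMat v * (((s.holonomy g)⁻¹ : SO31).1.1 *
        (s.holonomy g).1.1) * toMat w) * ((s.holonomy g)⁻¹ : SO31).1.1).trace := by
        simp only [Matrix.mul_assoc]
    _ = _ := by rw [h, Matrix.mul_one, trace_mul_cycle, h, Matrix.one_mul]

/-- The form is indefinite, but 𝔳 is closed under transposition, and tr(v vᵀ) = 0 forces v = 0. -/
lemma traceForm_injective : Function.Injective traceForm := by
  rw [injective_iff_map_eq_zero]
  intro v hv
  have hmem : toMat v ∈ 𝔳 := (show 𝔳 from v).2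
  have hT : (toMat v)ᵀ ∈ 𝔳 := by
    rw [mem_𝔳_iff] at hmem ⊢
    have hJ : Jᵀ = J := by simp [J]
    refine ⟨by rw [trace_transpose, hmem.1], ?_⟩
    have h := hmem.2
    rw [transpose_mul, hJ] at h
    rw [transpose_mul, transpose_transpose, hJ]
    calc J * toMat v = J * (toMat v * J) * J := by
          rw [Matrix.mul_assoc, Matrix.mul_assoc, J_mul_J, Matrix.mul_one]
      _ = (toMat v)ᵀ * J := by rw [← h, ← Matrix.mul_assoc, J_mul_J, Matrix.one_mul]
  have h : (toMat v * (toMat v)ᵀ).trace = 0 := congrArg (fun f => f (⟨_, hT⟩ : 𝔳)) hv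
  have h0 : toMat v = 0 := by
    rwa [← conjTranspose_eq_transpose_of_trivial,
      trace_mul_conjTranspose_self_eq_zero_iff] at h
  exact Subtype.ext h0

lemma traceForm_surjective : Function.Surjective traceForm :=
  (LinearMap.injective_iff_surjective_of_finrank_eq_finrank
    (Subspace.dual_finrank_eq (K := ℝ) (V := VSpace)).symm).mp traceForm_injective

/-- A functional that kills both ranges is pairing with some w, and invariance of the form makes w
fixed by a and b. -/
lemma range_sup_range_eq_top
    (h : ∀ v, s.adRep a v = v → s.adRep b v = v → v = 0) :
    LinearMap.range (s.adRep a - 1) ⊔ LinearMap.range (s.adRep b - 1) = ⊤ := by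
  by_contra hne
  obtain ⟨f, hf, hle⟩ := Submodule.exists_le_ker_of_lt_top _ (lt_top_iff_ne_top.mpr hne)
  obtain ⟨w, rfl⟩ := traceForm_surjective f
  have key : ∀ g, LinearMap.range (s.adRep g - 1) ≤ LinearMap.ker (traceForm w) →
      s.adRep g w = w := by
    intro g hg
    refine traceForm_injective (LinearMap.ext fun u => ?_)
    have h1 : (s.adRep g - 1) (s.adRep g⁻¹ u) ∈ LinearMap.ker (traceForm w) := hg ⟨_, rfl⟩
    rw [LinearMap.sub_apply, Representation.self_inv_apply, Module.End.one_apply,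
      LinearMap.mem_ker, map_sub, sub_eq_zero] at h1
    rw [h1, ← s.traceForm_adRep g w, Representation.self_inv_apply]
  rw [sup_le_iff] at hle
  exact hf (by rw [h w (key a hle.1) (key b hle.2), map_zero])

end Shape

/-! ### Intertwiners between a representation of `𝔰𝔩₂` and its conjugate -/

/-- The bracket with the traceless matrix `!![n 1, -n 0; n 2, -n 1]`, in the coordinates of the
symmetric square. -/
def adMat (n : Fin 3 → ℂ) : Matrix (Fin 3) (Fin 3) ℂ :=
  !![2 * n 1, -2 * n 0, 0; n 2, 0, -n 0; 0, 2 * n 2, -2 * n 1]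

/-- The invariant bilinear form. -/
def adForm (n n' : Fin 3 → ℂ) : ℂ := n 1 * n' 1 - (n 0 * n' 2 + n 2 * n' 0) / 2

/-- The matrix with columns `n`, `n'` and their bracket. -/
def adBasis (n n' : Fin 3 → ℂ) : Matrix (Fin 3) (Fin 3) ℂ :=
  !![n 0, n' 0, 2 * (n 1 * n' 0 - n 0 * n' 1);
    n 1, n' 1, n 2 * n' 0 - n 0 * n' 2;
    n 2, n' 2, 2 * (n 2 * n' 1 - n 1 * n' 2)]

/-- Thus n, n' and their bracket form a basis of 𝔰𝔩₂ exactly when the Gram determinant of n and n'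
is nonzero. -/
lemma det_adBasis (n n' : Fin 3 → ℂ) :
    (adBasis n n').det = 4 * (adForm n n' ^ 2 - adForm n n * adForm n' n') := by
  rw [det_fin_three]
  simp only [adBasis, adForm, of_apply, cons_val, cons_val_zero, cons_val_one]
  ring

/-- In the basis n, n', [n, n'] the brackets depend only on the values of the form. An intertwiner
with the conjugate representation can then be studied through these structure constants and their
conjugates. -/
lemma adMat_mul_adBasis_left (n n' : Fin 3 → ℂ) :
    adMat n * adBasis n n' = adBasis n n' *
      !![0, 0, -4 * adForm n n'; 0, 0, 4 * adForm n n; 0, 1, 0] := by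
  ext i j
  fin_cases i <;> fin_cases j <;>
    simp [adMat, adBasis, adForm, Matrix.mul_apply, Fin.sum_univ_three] <;> ring

lemma adMat_mul_adBasis_right (n n' : Fin 3 → ℂ) :
    adMat n' * adBasis n n' = adBasis n n' *
      !![0, 0, -4 * adForm n' n'; 0, 0, 4 * adForm n n'; -1, 0, 0] := by
  ext i j
  fin_cases i <;> fin_cases j <;>
    simp [adMat, adBasis, adForm, Matrix.mul_apply, Fin.sum_univ_three] <;> ring

/-- Entrywise complex conjugation. -/
abbrev conjMat (A : Matrix (Fin 3) (Fin 3) ℂ) : Matrix (Fin 3) (Fin 3) ℂ :=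
  A.map (starRingEnd ℂ)

lemma conjMat_mul (A B : Matrix (Fin 3) (Fin 3) ℂ) :
    conjMat (A * B) = conjMat A * conjMat B := Matrix.map_mul

/-- Comparison of entries leaves K a scalar matrix k, as in Schur's lemma. The entries that contain
δ and ε then give k(δ̄ - δ) = 0 and k(ε̄ - ε) = 0. -/
lemma eq_zero_of_intertwines_structure {δ ε δ' : ℂ} (hG : ε ^ 2 - δ * δ' ≠ 0)
    (hreal : ¬ ((starRingEnd ℂ) δ = δ ∧ (starRingEnd ℂ) ε = ε)) {K : Matrix (Fin 3) (Fin 3) ℂ}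
    (h1 : !![0, 0, -4 * ε; 0, 0, 4 * δ; 0, 1, 0] * K =
      K * conjMat !![0, 0, -4 * ε; 0, 0, 4 * δ; 0, 1, 0])
    (h2 : !![0, 0, -4 * δ'; 0, 0, 4 * ε; -1, 0, 0] * K =
      K * conjMat !![0, 0, -4 * δ'; 0, 0, 4 * ε; -1, 0, 0]) : K = 0 := by
  have e1 := fun i j => congrFun (congrFun h1 i) j
  have e2 := fun i j => congrFun (congrFun h2 i) j
  simp only [Matrix.mul_apply, Fin.sum_univ_three] at e1 e2
  have a00 := e1 0 0
  have a10 := e1 1 0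
  have a20 := e1 2 0
  have a01 := e1 0 1
  have a11 := e1 1 1
  have a21 := e1 2 1
  have a02 := e1 0 2
  have a12 := e1 1 2
  have b20 := e2 2 0
  have b01 := e2 0 1
  have b11 := e2 1 1
  have b21 := e2 2 1
  simp [map_ofNat] at a00 a10 a20 a01 a11 a21 a02 a12 b20 b01 b11 b21
  have k20 : K 2 0 = 0 := by
    by_contra h
    refine hG ?_
    rw [a00.resolve_right h, a10.resolve_right h]
    ring
  have k21 : K 2 1 = 0 := by
    by_contra h
    refine hG ?_
    rw [b01.resolve_right h, b11.resolve_right h]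
    ring
  rw [k21] at a01 a11
  rw [a20] at a12
  rw [b21] at a02
  have k00 : K 0 0 = 0 := by
    by_contra h
    have h22 : K 2 2 ≠ 0 := by rwa [← b20]
    refine hreal ⟨?_, ?_⟩
    · rw [a21] at a12
      have : K 2 2 * ((starRingEnd ℂ) δ - δ) = 0 := by linear_combination (-1 / 4) * a12
      exact sub_eq_zero.mp ((mul_eq_zero.mp this).resolve_left h22)
    · rw [b20] at a02
      have : K 2 2 * ((starRingEnd ℂ) ε - ε) = 0 := by linear_combination (1 / 4) * a02
      exact sub_eq_zero.mp ((mul_eq_zero.mp this).resolve_left h22)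
  have k22 : K 2 2 = 0 := by rw [← b20, k00]
  have k11 : K 1 1 = 0 := by rw [a21, k22]
  have k02 : K 0 2 = 0 := by rw [← a01]; ring
  have k12 : K 1 2 = 0 := by rw [← a11]; ring
  ext i j
  fin_cases i <;> fin_cases j <;> assumption

lemma eq_zero_of_intertwines {n n' : Fin 3 → ℂ}
    (hG : adForm n n' ^ 2 - adForm n n * adForm n' n' ≠ 0)
    (hreal : ¬ ((starRingEnd ℂ) (adForm n n) = adForm n n ∧
      (starRingEnd ℂ) (adForm n n') = adForm n n')) {K : Matrix (Fin 3) (Fin 3) ℂ}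
    (h1 : adMat n * K = K * conjMat (adMat n)) (h2 : adMat n' * K = K * conjMat (adMat n')) :
    K = 0 := by
  set P := adBasis n n' with hP
  have hdet : IsUnit P.det := by
    rw [isUnit_iff_ne_zero, hP, det_adBasis]
    exact mul_ne_zero (by norm_num) hG
  have hPi : P⁻¹ * P = 1 := nonsing_inv_mul P hdet
  have hPi' : P * P⁻¹ = 1 := mul_nonsing_inv P hdet
  have hc : conjMat P * conjMat P⁻¹ = 1 := by
    rw [← conjMat_mul, hPi']
    simp [conjMat]
  have key : ∀ {N A : Matrix (Fin 3) (Fin 3) ℂ}, N * P = P * A → N * K = K * conjMat N →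
      A * (P⁻¹ * K * conjMat P) = (P⁻¹ * K * conjMat P) * conjMat A := by
    intro N A hA hN
    have hA' : P⁻¹ * N = A * P⁻¹ := by
      calc P⁻¹ * N = P⁻¹ * (N * P) * P⁻¹ := by
            rw [Matrix.mul_assoc, Matrix.mul_assoc, hPi', Matrix.mul_one]
        _ = A * P⁻¹ := by rw [hA, ← Matrix.mul_assoc, hPi, Matrix.one_mul]
    calc A * (P⁻¹ * K * conjMat P) = (A * P⁻¹) * K * conjMat P := by
          simp only [Matrix.mul_assoc]
      _ = P⁻¹ * (N * K) * conjMat P := by rw [← hA']; simp only [Matrix.mul_assoc]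
      _ = P⁻¹ * K * conjMat (N * P) := by rw [hN, conjMat_mul]; simp only [Matrix.mul_assoc]
      _ = _ := by rw [hA, conjMat_mul]; simp only [Matrix.mul_assoc]
  have h0 := eq_zero_of_intertwines_structure hG hreal
    (key (adMat_mul_adBasis_left n n') h1) (key (adMat_mul_adBasis_right n n') h2)
  calc K = P * (P⁻¹ * K * conjMat P) * conjMat P⁻¹ := by
        rw [Matrix.mul_assoc, Matrix.mul_assoc, hc, Matrix.mul_one, ← Matrix.mul_assoc, hPi',
          Matrix.one_mul]
    _ = 0 := by rw [h0]; simp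

/-! ### Invariant Hermitian forms as intertwiners -/

/-- The matrix of the invariant bilinear form on the symmetric square. -/
def formMat : Matrix (Fin 3) (Fin 3) ℂ := !![0, 0, 1; 0, -2, 0; 1, 0, 0]

lemma conjMat_formMat : conjMat formMat = formMat := by
  ext i j
  fin_cases i <;> fin_cases j <;> simp [formMat, map_ofNat]

/-- The form identifies Sym² with its dual up to determinant factors, so multiplication by `formMat`
turns an invariant Hermitian form into an intertwiner with the conjugate representation. -/
lemma transpose_symSq_mul_formMat (g : Matrix (Fin 2) (Fin 2) ℂ) :
    (symSq g)ᵀ * formMat = formMat * symSq g.adjugate := by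
  rw [adjugate_fin_two]
  ext i j
  fin_cases i <;> fin_cases j <;>
    simp [symSq, formMat, Matrix.mul_apply, Fin.sum_univ_three] <;> ring

lemma symSq_smul (r : ℂ) (g : Matrix (Fin 2) (Fin 2) ℂ) : symSq (r • g) = r ^ 2 • symSq g := by
  ext i j
  fin_cases i <;> fin_cases j <;> simp [symSq] <;> ring

lemma symSq_one : symSq 1 = 1 := by
  ext i j
  fin_cases i <;> fin_cases j <;> simp [symSq]

/-- The coordinates of the traceless part of `g`. -/
def tracelessPart (g : Matrix (Fin 2) (Fin 2) ℂ) : Fin 3 → ℂ :=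
  ![-g 0 1, (g 0 0 - g 1 1) / 2, g 1 0]

/-- Write g = τ/2 + n with n traceless; its adjugate is τ/2 - n. Sym² is quadratic, so in the
difference the terms even in n cancel and the mixed term, the bracket with n, remains. This passes
from the group to the Lie algebra without a logarithm. -/
lemma symSq_sub_symSq_adjugate (g : Matrix (Fin 2) (Fin 2) ℂ) :
    symSq g - symSq g.adjugate = g.trace • adMat (tracelessPart g) := by
  rw [adjugate_fin_two, trace_fin_two]
  ext i j
  fin_cases i <;> fin_cases j <;> simp [symSq, adMat, tracelessPart] <;> ring

lemma adMat_smul (r : ℂ) (n : Fin 3 → ℂ) : adMat (r • n) = r • adMat n := by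
  ext i j
  fin_cases i <;> fin_cases j <;> simp [adMat] <;> ring

/-- A Hermitian form invariant under `g` gives an intertwiner for the traceless part of `g`. -/
lemma intertwines_of_invariant {g : Matrix (Fin 2) (Fin 2) ℂ} (hg : g.det ≠ 0)
    {h : Matrix (Fin 3) (Fin 3) ℂ}
    (hh : symSq g * h * (symSq g)ᴴ = (g.det * (starRingEnd ℂ) g.det) • h) :
    adMat ((g.trace / g.det) • tracelessPart g) * (h * formMat) =
      h * formMat * conjMat (adMat ((g.trace / g.det) • tracelessPart g)) := by
  set μ := g.det with hμ
  have hμ' : (starRingEnd ℂ) μ ≠ 0 := by simpa using hg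
  have hinv : symSq g.adjugate * symSq g = μ ^ 2 • 1 := by
    rw [← symSq_mul, adjugate_mul, symSq_smul, symSq_one]
  have hstar : (symSq g)ᴴ * formMat = formMat * conjMat (symSq g.adjugate) := by
    have := congrArg conjMat (transpose_symSq_mul_formMat g)
    rw [conjMat_mul, conjMat_mul, conjMat_formMat] at this
    exact this
  have e0 : symSq g * (h * formMat) * conjMat (symSq g.adjugate) =
      (μ * (starRingEnd ℂ) μ) • (h * formMat) := by
    rw [Matrix.mul_assoc, Matrix.mul_assoc h, ← hstar, ← Matrix.mul_assoc h,
      ← Matrix.mul_assoc, ← Matrix.mul_assoc, hh, Matrix.smul_mul]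
  have cinv : ∀ {A B : Matrix (Fin 3) (Fin 3) ℂ}, A * B = μ ^ 2 • 1 →
      conjMat A * conjMat B = (starRingEnd ℂ) μ ^ 2 • 1 := by
    intro A B hAB
    rw [← conjMat_mul, hAB]
    ext i j
    fin_cases i <;> fin_cases j <;> simp
  -- With K = h * formMat, both S = Sym² g and S = Sym² of the adjugate satisfy μ̄ S K = μ K S̄.
  -- Their difference inherits the relation, and division by μ μ̄ explains the factor trace / det in
  -- the statement.
  have e1 : (starRingEnd ℂ) μ • (symSq g * (h * formMat)) =
      μ • (h * formMat * conjMat (symSq g)) := by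
    have := congrArg (· * conjMat (symSq g)) e0
    simp only [Matrix.mul_assoc (symSq g * (h * formMat)), cinv hinv] at this
    rw [Matrix.mul_smul, Matrix.mul_one, Matrix.smul_mul] at this
    apply smul_right_injective _ hμ'
    simp only [smul_smul]
    rw [← pow_two, this, mul_comm]
  have e2 : (starRingEnd ℂ) μ • (symSq g.adjugate * (h * formMat)) =
      μ • (h * formMat * conjMat (symSq g.adjugate)) := by
    have := congrArg (symSq g.adjugate * ·) e0
    simp only [← Matrix.mul_assoc, hinv] at this
    simp only [Matrix.smul_mul, Matrix.one_mul, Matrix.mul_smul] at this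
    apply smul_right_injective _ hg
    simp only [smul_smul]
    rw [← pow_two, this]
  have e3 : (starRingEnd ℂ) μ • ((g.trace • adMat (tracelessPart g)) * (h * formMat)) =
      μ • (h * formMat * conjMat (g.trace • adMat (tracelessPart g))) := by
    rw [← symSq_sub_symSq_adjugate, sub_mul, smul_sub, e1, e2, ← smul_sub, ← mul_sub]
    congr 2
    ext i j
    simp
  have hconj : ∀ (r : ℂ) (A : Matrix (Fin 3) (Fin 3) ℂ),
      conjMat (r • A) = (starRingEnd ℂ) r • conjMat A := by
    intro r A
    ext i j
    simp
  rw [adMat_smul, hconj, Matrix.smul_mul, Matrix.mul_smul]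
  rw [hconj, Matrix.smul_mul, Matrix.mul_smul, smul_smul, smul_smul] at e3
  apply smul_right_injective _ (mul_ne_zero hg hμ')
  simp only [smul_smul]
  convert e3 using 2
  · field_simp
  · rw [map_div₀]
    field_simp

/-! ### The holonomy of the fiber has no invariants in `𝔳` -/

namespace Shape

variable (s : Shape)

/-- For real r = m / z₂ the relation m² = (1 - z₁) z₂ reads r² z₂ = 1 - z₁, where the left side has
nonnegative imaginary part and the right side negative. -/
lemma not_real_ratio : (starRingEnd ℂ) (s.m / s.z₂) ≠ s.m / s.z₂ := by
  intro h
  obtain ⟨r, hr⟩ := Complex.conj_eq_iff_real.mp h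
  have hz : s.z₂ ≠ 0 := (im_pos_ne _ s.im_pos₂).1
  rw [div_eq_iff hz] at hr
  have hsq := s.m_sq
  rw [hr] at hsq
  have h1 : (r : ℂ) ^ 2 * s.z₂ = 1 - s.z₁ := by
    apply mul_right_cancel₀ hz
    linear_combination hsq
  have h2 := congrArg Complex.im h1
  rw [← Complex.ofReal_pow, Complex.im_ofReal_mul] at h2
  simp at h2
  have := s.im_pos₁
  have := mul_nonneg (sq_nonneg r) s.im_pos₂.le
  linarith

end Shape

/-! ### Gram values of the fiber holonomy as functions of r = m / z₂ -/

lemma real_of_sq_real {r : ℂ} {t : ℝ} (ht : 0 ≤ t) (h : r ^ 2 = t) :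
    (starRingEnd ℂ) r = r := by
  rw [Complex.conj_eq_iff_im]
  have h1 := congrArg Complex.re h
  have h2 := congrArg Complex.im h
  simp [pow_two] at h1 h2
  by_contra hi
  have hr : r.re = 0 := by
    have : r.re * r.im = 0 := by linarith
    exact (mul_eq_zero.mp this).resolve_right hi
  rw [hr] at h1
  have := mul_self_pos.mpr hi
  linarith

/-- The Gram determinant factors as (1 + r)⁴ (r - 1)² (r² + 3r + 1) / (4r²), and all its zeros are
real: for the last factor, (2r + 3)² = 5. -/
lemma gram_ne_zero {r : ℂ} (hr : (starRingEnd ℂ) r ≠ r) (hr0 : r ≠ 0) :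
    ((1 + r) ^ 2 * ((1 + r) ^ 2 - 2 * (1 + r⁻¹)) / 4) ^ 2 -
      ((1 + r) ^ 2 * ((1 + r) ^ 2 - 4) / 4) * ((1 + r) ^ 2 * ((1 + r) ^ 2 - 4) / 4) ≠ 0 := by
  have h1 : 1 + r ≠ 0 := by
    intro h
    apply hr
    rw [show r = -1 by linear_combination h]
    simp
  have h2 : r - 1 ≠ 0 := by
    intro h
    apply hr
    rw [show r = 1 by linear_combination h]
    simp
  have h3 : r ^ 2 + 3 * r + 1 ≠ 0 := by
    intro h
    apply hr
    have := real_of_sq_real (r := 2 * r + 3) (t := 5) (by norm_num)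
      (by push_cast; linear_combination 4 * h)
    simp only [map_add, map_mul, Complex.conj_ofNat] at this
    linear_combination this / 2
  have h4 : ((1 + r) ^ 2 * ((1 + r) ^ 2 - 2 * (1 + r⁻¹)) / 4) ^ 2 -
      ((1 + r) ^ 2 * ((1 + r) ^ 2 - 4) / 4) * ((1 + r) ^ 2 * ((1 + r) ^ 2 - 4) / 4) =
      (1 + r) ^ 4 * (r - 1) ^ 2 * (r ^ 2 + 3 * r + 1) / (4 * r ^ 2) := by
    field_simp
    ring
  rw [h4]
  exact div_ne_zero (mul_ne_zero (mul_ne_zero (pow_ne_zero _ h1) (pow_ne_zero _ h2)) h3)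
    (mul_ne_zero (by norm_num) (pow_ne_zero _ hr0))

/-- Let δ and ε be the two quantities. Then 2δ / (ε - δ) = r(r + 3), and if this is real with r not
real, then Re r = -3/2. At such r the imaginary part of δ is Im r · ((Im r)² + 7/4) / 2, which is
not zero. -/
lemma not_both_real {r : ℂ} (hr : (starRingEnd ℂ) r ≠ r) (hr0 : r ≠ 0) :
    ¬ ((starRingEnd ℂ) ((1 + r) ^ 2 * ((1 + r) ^ 2 - 4) / 4) =
        (1 + r) ^ 2 * ((1 + r) ^ 2 - 4) / 4 ∧
      (starRingEnd ℂ) ((1 + r) ^ 2 * ((1 + r) ^ 2 - 2 * (1 + r⁻¹)) / 4) =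
        (1 + r) ^ 2 * ((1 + r) ^ 2 - 2 * (1 + r⁻¹)) / 4) := by
  rintro ⟨h1, h2⟩
  have n1 : r + 1 ≠ 0 := by
    intro h
    apply hr
    rw [show r = -1 by linear_combination h]
    simp
  have n2 : r - 1 ≠ 0 := by
    intro h
    apply hr
    rw [show r = 1 by linear_combination h]
    simp
  have hq : (starRingEnd ℂ) (r * (r + 3)) = r * (r + 3) := by
    have e : r * (r + 3) = ((1 + r) ^ 2 * ((1 + r) ^ 2 - 4) / 4) /
        ((1 + r) ^ 2 * ((1 + r) ^ 2 - 2 * (1 + r⁻¹)) / 4 -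
          (1 + r) ^ 2 * ((1 + r) ^ 2 - 4) / 4) * 2 := by
      have : (1 + r) ^ 2 * ((1 + r) ^ 2 - 2 * (1 + r⁻¹)) / 4 -
          (1 + r) ^ 2 * ((1 + r) ^ 2 - 4) / 4 = (r + 1) ^ 2 * (r - 1) / (2 * r) := by
        field_simp
        ring
      rw [this]
      field_simp
      ring
    rw [e, map_mul, map_div₀, map_sub, h1, h2, Complex.conj_ofNat]
  rw [Complex.conj_eq_iff_im] at h1 hq
  have hi : r.im ≠ 0 := fun h => hr (Complex.conj_eq_iff_im.mpr h)
  have q1 : r.im * (2 * r.re + 3) = 0 := by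
    simp at hq
    linarith
  have q2 := (mul_eq_zero.mp q1).resolve_left hi
  have q3 : r.re = -3 / 2 := by linarith
  have q4 : ((1 + r) ^ 2 * ((1 + r) ^ 2 - 4) / 4).im =
      (1 + r.re) * r.im * ((1 + r.re) ^ 2 - r.im ^ 2 - 2) := by
    have : (1 + r) ^ 2 * ((1 + r) ^ 2 - 4) / 4 = (1 + r) ^ 2 * ((1 + r) ^ 2 - 4) * ((1 / 4 : ℝ) : ℂ) := by
      push_cast; ring
    rw [this, Complex.im_mul_ofReal]
    simp [pow_two]
    ring
  rw [q4, q3] at h1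
  have h5 : r.im * (r.im ^ 2 + 7 / 4) = 0 := by linear_combination 2 * h1
  rcases mul_eq_zero.mp h5 with h | h
  · exact hi h
  · nlinarith [sq_nonneg r.im]

namespace Shape

variable (s : Shape)

lemma y₂'_mul_y₂ : s.y₂' * s.y₂ = s.m • 1 := by
  ext i j
  fin_cases i <;> fin_cases j <;> simp [y₂, y₂']; ring

lemma herm_adRep_y_inv (v : VSpace) :
    ((‖s.m‖ ^ 2 : ℝ) : ℂ) • herm (coordEquiv (s.adRep y⁻¹ v)) =
      symSq s.y₂' * herm (coordEquiv v) * (symSq s.y₂')ᴴ := by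
  have h0 : ((‖s.m‖ ^ 2 : ℝ) : ℂ) ≠ 0 := by
    simpa using s.m_ne_zero
  have h := s.herm_adRep_y (s.adRep y⁻¹ v)
  rw [Representation.self_inv_apply] at h
  apply smul_right_injective _ h0
  have hm : ((‖s.m‖ ^ 2 : ℝ) : ℂ) = s.m * (starRingEnd ℂ) s.m := by
    rw [Complex.mul_conj, Complex.normSq_eq_norm_sq]
  have h1 : symSq s.y₂' * symSq s.y₂ = s.m ^ 2 • 1 := by
    rw [← symSq_mul, y₂'_mul_y₂, symSq_smul, symSq_one]
  have h2 : (symSq s.y₂)ᴴ * (symSq s.y₂')ᴴ = (starRingEnd ℂ) s.m ^ 2 • 1 := by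
    rw [← conjTranspose_mul, h1]
    simp
  calc _ = (symSq s.y₂' * symSq s.y₂) * herm (coordEquiv (s.adRep y⁻¹ v)) *
        ((symSq s.y₂)ᴴ * (symSq s.y₂')ᴴ) := by
        rw [h1, h2, hm]
        simp only [Matrix.smul_mul, Matrix.mul_smul, Matrix.one_mul, Matrix.mul_one, smul_smul]
        congr 1
        ring
    _ = symSq s.y₂' * (symSq s.y₂ * herm (coordEquiv (s.adRep y⁻¹ v)) * (symSq s.y₂)ᴴ) *
        (symSq s.y₂')ᴴ := by simp only [Matrix.mul_assoc]
    _ = _ := by rw [← h]; simp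

lemma herm_invariant_left {v : VSpace} (h : s.adRep (x * y⁻¹) v = v) :
    symSq (s.x₂ * s.y₂') * herm (coordEquiv v) * (symSq (s.x₂ * s.y₂'))ᴴ =
      (s.m ^ 2 * (starRingEnd ℂ) (s.m ^ 2)) • herm (coordEquiv v) := by
  have h1 := s.herm_adRep_x (s.adRep y⁻¹ v)
  rw [← Module.End.mul_apply, ← map_mul, h] at h1
  have h2 := s.herm_adRep_y_inv v
  rw [symSq_mul, conjTranspose_mul]
  calc _ = symSq s.x₂ * (symSq s.y₂' * herm (coordEquiv v) * (symSq s.y₂')ᴴ) * (symSq s.x₂)ᴴ := by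
        simp only [Matrix.mul_assoc]
    _ = _ := by
      rw [← h2, Matrix.mul_smul, Matrix.smul_mul, ← h1, smul_smul]
      congr 1
      rw [← Complex.normSq_eq_norm_sq, ← Complex.mul_conj, map_pow]
      ring

lemma herm_invariant_right {v : VSpace} (h : s.adRep (y⁻¹ * x) v = v) :
    symSq (s.y₂' * s.x₂) * herm (coordEquiv v) * (symSq (s.y₂' * s.x₂))ᴴ =
      (s.m ^ 2 * (starRingEnd ℂ) (s.m ^ 2)) • herm (coordEquiv v) := by
  have h1 := s.herm_adRep_y_inv (s.adRep x v)
  rw [← Module.End.mul_apply, ← map_mul, h] at h1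
  have h2 := s.herm_adRep_x v
  rw [symSq_mul, conjTranspose_mul]
  calc _ = symSq s.y₂' * (symSq s.x₂ * herm (coordEquiv v) * (symSq s.x₂)ᴴ) * (symSq s.y₂')ᴴ := by
        simp only [Matrix.mul_assoc]
    _ = _ := by
      rw [← h2, Matrix.mul_smul, Matrix.smul_mul, ← h1, smul_smul]
      congr 1
      rw [← Complex.normSq_eq_norm_sq, ← Complex.mul_conj, map_pow]
      ring

lemma eq_zero_of_fiber_invariant (v : VSpace) (ha : s.adRep a v = v) (hb : s.adRep b v = v) :
    v = 0 := by
  -- The pair xy⁻¹ = b and y⁻¹x = a⁻¹b is used in place of a and b: these are conjugate in π₁(M),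
  -- hence have the same trace and determinant, and their matrices are short.
  have hb' : s.adRep (y⁻¹ * x) v = v := by
    have : y⁻¹ * x = a⁻¹ * b := by simp only [a, b]; group
    rw [this, map_mul, Module.End.mul_apply, hb]
    conv_lhs => rw [← ha]
    rw [Representation.inv_self_apply]
  have hm := s.m_ne_zero
  have hz : s.z₂ ≠ 0 := (im_pos_ne _ s.im_pos₂).1
  have hrel := s.m_rel
  have dl : (s.x₂ * s.y₂').det = s.m ^ 2 := by
    rw [det_mul]; simp [x₂, y₂', det_fin_two]; ring
  have dr : (s.y₂' * s.x₂).det = s.m ^ 2 := by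
    rw [det_mul]; simp [x₂, y₂', det_fin_two]; ring
  have tl : (s.x₂ * s.y₂').trace = 1 - s.z₂ + s.m ^ 2 := by
    simp [x₂, y₂', trace_fin_two]; ring
  have tr : (s.y₂' * s.x₂).trace = 1 - s.z₂ + s.m ^ 2 := by
    rw [trace_mul_comm, tl]
  have i1 := intertwines_of_invariant (by rw [dl]; exact pow_ne_zero 2 hm)
    (by rw [dl]; exact s.herm_invariant_left hb)
  have i2 := intertwines_of_invariant (by rw [dr]; exact pow_ne_zero 2 hm)
    (by rw [dr]; exact s.herm_invariant_right hb')
  rw [dl, tl] at i1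
  rw [dr, tr] at i2
  set n := ((1 - s.z₂ + s.m ^ 2) / s.m ^ 2) • tracelessPart (s.x₂ * s.y₂') with hn
  set n' := ((1 - s.z₂ + s.m ^ 2) / s.m ^ 2) • tracelessPart (s.y₂' * s.x₂) with hn'
  set r := s.m / s.z₂ with hr
  have hr0 : r ≠ 0 := div_ne_zero hm hz
  -- The determinant being m², the normalized trace is 1 + r; this is why r parametrizes everything
  -- below.
  have ht : 1 - s.z₂ + s.m ^ 2 = s.m * (1 + r) := by
    rw [hr]
    field_simp
    linear_combination -hrel
  have f1 : adForm n n = (1 + r) ^ 2 * ((1 + r) ^ 2 - 4) / 4 := by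
    have : adForm n n = ((1 - s.z₂ + s.m ^ 2) / s.m ^ 2) ^ 2 *
        ((1 - s.z₂ + s.m ^ 2) ^ 2 - 4 * s.m ^ 2) / 4 := by
      rw [hn]
      simp [adForm, tracelessPart, x₂, y₂', Matrix.mul_apply, Fin.sum_univ_two]
      ring
    rw [this, ht]
    field_simp
  have f2 : adForm n' n' = (1 + r) ^ 2 * ((1 + r) ^ 2 - 4) / 4 := by
    have : adForm n' n' = ((1 - s.z₂ + s.m ^ 2) / s.m ^ 2) ^ 2 *
        ((1 - s.z₂ + s.m ^ 2) ^ 2 - 4 * s.m ^ 2) / 4 := by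
      rw [hn']
      simp [adForm, tracelessPart, x₂, y₂', Matrix.mul_apply, Fin.sum_univ_two]
      ring
    rw [this, ht]
    field_simp
  have f3 : adForm n n' = (1 + r) ^ 2 * ((1 + r) ^ 2 - 2 * (1 + r⁻¹)) / 4 := by
    have : adForm n n' = ((1 - s.z₂ + s.m ^ 2) / s.m ^ 2) ^ 2 *
        ((1 - s.z₂ + s.m ^ 2) ^ 2 - 2 * s.m ^ 2 - 2 * s.m * s.z₂) / 4 := by
      rw [hn, hn']
      simp [adForm, tracelessPart, x₂, y₂', Matrix.mul_apply, Fin.sum_univ_two]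
      linear_combination (-1 / 2) * ((1 - s.z₂ + s.m ^ 2) / s.m ^ 2) ^ 2 * hrel
    rw [this, ht, hr]
    field_simp
    ring
  have hK : herm (coordEquiv v) * formMat = 0 := by
    refine eq_zero_of_intertwines (n := n) (n' := n') ?_ ?_ i1 i2
    · rw [f1, f2, f3]
      exact gram_ne_zero s.not_real_ratio hr0
    · rw [f1, f3]
      exact not_both_real s.not_real_ratio hr0
  have hform : formMat * !![0, 0, 1; 0, -1 / 2, 0; 1, 0, 0] = 1 := by
    ext i j
    fin_cases i <;> fin_cases j <;> simp [formMat, Matrix.mul_apply, Fin.sum_univ_three]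
    norm_num
  have h0 : herm (coordEquiv v) = 0 := by
    have := congrArg (· * (!![0, 0, 1; 0, -1 / 2, 0; 1, 0, 0] : Matrix (Fin 3) (Fin 3) ℂ)) hK
    simpa only [Matrix.mul_assoc, hform, Matrix.mul_one, Matrix.zero_mul] using this
  have h00 : herm 0 = 0 := by
    ext i j
    fin_cases i <;> fin_cases j <;> simp [herm, Complex.ext_iff]
  rw [← h00] at h0
  simpa using herm_injective h0

theorem range_sup_range (s : Shape) :
    LinearMap.range (s.adRep a - 1) ⊔ LinearMap.range (s.adRep b - 1) = ⊤ :=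
  s.range_sup_range_eq_top s.eq_zero_of_fiber_invariant

end Shape

/-! ### Integral structure of the complete representation -/

lemma sqrt_three_ne_zero : √(3 : ℝ) ≠ 0 := by
  rw [Real.sqrt_ne_zero']
  norm_num

/-- The change from real and imaginary parts to the basis `1, ω` of `ℂ`. -/
def eisensteinEquiv : (Fin 9 → ℝ) ≃ₗ[ℝ] (Fin 9 → ℝ) where
  toFun c := ![c 0, c 1, c 2, c 3 - c 4 / √3, 2 * c 4 / √3, c 5 - c 6 / √3, 2 * c 6 / √3,
    c 7 - c 8 / √3, 2 * c 8 / √3]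
  invFun d := ![d 0, d 1, d 2, d 3 + d 4 / 2, d 4 * √3 / 2, d 5 + d 6 / 2, d 6 * √3 / 2,
    d 7 + d 8 / 2, d 8 * √3 / 2]
  left_inv c := by
    have := sqrt_three_ne_zero
    ext i
    fin_cases i <;> simp <;> field_simp <;> ring
  right_inv d := by
    have := sqrt_three_ne_zero
    ext i
    fin_cases i <;> simp <;> field_simp <;> ring
  map_add' c d := by
    ext i
    fin_cases i <;> simp <;> ring
  map_smul' r c := by
    ext i
    fin_cases i <;> simp <;> ring

/-- Coordinates on `𝔳` in which the complete representation is integral. -/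
def eisenstein : VSpace ≃ₗ[ℝ] (Fin 9 → ℝ) := coordEquiv.trans eisensteinEquiv

/-- The Hermitian matrix with given Eisenstein coordinates. -/
def eisensteinHerm (d : Fin 9 → ℝ) : Matrix (Fin 3) (Fin 3) ℂ :=
  !![(d 0 : ℂ), d 3 + d 4 * Shape.ω, d 5 + d 6 * Shape.ω;
    d 3 + d 4 * (1 - Shape.ω), (d 1 : ℂ), d 7 + d 8 * Shape.ω;
    d 5 + d 6 * (1 - Shape.ω), d 7 + d 8 * (1 - Shape.ω), (d 2 : ℂ)]

lemma herm_eisensteinEquiv_symm (d : Fin 9 → ℝ) :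
    herm (eisensteinEquiv.symm d) = eisensteinHerm d := by
  have hsymm : eisensteinEquiv.symm d = ![d 0, d 1, d 2, d 3 + d 4 / 2, d 4 * √3 / 2,
    d 5 + d 6 / 2, d 6 * √3 / 2, d 7 + d 8 / 2, d 8 * √3 / 2] := rfl
  rw [hsymm]
  ext i j
  fin_cases i <;> fin_cases j <;>
    simp [herm, eisensteinHerm, Shape.ω_eq, Complex.ext_iff] <;> constructor <;> ring

lemma herm_coordEquiv (v : VSpace) : herm (coordEquiv v) = eisensteinHerm (eisenstein v) := by
  rw [← herm_eisensteinEquiv_symm]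
  simp [eisenstein]

lemma eisensteinHerm_injective : Function.Injective eisensteinHerm := by
  intro c d h
  rw [← herm_eisensteinEquiv_symm, ← herm_eisensteinEquiv_symm] at h
  exact eisensteinEquiv.symm.injective (herm_injective h)

namespace Shape

lemma conj_ω : (starRingEnd ℂ) ω = 1 - ω := by
  rw [ω_eq]
  apply Complex.ext <;> simp [map_ofNat]
  norm_num

lemma complete_m : complete.m = 1 := by
  change ω * (1 - ω) = 1
  linear_combination -ω_sq

lemma complete_u : complete.u = 0 := by
  rw [u, complete_m, Complex.log_one]

end Shape

/-- The action of `x` on `𝔳₀` in Eisenstein coordinates. -/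
def intX : Matrix (Fin 9) (Fin 9) ℤ :=
  !![1, 4, 1, -4, -2, 2, 1, -4, -2;
    0, 1, 1, 0, 0, 0, 0, -2, -1;
    0, 0, 1, 0, 0, 0, 0, 0, 0;
    0, -2, -1, 1, 0, -1, 0, 3, 1;
    0, 0, 0, 0, 1, 0, -1, 0, 1;
    0, 0, 1, 0, 0, 1, 0, -2, 0;
    0, 0, 0, 0, 0, 0, 1, 0, -2;
    0, 0, -1, 0, 0, 0, 0, 1, 0;
    0, 0, 0, 0, 0, 0, 0, 0, 1]

/-- The inverse of `intX`. -/
def intXInv : Matrix (Fin 9) (Fin 9) ℤ :=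
  !![1, 4, 1, 4, 2, 2, 1, 4, 2;
    0, 1, 1, 0, 0, 0, 0, 2, 1;
    0, 0, 1, 0, 0, 0, 0, 0, 0;
    0, 2, 1, 1, 0, 1, 0, 3, 1;
    0, 0, 0, 0, 1, 0, 1, 0, 1;
    0, 0, 1, 0, 0, 1, 0, 2, 0;
    0, 0, 0, 0, 0, 0, 1, 0, 2;
    0, 0, 1, 0, 0, 0, 0, 1, 0;
    0, 0, 0, 0, 0, 0, 0, 0, 1]

/-- The action of `y` on `𝔳₀` in Eisenstein coordinates. -/
def intY : Matrix (Fin 9) (Fin 9) ℤ :=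
  !![1, 0, 0, 0, 0, 0, 0, 0, 0;
    1, 1, 0, -1, 1, 0, 0, 0, 0;
    1, 4, 1, -2, 2, -1, -2, -2, 2;
    -1, 0, 0, 1, 0, 0, 0, 0, 0;
    1, 0, 0, 0, 1, 0, 0, 0, 0;
    0, 0, 0, -2, -2, 1, 0, 0, 0;
    -1, 0, 0, 2, 0, 0, 1, 0, 0;
    -1, -2, 0, 2, -1, 0, 1, 1, 0;
    1, 2, 0, -1, 2, -1, -1, 0, 1]

/-- The inverse of `intY`. -/
def intYInv : Matrix (Fin 9) (Fin 9) ℤ :=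
  !![1, 0, 0, 0, 0, 0, 0, 0, 0;
    1, 1, 0, 1, -1, 0, 0, 0, 0;
    1, 4, 1, 2, -2, -1, -2, 2, -2;
    1, 0, 0, 1, 0, 0, 0, 0, 0;
    -1, 0, 0, 0, 1, 0, 0, 0, 0;
    0, 0, 0, 2, 2, 1, 0, 0, 0;
    -1, 0, 0, -2, 0, 0, 1, 0, 0;
    1, 2, 0, 2, -1, 0, -1, 1, 0;
    -1, -2, 0, -1, 2, 1, 1, 0, 1]

/-- The action of `a` on `𝔳₀` in Eisenstein coordinates. -/
def intA : Matrix (Fin 9) (Fin 9) ℤ :=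
  !![0, 0, 1, 0, 0, 0, 0, 0, 0;
    0, 1, 3, 0, 0, 0, 0, 0, 3;
    1, 12, 9, 0, 6, -6, -3, 0, 18;
    0, 0, -1, 0, 0, 0, 0, 1, 0;
    0, 0, -1, 0, 0, 0, 0, -1, -1;
    0, 0, 0, 0, 0, 0, -1, -4, -2;
    0, 0, 3, 0, 0, -1, 0, 2, 4;
    0, -2, -3, 1, 0, 1, 2, 3, -3;
    0, -2, -3, -1, -1, 1, -1, -3, -6]

/-- The action of `b` on `𝔳₀` in Eisenstein coordinates. -/
def intB : Matrix (Fin 9) (Fin 9) ℤ :=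
  !![1, 4, 1, -2, -4, -1, 1, -2, -4;
    1, 3, 1, 0, -3, -2, -1, 0, -3;
    1, 4, 1, 2, -2, -1, -2, 2, -2;
    0, -2, -1, 0, 1, 1, 0, 1, 3;
    -1, -2, 0, 1, 3, 1, 0, 0, 1;
    -1, 0, 1, 0, 2, 0, 0, 0, -2;
    1, 4, 0, 0, -4, -2, -1, 0, -2;
    0, -2, -1, 0, 1, 1, 1, -1, 2;
    -1, -2, 0, -1, 2, 1, 1, 0, 1]

/-- The action of `x b⁻¹` on `𝔳₀` in Eisenstein coordinates. -/
def intXBInv : Matrix (Fin 9) (Fin 9) ℤ :=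
  !![9, 12, 1, 18, 18, 3, 6, 6, 6;
    3, 7, 1, 6, 9, 0, 3, 4, 5;
    1, 4, 1, 2, 4, -1, 1, 2, 4;
    -6, -10, -1, -12, -15, -1, -5, -5, -6;
    3, 8, 1, 9, 9, 2, 4, 5, 5;
    3, 4, 0, 4, 8, -2, 1, 0, 2;
    -3, -8, -1, -8, -10, 0, -4, -4, -6;
    -2, -6, -1, -4, -7, 1, -2, -3, -5;
    1, 4, 1, 3, 4, 0, 2, 3, 4]

/-- The action of `x a⁻¹` on `𝔳₀` in Eisenstein coordinates. -/
def intXAInv : Matrix (Fin 9) (Fin 9) ℤ :=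
  !![16, 16, 1, 16, 32, -4, 4, 4, 8;
    4, 1, 0, 2, 4, 0, 0, 0, 0;
    1, 0, 0, 0, 0, 0, 0, 0, 0;
    0, 0, 0, 4, 0, 2, 2, 1, 0;
    -8, -4, 0, -8, -12, 0, -2, -1, -1;
    -4, 0, 0, -4, -4, 0, -1, 0, 0;
    4, 0, 0, 0, 4, -1, 0, 0, 0;
    0, 0, 0, 1, 0, 0, 0, 0, 0;
    -2, 0, 0, -1, -1, 0, 0, 0, 0]

/-- The values at `a` of the iterates under `x` of a cyclic vector of `H¹(F; 𝔳₀)`. -/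
def cycA : Fin 10 → Fin 9 → ℤ :=
  ![![0, 0, 1, 0, 0, 0, 0, 0, 0],
    ![1, 1, 2, -1, 1, 0, -1, -1, 1],
    ![27, 20, 28, -25, 14, 15, -20, -23, 16],
    ![450, 288, 451, -366, 162, 248, -262, -356, 220],
    ![6298, 3857, 6299, -4894, 2014, 3382, -3412, -4864, 2920],
    ![84063, 50960, 84064, -64609, 26177, 44804, -44859, -64539, 38517],
    ![1110561, 671948, 1110562, -851777, 344206, 591017, -591108, -851637, 507732],
    ![14644528, 8857997, 14644529, -11228294, 4535682, 7791564, -7791704, -11228042, 6692892],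
    ![193055820, 116768100, 193055821, -148013276, 59787172, 102710868, -102711072, -148012856, 88226560],
    ![2544912921, 1539259400, 2544912922, -1951138143, 788120667, 1353955348, -1353955633, -1951137483, 1163018181]]

/-- The values at `b` of the iterates under `x` of a cyclic vector of `H¹(F; 𝔳₀)`. -/
def cycB : Fin 10 → Fin 9 → ℤ :=
  ![![0, 0, 0, 0, 0, 0, 0, 0, 0],
    ![-1, 0, 0, 0, 0, 0, 0, 0, 0],
    ![-66, -11, -2, 7, 22, 7, -12, 1, 4],
    ![-1182, -307, -93, 152, 488, 204, -332, 32, 146],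
    ![-16600, -4783, -1632, 2232, 7206, 3222, -5180, 518, 2420],
    ![-221283, -65212, -22898, 30030, 97086, 44088, -70664, 7126, 33478],
    ![-2921946, -864642, -305346, 397179, 1284420, 584997, -937032, 94639, 445144],
    ![-38526532, -11407850, -4032507, 5238212, 16940360, 7719272, -12363152, 1248956, 5875844],
    ![-507878772, -150398363, -53171060, 69055542, 223326630, 101770952, -162993236, 16466506, 77470936],
    ![-6694976553, -1982609363, -700934592, 910310474, 2943959138, 1341587428, -2148640620, 217068818, 1021260908]]

/-- The values at `a` of the iterates under `x` of a cyclic vector of `H¹(F, ∂F; 𝔳₀)`. -/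
def relCycA : Fin 10 → Fin 9 → ℤ :=
  ![![2, 0, 2, 0, 0, 2, 0, 0, 0],
    ![10, 3, 2, -6, 2, 4, -2, -2, 0],
    ![86, 43, 54, -58, 22, 38, -36, -50, 28],
    ![966, 564, 894, -720, 288, 496, -494, -708, 420],
    ![12342, 7427, 12214, -9422, 3802, 6534, -6532, -9406, 5604],
    ![161962, 97899, 161762, -124106, 50126, 86116, -86114, -124086, 73960],
    ![2133826, 1290528, 2133538, -1635864, 660768, 1135170, -1135168, -1635840, 975072],
    ![28126762, 17011995, 28126370, -21564118, 8710354, 14964004, -14964002, -21564090, 12853736],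
    ![370769910, 224255315, 370769398, -284262082, 114821510, 197258310, -197258308, -284262050, 169440540],
    ![4887555462, 2956175604, 4887554814, -3747195888, 1513598688, 2600296048, -2600296046, -3747195852, 2233597164]]

/-- The values at `b` of the iterates under `x` of a cyclic vector of `H¹(F, ∂F; 𝔳₀)`. -/
def relCycB : Fin 10 → Fin 9 → ℤ :=
  ![![0, 1, 0, 0, 0, 2, 0, 0, 0],
    ![-18, -7, -2, 0, 12, 8, -8, 0, 4],
    ![-196, -70, -28, 22, 102, 54, -76, 6, 40],
    ![-2466, -761, -282, 328, 1120, 528, -824, 80, 404],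
    ![-32320, -9629, -3432, 4384, 14276, 6538, -10432, 1048, 4984],
    ![-425830, -126196, -44662, 57886, 187350, 85428, -136756, 13806, 65044],
    ![-5613152, -1662383, -587792, 763200, 2468400, 1124946, -1801584, 181992, 856368],
    ![-73993378, -21912167, -7746978, 10060808, 32537076, 14827544, -23747160, 2399064, 11287260],
    ![-975394244, -288847982, -102120140, 132623622, 428907334, 195457126, -313037212, 31624926, 148788632],
    ![-12857829362, -3807645209, -1346164154, 1748269616, 5653933640, 2576549408, -4126512136, 416885704, 1961356780]]

/-- With `annB`, nine functionals on crossed homomorphisms that vanish on coboundaries. -/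
def annA : Matrix (Fin 9) (Fin 9) ℤ :=
  !![1, 3, 1, 0, 3, -1, 1, 3, 3;
    40, 66, 4, 60, 24, -4, -59, 6, 0;
    20, 78, 2, 84, 12, 34, -25, 30, 0;
    0, -8, 0, -12, -6, 0, 3, 0, 0;
    -6, -2, 0, 0, 0, 0, 3, 0, 0;
    -56, 30, -2, -12, 132, -52, -11, -30, 0;
    29, 78, 2, 66, -24, 25, -43, 30, 0;
    -2, -42, -2, -30, -30, -10, 19, -12, 0;
    -12, -18, 0, -24, 12, -8, 11, -6, 0]

/-- With `annA`, nine functionals on crossed homomorphisms that vanish on coboundaries. -/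
def annB : Matrix (Fin 9) (Fin 9) ℤ :=
  !![0, 0, 0, 0, 0, 0, 0, 0, 0;
    -27, 36, 0, 0, 0, 0, 0, 0, 0;
    -9, 0, 18, 0, 0, 0, 0, 0, 0;
    3, 0, 0, 6, 0, 0, 0, 0, 0;
    3, 0, 0, 0, 6, 0, 0, 0, 0;
    -9, 0, 0, 0, 0, 54, 0, 0, 0;
    -18, 0, 0, 0, 0, 0, 27, 0, 0;
    9, 0, 0, 0, 0, 0, 0, 18, 0;
    3, 0, 0, 0, 0, 0, 0, 0, 12]

/-- An inverse modulo `5` of the values of `annA`, `annB` at the iterates of the cyclic vector. -/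
def cycInv : Matrix (Fin 9) (Fin 9) ℤ :=
  !![4, 3, 4, 4, 2, 3, 1, 2, 4;
    1, 0, 0, 3, 1, 0, 3, 1, 3;
    3, 2, 3, 0, 4, 2, 3, 2, 1;
    0, 3, 2, 3, 4, 3, 4, 4, 3;
    4, 1, 3, 4, 4, 0, 2, 4, 1;
    1, 4, 2, 0, 0, 0, 2, 0, 1;
    2, 3, 0, 1, 2, 0, 1, 3, 2;
    0, 0, 4, 0, 4, 3, 4, 0, 0;
    4, 4, 2, 3, 1, 2, 0, 0, 1]

/-- An inverse modulo `5` of the combination `relCycA + 1 relCycB`. -/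
def relCycInv : Matrix (Fin 9) (Fin 9) ℤ :=
  !![4, 2, 4, 3, 3, 2, 1, 4, 0;
    1, 2, 3, 4, 1, 0, 4, 2, 4;
    0, 0, 1, 3, 2, 2, 3, 2, 0;
    3, 3, 2, 3, 4, 3, 2, 1, 1;
    3, 1, 0, 3, 3, 2, 3, 0, 0;
    4, 1, 2, 3, 0, 3, 2, 0, 2;
    1, 1, 3, 3, 0, 4, 0, 1, 1;
    1, 0, 3, 1, 1, 3, 0, 3, 0;
    4, 4, 3, 3, 2, 3, 0, 2, 4]

/-- The real vector with given integral coordinates. -/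
def vecOf (c : Fin 9 → ℤ) : VSpace := eisenstein.symm fun i => (c i : ℝ)

lemma eisenstein_vecOf (c : Fin 9 → ℤ) : eisenstein (vecOf c) = fun i => (c i : ℝ) :=
  eisenstein.apply_symm_apply _

lemma vecOf_add (c d : Fin 9 → ℤ) : vecOf (c + d) = vecOf c + vecOf d := by
  rw [vecOf, vecOf, vecOf, ← map_add]
  congr 1
  ext i
  simp

lemma vecOf_sub (c d : Fin 9 → ℤ) : vecOf (c - d) = vecOf c - vecOf d := by
  rw [vecOf, vecOf, vecOf, ← map_sub]
  congr 1
  ext i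
  simp

lemma vecOf_smul (r : ℤ) (c : Fin 9 → ℤ) : vecOf (r • c) = (r : ℝ) • vecOf c := by
  rw [vecOf, vecOf, ← map_smul]
  congr 1
  ext i
  simp

/-- The action of `g` at the complete structure has the integral matrix `M`. -/
def IsIntegralAction (g : Pi) (M : Matrix (Fin 9) (Fin 9) ℤ) : Prop :=
  ∀ v, eisenstein (Shape.complete.adRep g v) = M.map (Int.cast : ℤ → ℝ) *ᵥ eisenstein v

lemma map_intCast_mulVec (M : Matrix (Fin 9) (Fin 9) ℤ) (c : Fin 9 → ℤ) :
    M.map (Int.cast : ℤ → ℝ) *ᵥ (fun i => (c i : ℝ)) = fun i => ((M *ᵥ c) i : ℝ) := by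
  ext i
  simp [mulVec, dotProduct]

namespace IsIntegralAction

lemma mul {g h : Pi} {M N : Matrix (Fin 9) (Fin 9) ℤ} (hg : IsIntegralAction g M)
    (hh : IsIntegralAction h N) : IsIntegralAction (g * h) (M * N) := by
  intro v
  rw [map_mul, Module.End.mul_apply, hg, hh, mulVec_mulVec]
  congr 1
  ext i j
  simp [Matrix.mul_apply]

lemma inv {g : Pi} {M N : Matrix (Fin 9) (Fin 9) ℤ} (hg : IsIntegralAction g M)
    (hNM : N * M = 1) : IsIntegralAction g⁻¹ N := by
  intro v
  have h := hg (Shape.complete.adRep g⁻¹ v)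
  rw [Representation.self_inv_apply] at h
  rw [h, mulVec_mulVec]
  have : N.map (Int.cast : ℤ → ℝ) * M.map (Int.cast : ℤ → ℝ) = 1 := by
    have := congrArg (Int.castRingHom ℝ).mapMatrix hNM
    rwa [map_mul, map_one] at this
  rw [this, one_mulVec]

lemma vecOf {g : Pi} {M : Matrix (Fin 9) (Fin 9) ℤ} (hg : IsIntegralAction g M)
    (c : Fin 9 → ℤ) :
    Shape.complete.adRep g (FigureEight.vecOf c) = FigureEight.vecOf (M *ᵥ c) := by
  apply eisenstein.injective
  rw [hg, eisenstein_vecOf, eisenstein_vecOf, map_intCast_mulVec]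

end IsIntegralAction

/-- At the complete structure m = 1 and z₂ = ω, so `x₂` and `y₂` have entries in ℤ[ω] and
determinant 1. They preserve the Hermitian matrices over ℤ[ω]. -/
lemma eisensteinHerm_x (d : Fin 9 → ℝ) :
    symSq Shape.complete.x₂ * eisensteinHerm d * (symSq Shape.complete.x₂)ᴴ =
      eisensteinHerm (intX.map (Int.cast : ℤ → ℝ) *ᵥ d) := by
  ext i j
  rw [Shape.x₂, Shape.complete_m]
  fin_cases i <;> fin_cases j <;>
    (simp [symSq, eisensteinHerm, Matrix.mul_apply, mulVec, dotProduct,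
      Fin.sum_univ_succ, intX, map_ofNat]
     try ring)

lemma symSq_complete_y₂ : symSq Shape.complete.y₂ =
    !![1, 0, 0; -Shape.ω, 1, 0; Shape.ω - 1, -2 * Shape.ω, 1] := by
  rw [Shape.y₂, Shape.complete_m, show Shape.complete.z₂ = Shape.ω from rfl]
  ext i j
  fin_cases i <;> fin_cases j <;> simp [symSq, Shape.ω_sq]

lemma eisensteinHerm_y (d : Fin 9 → ℝ) :
    symSq Shape.complete.y₂ * eisensteinHerm d * (symSq Shape.complete.y₂)ᴴ =
      eisensteinHerm (intY.map (Int.cast : ℤ → ℝ) *ᵥ d) := by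
  have hω := Shape.ω_sq
  have hc := Shape.conj_ω
  rw [symSq_complete_y₂]
  ext i j
  fin_cases i <;> fin_cases j <;>
    (simp [eisensteinHerm, Matrix.mul_apply, mulVec, dotProduct,
      Fin.sum_univ_succ, intY, hc, map_ofNat]
     try grind)

lemma isIntegralAction_x : IsIntegralAction x intX := by
  intro v
  have h := Shape.complete.herm_adRep_x v
  rw [Shape.complete_m, herm_coordEquiv, herm_coordEquiv, eisensteinHerm_x] at h
  exact eisensteinHerm_injective (by simpa using h)

lemma isIntegralAction_y : IsIntegralAction y intY := by
  intro v
  have h := Shape.complete.herm_adRep_y v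
  rw [Shape.complete_m, herm_coordEquiv, herm_coordEquiv, eisensteinHerm_y] at h
  exact eisensteinHerm_injective (by simpa using h)

lemma isIntegralAction_x_inv : IsIntegralAction x⁻¹ intXInv :=
  isIntegralAction_x.inv (by decide +kernel)

lemma isIntegralAction_y_inv : IsIntegralAction y⁻¹ intYInv :=
  isIntegralAction_y.inv (by decide +kernel)

lemma isIntegralAction_b : IsIntegralAction b intB := by
  have h : intX * intYInv = intB := by decide +kernel
  rw [← h]
  exact isIntegralAction_x.mul isIntegralAction_y_inv

lemma isIntegralAction_a : IsIntegralAction a intA := by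
  have h : intB * intXInv * intY = intA := by decide +kernel
  rw [← h]
  exact (isIntegralAction_b.mul isIntegralAction_x_inv).mul isIntegralAction_y

lemma isIntegralAction_x_mul_b_inv : IsIntegralAction (x * b⁻¹) intXBInv := by
  have h : intX * intY * intXInv = intXBInv := by decide +kernel
  have h' : x * b⁻¹ = x * y * x⁻¹ := by simp only [b]; group
  rw [← h, h']
  exact (isIntegralAction_x.mul isIntegralAction_y).mul isIntegralAction_x_inv

lemma isIntegralAction_x_mul_a_inv : IsIntegralAction (x * a⁻¹) intXAInv := by
  have h : intX * intYInv * intXBInv = intXAInv := by decide +kernel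
  have h' : x * a⁻¹ = x * y⁻¹ * (x * b⁻¹) := by simp only [a, b]; group
  rw [← h, h']
  exact (isIntegralAction_x.mul isIntegralAction_y_inv).mul isIntegralAction_x_mul_b_inv

/-! ### Cyclic vectors for the monodromy -/

/-- The iterates under `x` of a crossed homomorphism whose class is cyclic in `H¹(F; 𝔳₀)`. -/
def cyc (i : Fin 10) : VSpace × VSpace := (vecOf (cycA i), vecOf (cycB i))

/-- The iterates under `x` of a cyclic vector of `H¹(F, ∂F; 𝔳₀)`. -/
def relCyc (i : Fin 10) : VSpace × VSpace := (vecOf (relCycA i), vecOf (relCycB i))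

lemma twist_vecOf (c d : Fin 9 → ℤ) : twist Shape.complete.adRep (vecOf c, vecOf d) =
    (vecOf (intXBInv *ᵥ (c + intA *ᵥ c - d)), vecOf (intXAInv *ᵥ (d - c))) := by
  rw [twist_apply, ← isIntegralAction_x_mul_b_inv.vecOf, ← isIntegralAction_x_mul_a_inv.vecOf,
    vecOf_sub, vecOf_add, vecOf_sub, isIntegralAction_a.vecOf]

lemma twist_cyc (i : Fin 9) : twist Shape.complete.adRep (cyc i.castSucc) = cyc i.succ := by
  rw [cyc, twist_vecOf, cyc]
  have h : ∀ i : Fin 9, intXBInv *ᵥ (cycA i.castSucc + intA *ᵥ cycA i.castSucc -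
      cycB i.castSucc) = cycA i.succ := by decide +kernel
  have h' : ∀ i : Fin 9, intXAInv *ᵥ (cycB i.castSucc - cycA i.castSucc) = cycB i.succ := by
    decide +kernel
  rw [h, h']

lemma twist_relCyc (i : Fin 9) :
    twist Shape.complete.adRep (relCyc i.castSucc) = relCyc i.succ := by
  rw [relCyc, twist_vecOf, relCyc]
  have h : ∀ i : Fin 9, intXBInv *ᵥ (relCycA i.castSucc + intA *ᵥ relCycA i.castSucc -
      relCycB i.castSucc) = relCycA i.succ := by decide +kernel
  have h' : ∀ i : Fin 9, intXAInv *ᵥ (relCycB i.castSucc - relCycA i.castSucc) =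
      relCycB i.succ := by decide +kernel
  rw [h, h']

lemma boundary_relCyc_zero : boundary Shape.complete.adRep (relCyc 0) = 0 := by
  change Shape.complete.adRep (b⁻¹ * a⁻¹) ((Shape.complete.adRep b - 1) (vecOf (relCycA 0)) +
    (1 - Shape.complete.adRep a) (vecOf (relCycB 0))) = 0
  rw [LinearMap.sub_apply, LinearMap.sub_apply, isIntegralAction_a.vecOf,
    isIntegralAction_b.vecOf, Module.End.one_apply, Module.End.one_apply, ← vecOf_sub,
    ← vecOf_sub, ← vecOf_add]
  -- The invertible outer factor of `boundary` plays no role in its kernel, so the condition is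
  -- integral in a and b alone.
  have h : intB *ᵥ relCycA 0 - relCycA 0 + (relCycB 0 - intA *ᵥ relCycB 0) = 0 := by
    decide +kernel
  have h0 : vecOf 0 = 0 := by simpa using vecOf_smul 0 0
  rw [h, h0, map_zero]

/-- The coefficients of the characteristic polynomial of the monodromy. -/
def monodromyCoeff : Fin 10 → ℤ := ![-1, 18, -75, 169, -249, 249, -169, 75, -18, 1]

lemma vecOf_sum (r : Fin 10 → ℤ) (c : Fin 10 → Fin 9 → ℤ) :
    vecOf (∑ i, r i • c i) = ∑ i, (r i : ℝ) • vecOf (c i) := by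
  simp only [vecOf, ← map_smul, ← map_sum]
  congr 1
  ext i
  simp [Finset.sum_apply]

lemma sum_relCyc : ∑ i, (monodromyCoeff i : ℝ) • relCyc i = 0 := by
  have hA : ∑ i, monodromyCoeff i • relCycA i = 0 := by decide +kernel
  have hB : ∑ i, monodromyCoeff i • relCycB i = 0 := by decide +kernel
  have h0 : vecOf 0 = 0 := by simpa using vecOf_smul 0 0
  refine Prod.ext ?_ ?_
  · simp only [Prod.fst_sum, Prod.smul_fst, relCyc, ← vecOf_sum, hA, h0, Prod.fst_zero]
  · simp only [Prod.snd_sum, Prod.smul_snd, relCyc, ← vecOf_sum, hB, h0, Prod.snd_zero]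

/-- In H¹(F), unlike in the relative group, the relation holds only modulo coboundaries. The vector
on the right is the unique one with this coboundary, because a and b have no common fixed vector. -/
lemma sum_cyc : ∑ i, (monodromyCoeff i : ℝ) • cyc i = delta Shape.complete.adRep
    (vecOf ![-480, 0, 0, -56, 160, 16, -32, 0, 0]) := by
  set w : Fin 9 → ℤ := ![-480, 0, 0, -56, 160, 16, -32, 0, 0] with hw
  have hA : ∑ i, monodromyCoeff i • cycA i = intA *ᵥ w - w := by decide +kernel
  have hB : ∑ i, monodromyCoeff i • cycB i = intB *ᵥ w - w := by decide +kernel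
  have hd : delta Shape.complete.adRep (vecOf w) =
      (vecOf (intA *ᵥ w - w), vecOf (intB *ᵥ w - w)) := by
    rw [vecOf_sub, vecOf_sub, ← isIntegralAction_a.vecOf, ← isIntegralAction_b.vecOf]
    rfl
  rw [hd]
  refine Prod.ext ?_ ?_
  · simp only [Prod.fst_sum, Prod.smul_fst, cyc, ← vecOf_sum, hA]
  · simp only [Prod.snd_sum, Prod.smul_snd, cyc, ← vecOf_sum, hB]

/-- An integral matrix that is invertible modulo `5` is injective on real vectors. -/
lemma eq_zero_of_mulVec_eq_zero {M N : Matrix (Fin 9) (Fin 9) ℤ}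
    (h : ∀ i j, (N * M) i j % 5 = if i = j then 1 else 0) {c : Fin 9 → ℝ}
    (hc : M.map (Int.cast : ℤ → ℝ) *ᵥ c = 0) : c = 0 := by
  have h1 : (Int.castRingHom (ZMod 5)).mapMatrix (N * M) = 1 := by
    ext i j
    have h2 : (((N * M) i j : ℤ) : ZMod 5) = (((N * M) i j % 5 : ℤ) : ZMod 5) := by
      rw [ZMod.intCast_eq_intCast_iff]
      exact (Int.mod_modEq _ _).symm
    refine h2.trans ?_
    rw [h i j, one_apply]
    split_ifs <;> simp
  -- The integer determinant is not divisible by 5.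
  have h3 : M.det ≠ 0 := by
    intro h0
    have h4 := congrArg det h1
    rw [← RingHom.map_det, det_mul, h0, mul_zero, map_zero, det_one] at h4
    exact absurd h4 (by decide)
  have h5 : (M.map (Int.cast : ℤ → ℝ)).det ≠ 0 := by
    have : (M.map (Int.cast : ℤ → ℝ)).det = ((M.det : ℤ) : ℝ) :=
      ((Int.castRingHom ℝ).map_det M).symm
    rw [this]
    exact_mod_cast h3
  exact Matrix.eq_zero_of_mulVec_eq_zero h5 hc

/-! ### The characteristic polynomial of the monodromy -/

section Finrank

variable {V : Type} [AddCommGroup V] [Module ℝ V] [Module.Finite ℝ V] (ρ : Representation ℝ Pi V)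

/-- Without invariants `delta` is injective, so the quotient of V × V by its range has the dimension
of V. -/
lemma finrank_H1_F (h : ∀ v, ρ a v = v → ρ b v = v → v = 0) :
    Module.finrank ℝ (H1 ρ F) = Module.finrank ℝ V := by
  have hδ : Function.Injective (delta ρ) := by
    rw [injective_iff_map_eq_zero]
    intro v hv
    exact h v (sub_eq_zero.mp (congrArg Prod.fst hv)) (sub_eq_zero.mp (congrArg Prod.snd hv))
  have h1 := (classOf ρ).finrank_range_add_finrank_ker
  rw [ker_classOf, LinearMap.finrank_range_of_inj hδ,
    LinearMap.range_eq_top.mpr (classOf_surjective ρ), finrank_top, Module.finrank_prod] at h1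
  omega

lemma finrank_H1rel (h : LinearMap.range (ρ a - 1) ⊔ LinearMap.range (ρ b - 1) = ⊤) :
    Module.finrank ℝ (H1rel ρ F dF) = Module.finrank ℝ V := by
  have h1 := (boundary ρ).finrank_range_add_finrank_ker
  rw [LinearMap.range_eq_top.mpr (boundary_surjective ρ h), finrank_top,
    Module.finrank_prod] at h1
  rw [(relEquiv ρ).finrank_eq]
  omega

end Finrank

lemma finrank_H1F (s : Shape) : Module.finrank ℝ s.H1F = 9 :=
  (finrank_H1_F s.adRep s.eq_zero_of_fiber_invariant).trans finrank_VSpace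

lemma finrank_H1FdF (s : Shape) : Module.finrank ℝ s.H1FdF = 9 :=
  (finrank_H1rel s.adRep s.range_sup_range).trans finrank_VSpace

/-! ### Independence of the iterates and the determinants -/

/-- The values of the functionals `annA`, `annB` at the iterates of the cyclic vector. -/
def annCyc : Matrix (Fin 9) (Fin 9) ℤ :=
  of fun i j => (annA *ᵥ cycA j.castSucc + annB *ᵥ cycB j.castSucc) i

/-- The functionals `annA`, `annB`. -/
def annihilator : VSpace × VSpace →ₗ[ℝ] (Fin 9 → ℝ) :=
  (mulVecLin (annA.map (Int.cast : ℤ → ℝ)) ∘ₗ eisenstein.toLinearMap).coprod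
    (mulVecLin (annB.map (Int.cast : ℤ → ℝ)) ∘ₗ eisenstein.toLinearMap)

lemma annihilator_apply (p : VSpace × VSpace) : annihilator p =
    annA.map (Int.cast : ℤ → ℝ) *ᵥ eisenstein p.1 +
      annB.map (Int.cast : ℤ → ℝ) *ᵥ eisenstein p.2 := rfl

lemma annihilator_delta (v : VSpace) : annihilator (delta Shape.complete.adRep v) = 0 := by
  have h : annA * (intA - 1) + annB * (intB - 1) = 0 := by decide +kernel
  have h' : annA.map (Int.cast : ℤ → ℝ) * (intA.map (Int.cast : ℤ → ℝ) - 1) +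
      annB.map (Int.cast : ℤ → ℝ) * (intB.map (Int.cast : ℤ → ℝ) - 1) = 0 := by
    have := congrArg (Int.castRingHom ℝ).mapMatrix h
    simp only [map_add, map_mul, map_sub, map_one, map_zero] at this
    exact this
  have ha : eisenstein (delta Shape.complete.adRep v).1 =
      (intA.map (Int.cast : ℤ → ℝ) - 1) *ᵥ eisenstein v := by
    rw [sub_mulVec, one_mulVec, ← isIntegralAction_a v, ← map_sub]
    rfl
  have hb : eisenstein (delta Shape.complete.adRep v).2 =
      (intB.map (Int.cast : ℤ → ℝ) - 1) *ᵥ eisenstein v := by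
    rw [sub_mulVec, one_mulVec, ← isIntegralAction_b v, ← map_sub]
    rfl
  rw [annihilator_apply, ha, hb, mulVec_mulVec, mulVec_mulVec, ← add_mulVec, h', zero_mulVec]

lemma annihilator_sum_cyc (c : Fin 9 → ℝ) :
    annihilator (∑ i, c i • cyc i.castSucc) = annCyc.map (Int.cast : ℤ → ℝ) *ᵥ c := by
  rw [map_sum]
  ext k
  simp only [map_smul, annihilator_apply, cyc, eisenstein_vecOf, map_intCast_mulVec,
    Finset.sum_apply, Pi.smul_apply, Pi.add_apply, smul_eq_mul, mulVec, dotProduct, map_apply,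
    annCyc, of_apply, Int.cast_add]
  exact Finset.sum_congr rfl fun i _ => mul_comm _ _

/-- The nine functionals in `annihilator` kill coboundaries, so they are defined on H¹(F); their
values at the nine classes form a nonsingular matrix. -/
lemma linearIndependent_classOf_cyc : LinearIndependent ℝ fun i : Fin 9 =>
    classOf Shape.complete.adRep (cyc i.castSucc) := by
  rw [Fintype.linearIndependent_iff]
  intro c hc
  simp only [← map_smul, ← map_sum] at hc
  rw [← LinearMap.mem_ker, ker_classOf] at hc
  obtain ⟨v, hv⟩ := hc
  have h1 := annihilator_sum_cyc c
  rw [← hv, annihilator_delta] at h1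
  -- An inverse modulo 5 is a certificate with small entries, whereas the iterates themselves grow
  -- fast.
  have h2 : ∀ i j, (cycInv * annCyc) i j % 5 = if i = j then 1 else 0 := by decide +kernel
  exact congrFun (eq_zero_of_mulVec_eq_zero h2 h1.symm)

lemma linearIndependent_relCyc : LinearIndependent ℝ fun i : Fin 9 => relCyc i.castSucc := by
  rw [Fintype.linearIndependent_iff]
  intro c hc
  -- Adding the values at a and at b maps the pairs to 𝔳 and gives a square matrix; independence of
  -- the images is enough.
  let M : Matrix (Fin 9) (Fin 9) ℤ :=
    of fun i j => relCycA j.castSucc i + relCycB j.castSucc i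
  have h1 : M.map (Int.cast : ℤ → ℝ) *ᵥ c = 0 := by
    have hA := congrArg (fun p => eisenstein p.1) hc
    have hB := congrArg (fun p => eisenstein p.2) hc
    simp only [Prod.fst_sum, Prod.snd_sum, Prod.smul_fst, Prod.smul_snd, map_sum, map_smul,
      relCyc, eisenstein_vecOf, Prod.fst_zero, Prod.snd_zero, map_zero] at hA hB
    ext k
    have hAk := congrFun hA k
    have hBk := congrFun hB k
    simp only [Finset.sum_apply, Pi.smul_apply, smul_eq_mul, Pi.zero_apply] at hAk hBk
    simp only [mulVec, dotProduct, map_apply, M, of_apply, Int.cast_add, add_mul,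
      Finset.sum_add_distrib, Pi.zero_apply]
    simp only [mul_comm (c _)] at hAk hBk
    rw [hAk, hBk, add_zero]
  have h2 : ∀ i j, (relCycInv * M) i j % 5 = if i = j then 1 else 0 := by decide +kernel
  exact congrFun (eq_zero_of_mulVec_eq_zero h2 h1)

/-- The characteristic polynomial of the monodromy at the complete structure. -/
def monodromyPoly : Polynomial ℝ :=
  Polynomial.X ^ 9 - Polynomial.C 18 * Polynomial.X ^ 8 + Polynomial.C 75 * Polynomial.X ^ 7 -
    Polynomial.C 169 * Polynomial.X ^ 6 + Polynomial.C 249 * Polynomial.X ^ 5 -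
    Polynomial.C 249 * Polynomial.X ^ 4 + Polynomial.C 169 * Polynomial.X ^ 3 -
    Polynomial.C 75 * Polynomial.X ^ 2 + Polynomial.C 18 * Polynomial.X - Polynomial.C 1

lemma monodromyPoly_natDegree : monodromyPoly.natDegree = 9 := by
  rw [monodromyPoly]
  compute_degree!

lemma monodromyPoly_monic : monodromyPoly.Monic := by
  rw [Polynomial.Monic, Polynomial.leadingCoeff, monodromyPoly_natDegree, monodromyPoly]
  compute_degree!

lemma aeval_monodromyPoly {W : Type} [AddCommGroup W] [Module ℝ W] (f : W →ₗ[ℝ] W) (e : W) :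
    Polynomial.aeval f monodromyPoly e =
      ∑ i : Fin 10, (monodromyCoeff i : ℝ) • (f ^ (i : ℕ)) e := by
  simp only [Fin.sum_univ_succ, monodromyPoly, monodromyCoeff]
  simp [Algebra.algebraMap_eq_smul_one]
  module

lemma det_eq_of_cyclic {W : Type} [AddCommGroup W] [Module ℝ W] [Module.Finite ℝ W]
    (f : W →ₗ[ℝ] W) (e : Fin 10 → W) (hn : Module.finrank ℝ W = 9)
    (he : ∀ i : Fin 9, f (e i.castSucc) = e i.succ)
    (hind : LinearIndependent ℝ fun i : Fin 9 => e i.castSucc)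
    (h0 : ∑ i, (monodromyCoeff i : ℝ) • e i = 0) (t : ℝ) :
    LinearMap.det (f - t • (LinearMap.id : W →ₗ[ℝ] W)) =
      -(t - 1) ^ 3 * (t ^ 6 - 15 * t ^ 5 + 27 * t ^ 4 - 42 * t ^ 3 + 27 * t ^ 2 - 15 * t + 1) := by
  have hpow : ∀ i : Fin 10, (f ^ (i : ℕ)) (e 0) = e i := by
    intro i
    induction i using Fin.induction with
    | zero => simp
    | succ i ih =>
      rw [Fin.val_succ, pow_succ', Module.End.mul_apply, ← he, ← ih]
      rfl
  have hind' : LinearIndependent ℝ fun i : Fin 9 => (f ^ (i : ℕ)) (e 0) := by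
    convert hind using 2 with i
    exact hpow i.castSucc
  have hchar := charpoly_eq_of_cyclic f (e 0) hn monodromyPoly_monic monodromyPoly_natDegree
    hind' (by
      rw [aeval_monodromyPoly]
      simpa only [hpow] using h0)
  -- The leading minus sign is (-1)⁹, and `monodromyPoly` is the expanded product of the cube and
  -- the sextic.
  rw [det_sub_smul_id, hchar, hn, monodromyPoly]
  simp
  ring

theorem det_repF (t : ℝ) : LinearMap.det
    (Shape.complete.repF xGen - t • (LinearMap.id : Shape.complete.H1F →ₗ[ℝ] _)) =
      -(t - 1) ^ 3 * (t ^ 6 - 15 * t ^ 5 + 27 * t ^ 4 - 42 * t ^ 3 + 27 * t ^ 2 - 15 * t + 1) := by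
  refine det_eq_of_cyclic _ (fun i => classOf Shape.complete.adRep (cyc i))
    (finrank_H1F Shape.complete) (fun i => ?_) linearIndependent_classOf_cyc ?_ t
  · rw [H1rep_classOf, twist_cyc]
  · simp only [← map_smul, ← map_sum]
    rw [sum_cyc, ← LinearMap.mem_ker, ker_classOf]
    exact ⟨_, rfl⟩

lemma boundary_relCyc (i : Fin 10) : boundary Shape.complete.adRep (relCyc i) = 0 := by
  induction i using Fin.induction with
  | zero => exact boundary_relCyc_zero
  | succ i ih => rw [← twist_relCyc, boundary_twist, ih, map_zero]

theorem det_repFdF (t : ℝ) : LinearMap.det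
    (Shape.complete.repFdF xGen - t • (LinearMap.id : Shape.complete.H1FdF →ₗ[ℝ] _)) =
      -(t - 1) ^ 3 * (t ^ 6 - 15 * t ^ 5 + 27 * t ^ 4 - 42 * t ^ 3 + 27 * t ^ 2 - 15 * t + 1) := by
  let E := relEquiv Shape.complete.adRep
  refine det_eq_of_cyclic _ (fun i => E.symm ⟨relCyc i, boundary_relCyc i⟩)
    (finrank_H1FdF Shape.complete) (fun i => ?_) ?_ ?_ t
  · rw [← LinearEquiv.symm_apply_eq, LinearEquiv.symm_symm]
    apply Subtype.ext
    rw [relEquiv_H1relRep, LinearEquiv.apply_symm_apply, twist_relCyc]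
  · refine LinearIndependent.of_comp
      ((LinearMap.ker (boundary Shape.complete.adRep)).subtype ∘ₗ E.toLinearMap) ?_
    convert linearIndependent_relCyc using 2 with i
    simp
  · simp only [← map_smul, ← map_sum]
    rw [LinearEquiv.map_eq_zero_iff]
    apply Subtype.ext
    simpa using sum_relCyc

/-- Modulo the range of x - 1 all iterates of the cyclic vector agree with the vector itself, and
modulo coboundaries the iterates span. -/
lemma complete_range_eq_top : LinearMap.range (twist Shape.complete.adRep - 1) ⊔
    LinearMap.range (delta Shape.complete.adRep) ⊔ Submodule.span ℝ {cyc 0} = ⊤ := by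
  set S := LinearMap.range (twist Shape.complete.adRep - 1) ⊔
    LinearMap.range (delta Shape.complete.adRep) ⊔ Submodule.span ℝ {cyc 0} with hS
  have hcyc : ∀ i : Fin 10, cyc i ∈ S := by
    intro i
    induction i using Fin.induction with
    | zero => exact Submodule.mem_sup_right (Submodule.mem_span_singleton_self _)
    | succ i ih =>
      have h1 : (twist Shape.complete.adRep - 1) (cyc i.castSucc) ∈ S :=
        Submodule.mem_sup_left (Submodule.mem_sup_left ⟨_, rfl⟩)
      rw [LinearMap.sub_apply, twist_cyc, Module.End.one_apply] at h1
      simpa using add_mem h1 ih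
  rw [eq_top_iff]
  rintro p -
  have hspan := linearIndependent_classOf_cyc.span_eq_top_of_card_eq_finrank'
    (by rw [finrank_H1F Shape.complete, Fintype.card_fin])
  have hp : classOf Shape.complete.adRep p ∈ Submodule.span ℝ
      (Set.range fun i : Fin 9 => classOf Shape.complete.adRep (cyc i.castSucc)) := by
    rw [hspan]; trivial
  obtain ⟨c, hc⟩ := (Submodule.mem_span_range_iff_exists_fun ℝ).mp hp
  simp only [← map_smul, ← map_sum] at hc
  rw [eq_comm, ← sub_eq_zero, ← map_sub, ← LinearMap.mem_ker, ker_classOf] at hc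
  have h1 : p - ∑ i, c i • cyc i.castSucc ∈ S :=
    Submodule.mem_sup_left (Submodule.mem_sup_right hc)
  have h2 : ∑ i, c i • cyc i.castSucc ∈ S :=
    Submodule.sum_mem _ fun i _ => Submodule.smul_mem _ _ (hcyc _)
  simpa using add_mem h1 h2

open Filter Topology

namespace Shape

/-! ### An invariant functional of the peripheral group -/

variable (s : Shape)

/-- The matrix of the holonomy of `g`. -/
def hol (g : Pi) : Matrix (Fin 4) (Fin 4) ℝ := (s.holonomy g).1.1

lemma hol_mul (g h : Pi) : s.hol (g * h) = s.hol g * s.hol h := by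
  simp [hol]

lemma hol_one : s.hol 1 = 1 := by
  simp [hol]

lemma hol_mul_inv (g : Pi) : s.hol g * s.hol g⁻¹ = 1 := by
  rw [← hol_mul, mul_inv_cancel, hol_one]

lemma toMat_adRep_eq (g : Pi) (v : VSpace) :
    toMat (s.adRep g v) = s.hol g * toMat v * s.hol g⁻¹ := by
  rw [toMat_adRep, hol, hol, map_inv]

lemma hol_inv (g : Pi) : s.hol g⁻¹ = J * (s.hol g)ᵀ * J := by
  have h : (s.hol g)ᵀ * J * s.hol g = J := (s.holonomy g).2.2
  calc s.hol g⁻¹ = J * J * s.hol g⁻¹ := by rw [J_mul_J, Matrix.one_mul]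
    _ = J * ((s.hol g)ᵀ * J * s.hol g) * s.hol g⁻¹ := by rw [h]
    _ = J * (s.hol g)ᵀ * J * (s.hol g * s.hol g⁻¹) := by simp only [Matrix.mul_assoc]
    _ = _ := by rw [hol_mul_inv, Matrix.mul_one]

/-- The trace of `g + g⁻¹`. -/
def symTrace (g : Pi) : ℝ := (s.hol g + s.hol g⁻¹).trace

/-- For a Lorentz matrix, g⁻¹ is the J-adjoint of g, so g + g⁻¹ is J-symmetric. Its traceless part
is a vector of 𝔳 fixed by the centralizer of g. -/
lemma symPart_mem (g : Pi) :
    s.hol g + s.hol g⁻¹ - (s.symTrace g / 4) • (1 : Matrix (Fin 4) (Fin 4) ℝ) ∈ 𝔳 := by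
  rw [mem_𝔳_iff]
  have hJ : Jᵀ = J := by simp [J]
  constructor
  · rw [trace_sub, trace_smul, trace_one, ← symTrace]
    simp
  · have h1 : (s.hol g * J)ᵀ = s.hol g⁻¹ * J := by
      rw [transpose_mul, hJ, hol_inv, Matrix.mul_assoc (J * _), J_mul_J, Matrix.mul_one]
    have h2 : (s.hol g⁻¹ * J)ᵀ = s.hol g * J := by rw [← h1, transpose_transpose]
    rw [sub_mul, add_mul, transpose_sub, transpose_add, h1, h2, Matrix.smul_mul, Matrix.one_mul,
      transpose_smul, hJ, add_comm]

/-- The projection of `g + g⁻¹` to `𝔳`. -/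
def symPart (g : Pi) : VSpace := (⟨_, s.symPart_mem g⟩ : 𝔳)

lemma toMat_symPart (g : Pi) : toMat (s.symPart g) = s.hol g + s.hol g⁻¹ -
    (s.symTrace g / 4) • (1 : Matrix (Fin 4) (Fin 4) ℝ) := rfl

lemma adRep_symPart {g h : Pi} (hgh : h * g * h⁻¹ = g) :
    s.adRep h (s.symPart g) = s.symPart g := by
  refine Subtype.ext (?_ : toMat _ = toMat _)
  have hgh' : h * g⁻¹ * h⁻¹ = g⁻¹ := by
    calc h * g⁻¹ * h⁻¹ = (h * g * h⁻¹)⁻¹ := by group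
      _ = g⁻¹ := by rw [hgh]
  rw [toMat_adRep_eq, toMat_symPart, mul_sub, mul_add, sub_mul, add_mul, ← hol_mul, ← hol_mul,
    ← hol_mul, ← hol_mul, hgh, hgh', Matrix.mul_smul, Matrix.mul_one, Matrix.smul_mul, hol_mul_inv]

lemma hol_x : s.hol x = s.matX := by
  rw [hol, holonomy_x]
  rfl

lemma hol_y : s.hol y = s.matY := by
  rw [hol, holonomy_y]
  rfl

lemma hol_x_inv : s.hol x⁻¹ = ‖s.m‖⁻¹ • klein s.x₂' := by
  rw [hol, map_inv, holonomy_x]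
  rfl

lemma symPart_x_ne_zero : s.symPart x ≠ 0 := by
  intro h
  have h0 : ‖s.m‖ ≠ 0 := norm_ne_zero_iff.mpr s.m_ne_zero
  -- For every shape this entry of x + x⁻¹ equals -1 / (4‖m‖), and the scalar correction does not
  -- affect it.
  have h1 : toMat (s.symPart x) 2 3 = 0 := by rw [h]; rfl
  have hn : Complex.normSq s.m = ‖s.m‖ ^ 2 := Complex.normSq_eq_norm_sq _
  rw [toMat_symPart, hol_x, hol_x_inv] at h1
  simp [matX, klein, x₂', hn] at h1
  field_simp at h1
  ring_nf at h1
  norm_num at h1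

lemma exists_peripheral_functional : ∃ φ : VSpace →ₗ[ℝ] ℝ, φ ≠ 0 ∧
    (∀ v, φ (s.adRep l v) = φ v) ∧ ∀ v, φ (s.adRep x v) = φ v := by
  have key : ∀ h : Pi, h * x * h⁻¹ = x → ∀ v,
      traceForm (s.symPart x) (s.adRep h v) = traceForm (s.symPart x) v := by
    intro h hh v
    conv_lhs => rw [← s.adRep_symPart hh]
    rw [traceForm_adRep]
  refine ⟨traceForm (s.symPart x), ?_, key l ?_, key x (by group)⟩
  · intro h
    exact s.symPart_x_ne_zero (traceForm_injective (by rw [h, map_zero]))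
  · have h1 : x * l = l * x := by
      calc x * l = x * l * x⁻¹ * x := by group
        _ = l * x := by rw [x_conj_l]
    rw [← h1]
    group

/-! ### Convergence to the complete structure -/

/-- The filter of shapes whose parameter tends to zero. -/
def nearComplete : Filter Shape := comap u (𝓝 0)

lemma exp_u : Complex.exp s.u = s.m := Complex.exp_log s.m_ne_zero

lemma tendsto_m : Tendsto m nearComplete (𝓝 1) := by
  have h : Tendsto (fun s : Shape => Complex.exp s.u) nearComplete (𝓝 (Complex.exp 0)) :=
    (Complex.continuous_exp.tendsto 0).comp tendsto_comap
  rw [Complex.exp_zero] at h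
  exact h.congr exp_u

/-- The relation between m and z₂ can be written (z₂ - ω)(z₂ - ω̄) = (m - 1)(m z₂ - (1 + m)). As z₂
lies in the upper half-plane it stays away from ω̄, so it must approach ω as m tends to 1. This
controls every shape with small parameter. -/
lemma norm_z₂_sub_ω_le :
    ‖s.z₂ - ω‖ ≤ ‖s.m - 1‖ * (‖s.m‖ + 2 * (‖s.m‖ + ‖1 + s.m‖)) := by
  set D := ‖s.z₂ - (starRingEnd ℂ) ω‖ with hD
  have hω : ω.im = √3 / 2 := by
    rw [ω_eq]
    simp
  have hD1 : 1 / 2 ≤ D := by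
    have h1 := Complex.abs_im_le_norm (s.z₂ - (starRingEnd ℂ) ω)
    rw [Complex.sub_im, Complex.conj_im, sub_neg_eq_add, hω] at h1
    have h2 := le_abs_self (s.z₂.im + √3 / 2)
    have h3 : (1 : ℝ) ≤ √3 := Real.one_le_sqrt.mpr (by norm_num)
    have := s.im_pos₂
    linarith
  have hz : ‖s.z₂‖ ≤ D + 1 := by
    have h1 : s.z₂ = (s.z₂ - (starRingEnd ℂ) ω) + (starRingEnd ℂ) ω := by ring
    have h2 : ‖(starRingEnd ℂ) ω‖ = 1 := by
      rw [Complex.norm_conj, ω, Complex.norm_exp_ofReal_mul_I]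
    calc ‖s.z₂‖ ≤ D + ‖(starRingEnd ℂ) ω‖ := by
          conv_lhs => rw [h1]
          exact norm_add_le _ _
      _ = D + 1 := by rw [h2]
  have hprod : ‖s.z₂ - ω‖ * D ≤ ‖s.m - 1‖ * (‖s.m‖ * (D + 1) + ‖1 + s.m‖) := by
    rw [hD, ← norm_mul]
    have h1 : (s.z₂ - ω) * (s.z₂ - (starRingEnd ℂ) ω) =
        (s.m - 1) * (s.m * s.z₂ - (1 + s.m)) := by
      rw [conj_ω]
      linear_combination (1 : ℂ) * s.m_rel - ω_sq
    rw [h1, norm_mul]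
    refine mul_le_mul_of_nonneg_left ?_ (norm_nonneg _)
    refine (norm_sub_le _ _).trans ?_
    rw [norm_mul]
    gcongr
  have hDpos : 0 < D := by linarith
  -- No a priori bound on z₂ is needed: the right side grows at most linearly in D, and 1 ≤ 2D
  -- absorbs its constant terms before D is cancelled.
  refine le_of_mul_le_mul_right (hprod.trans ?_) hDpos
  rw [mul_assoc]
  refine mul_le_mul_of_nonneg_left ?_ (norm_nonneg _)
  have := norm_nonneg s.m
  have := norm_nonneg (1 + s.m)
  nlinarith

lemma tendsto_z₂ : Tendsto z₂ nearComplete (𝓝 ω) := by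
  rw [tendsto_iff_norm_sub_tendsto_zero]
  refine squeeze_zero (fun _ => norm_nonneg _) norm_z₂_sub_ω_le ?_
  have h : Tendsto (fun s : Shape => ‖s.m - 1‖ * (‖s.m‖ + 2 * (‖s.m‖ + ‖1 + s.m‖)))
      nearComplete (𝓝 (‖(1 : ℂ) - 1‖ * (‖(1 : ℂ)‖ + 2 * (‖(1 : ℂ)‖ + ‖(1 : ℂ) + 1‖)))) :=
    ((tendsto_m.sub_const 1).norm).mul (tendsto_m.norm.add
      ((tendsto_m.norm.add (tendsto_m.const_add 1).norm).const_mul 2))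
  simpa using h

lemma tendsto_matX : Tendsto matX nearComplete (𝓝 complete.matX) := by
  have hm := tendsto_m
  rw [← complete_m] at hm
  have h0 : (8 * ‖complete.m‖) ≠ 0 := by
    rw [complete_m]
    simp
  refine Tendsto.smul ((hm.norm.const_mul 8).inv₀ h0) ?_
  have hc : Continuous fun m : ℂ =>
      !![8 * m.re, 8 * m.im, -4 * m.re, -4 * m.re;
        -8 * m.im, 8 * m.re, 4 * m.im, 4 * m.im;
        4, 0, 3 + 4 * ‖m‖ ^ 2, -5 + 4 * ‖m‖ ^ 2;
        -4, 0, -3 + 4 * ‖m‖ ^ 2, 5 + 4 * ‖m‖ ^ 2] := by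
    refine continuous_matrix fun i j => ?_
    fin_cases i <;> fin_cases j <;> simp <;> fun_prop
  exact (hc.tendsto _).comp hm

lemma tendsto_matY : Tendsto matY nearComplete (𝓝 complete.matY) := by
  have hm := tendsto_m
  rw [← complete_m] at hm
  have h0 : (2 * ‖complete.m‖) ≠ 0 := by
    rw [complete_m]
    simp
  have hq : Tendsto (fun s : Shape => s.m * (starRingEnd ℂ) s.z₂) nearComplete
      (𝓝 (complete.m * (starRingEnd ℂ) complete.z₂)) :=
    hm.mul ((Complex.continuous_conj.tendsto _).comp tendsto_z₂)
  have hm₁ := (Complex.continuous_re.tendsto _).comp hm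
  have hm₂ := (Complex.continuous_im.tendsto _).comp hm
  have hq₁ := (Complex.continuous_re.tendsto _).comp hq
  have hq₂ := (Complex.continuous_im.tendsto _).comp hq
  have hz₁ := (Complex.continuous_re.tendsto _).comp tendsto_z₂
  have hz₂ := (Complex.continuous_im.tendsto _).comp tendsto_z₂
  have hN := hm.norm.pow 2
  have hZ := (tendsto_z₂.norm.pow 2).const_mul 4
  refine Tendsto.smul ((hm.norm.const_mul 2).inv₀ h0) ?_
  refine tendsto_pi_nhds.mpr fun i => tendsto_pi_nhds.mpr fun j => ?_
  fin_cases i <;> fin_cases j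
  exacts [hm₁.const_mul 2, hm₂.const_mul (-2), hq₁.const_mul 4, hq₁.const_mul (-4),
    hm₂.const_mul 2, hm₁.const_mul 2, hq₂.const_mul 4, hq₂.const_mul (-4),
    hz₁.const_mul (-4), hz₂.const_mul 4, (hZ.const_sub 1).add hN, (hZ.const_add 1).sub hN,
    hz₁.const_mul (-4), hz₂.const_mul 4, (hZ.const_sub 1).sub hN, (hZ.const_add 1).add hN]

lemma tendsto_hol (g : Pi) : Tendsto (fun s => s.hol g) nearComplete (𝓝 (complete.hol g)) := by
  have hinv : ∀ g : Pi, Tendsto (fun s => s.hol g) nearComplete (𝓝 (complete.hol g)) →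
      Tendsto (fun s => s.hol g⁻¹) nearComplete (𝓝 (complete.hol g⁻¹)) := by
    intro g hg
    simp only [hol_inv]
    have hc : Continuous fun A : Matrix (Fin 4) (Fin 4) ℝ => J * Aᵀ * J := by fun_prop
    exact (hc.tendsto _).comp hg
  have hgen : g ∈ Subgroup.closure (Set.range (PresentedGroup.of (rels := {relator}))) := by
    rw [PresentedGroup.closure_range_of]
    trivial
  induction hgen using Subgroup.closure_induction with
  | mem g hg =>
    obtain ⟨i, rfl⟩ := hg
    cases i with
    | x =>
      have h := tendsto_matX
      rw [← hol_x] at h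
      exact h.congr fun s => (s.hol_x).symm
    | y =>
      have h := tendsto_matY
      rw [← hol_y] at h
      exact h.congr fun s => (s.hol_y).symm
  | one =>
    simp only [hol_one]
    exact tendsto_const_nhds
  | mul g h _ _ hg hh =>
    simp only [hol_mul]
    exact hg.mul hh
  | inv g _ hg => exact hinv g hg

lemma tendsto_adRep (g : Pi) (v : VSpace) (φ : VSpace →ₗ[ℝ] ℝ) :
    Tendsto (fun s => φ (s.adRep g v)) nearComplete (𝓝 (φ (complete.adRep g v))) := by
  have h1 : Tendsto (fun s => toMat (s.adRep g v)) nearComplete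
      (𝓝 (toMat (complete.adRep g v))) := by
    simp only [toMat_adRep_eq]
    exact ((tendsto_hol g).mul tendsto_const_nhds).mul (tendsto_hol g⁻¹)
  have h2 : Continuous coords := by
    refine continuous_pi fun i => ?_
    fin_cases i <;> simp [coords] <;> fun_prop
  have h3 : Tendsto (fun s => coordEquiv (s.adRep g v)) nearComplete
      (𝓝 (coordEquiv (complete.adRep g v))) := (h2.tendsto _).comp h1
  have h4 := ((φ ∘ₗ coordEquiv.symm.toLinearMap).continuous_of_finiteDimensional.tendsto _).comp h3
  simpa [Function.comp_def] using h4

/-! ### Semicontinuity -/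

/-- The map onto the crossed homomorphisms whose surjectivity bounds the coinvariants of `x` in
`H¹(F; 𝔳_u)`. -/
def testMap (e : VSpace × VSpace) :
    ((VSpace × VSpace) × VSpace) × ℝ →ₗ[ℝ] VSpace × VSpace :=
  ((twist s.adRep - 1).coprod (delta s.adRep)).coprod (LinearMap.toSpanSingleton ℝ _ e)

lemma range_testMap (e : VSpace × VSpace) : LinearMap.range (s.testMap e) =
    LinearMap.range (twist s.adRep - 1) ⊔ LinearMap.range (delta s.adRep) ⊔
      Submodule.span ℝ {e} := by
  rw [testMap, LinearMap.range_coprod, LinearMap.range_coprod, LinearMap.range_toSpanSingleton]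

lemma tendsto_testMap (e : VSpace × VSpace) (k : ((VSpace × VSpace) × VSpace) × ℝ)
    (φ : VSpace × VSpace →ₗ[ℝ] ℝ) :
    Tendsto (fun s : Shape => φ (s.testMap e k)) nearComplete (𝓝 (φ (complete.testMap e k))) := by
  obtain ⟨⟨⟨p, q⟩, w⟩, r⟩ := k
  have hφ : ∀ z : VSpace × VSpace, φ z =
      (φ ∘ₗ LinearMap.inl ℝ VSpace VSpace) z.1 + (φ ∘ₗ LinearMap.inr ℝ VSpace VSpace) z.2 := by
    intro z
    simp only [LinearMap.comp_apply, ← map_add]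
    simp
  have key : ∀ s : Shape, s.testMap e (((p, q), w), r) =
      (s.adRep (x * b⁻¹) p + s.adRep (x * b⁻¹ * a) p - s.adRep (x * b⁻¹) q - p
          + (s.adRep a w - w) + r • e.1,
        s.adRep (x * a⁻¹) q - s.adRep (x * a⁻¹) p - q + (s.adRep b w - w) + r • e.2) := by
    intro s
    refine Prod.ext ?_ ?_
    · change s.adRep (x * b⁻¹) (p + s.adRep a p - q) - p + (s.adRep a w - w) + r • e.1 = _
      rw [map_mul s.adRep (x * b⁻¹) a, Module.End.mul_apply, map_sub, map_add]
    · change s.adRep (x * a⁻¹) (q - p) - q + (s.adRep b w - w) + r • e.2 = _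
      rw [map_sub]
  simp only [key, hφ]
  set φ₁ := φ ∘ₗ LinearMap.inl ℝ VSpace VSpace
  set φ₂ := φ ∘ₗ LinearMap.inr ℝ VSpace VSpace
  simp only [map_add, map_sub]
  exact (((((((tendsto_adRep _ _ φ₁).add (tendsto_adRep _ _ φ₁)).sub
    (tendsto_adRep _ _ φ₁)).sub_const _).add ((tendsto_adRep _ _ φ₁).sub_const _)).add_const _)).add
    (((((tendsto_adRep _ _ φ₂).sub (tendsto_adRep _ _ φ₂)).sub_const _).add
      ((tendsto_adRep _ _ φ₂).sub_const _)).add_const _)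

/-- Surjectivity is an open condition. With R a right inverse of the map at the complete structure,
the determinant of its composite with R tends to det 1 = 1, so it is nonzero nearby. -/
lemma eventually_range_eq_top : ∀ᶠ s : Shape in nearComplete,
    LinearMap.range (twist s.adRep - 1) ⊔ LinearMap.range (delta s.adRep) ⊔
      Submodule.span ℝ {cyc 0} = ⊤ := by
  have h0 : LinearMap.range (complete.testMap (cyc 0)) = ⊤ := by
    rw [range_testMap, complete_range_eq_top]
  obtain ⟨R, hR⟩ := (complete.testMap (cyc 0)).exists_rightInverse_of_surjective h0
  let B := Module.finBasis ℝ (VSpace × VSpace)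
  have hmat : Tendsto (fun s : Shape => LinearMap.toMatrix B B (s.testMap (cyc 0) ∘ₗ R))
      nearComplete (𝓝 (LinearMap.toMatrix B B (complete.testMap (cyc 0) ∘ₗ R))) := by
    refine tendsto_pi_nhds.mpr fun i => tendsto_pi_nhds.mpr fun j => ?_
    simp only [LinearMap.toMatrix_apply]
    exact tendsto_testMap (cyc 0) (R (B j)) (B.coord i)
  have hdet : Tendsto (fun s : Shape => LinearMap.det (s.testMap (cyc 0) ∘ₗ R))
      nearComplete (𝓝 1) := by
    have hc : Continuous fun A : Matrix (Fin (Module.finrank ℝ (VSpace × VSpace)))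
        (Fin (Module.finrank ℝ (VSpace × VSpace))) ℝ => A.det := continuous_id.matrix_det
    have := (hc.tendsto _).comp hmat
    simpa only [Function.comp_def, LinearMap.det_toMatrix, hR, LinearMap.det_id] using this
  filter_upwards [hdet.eventually_ne one_ne_zero] with s hs
  rw [← range_testMap, eq_top_iff]
  have hsurj : LinearMap.range (s.testMap (cyc 0) ∘ₗ R) = ⊤ := by
    rw [LinearMap.range_eq_top]
    exact (LinearMap.equivOfDetNeZero _ hs).surjective
  rw [← hsurj]
  exact LinearMap.range_comp_le_range _ _

lemma eventually_finrank_invariants : ∀ᶠ s : Shape in nearComplete,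
    Module.finrank ℝ s.repF.invariants = 1 ∧ Module.finrank ℝ s.repdF.invariants = 1 := by
  filter_upwards [eventually_range_eq_top] with s hs
  obtain ⟨φ, hφ, hl, hx⟩ := s.exists_peripheral_functional
  exact finrank_invariants_eq_one s.adRep s.range_sup_range (cyc 0) hs φ hφ hl hx

/-! ### Shapes with small parameter -/

lemma mem_slitPlane_of_im_pos {z : ℂ} (hz : 0 < z.im) : z ∈ Complex.slitPlane :=
  Or.inr hz.ne'

/-- The left-hand side of the first gluing equation. -/
def gluingSum₁ (z₁ z₂ : ℂ) : ℂ :=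
  2 * Complex.log z₁ + Complex.log (1 / (1 - z₁)) + Complex.log z₂ + 2 * Complex.log (1 - 1 / z₂)

/-- The left-hand side of the second gluing equation. -/
def gluingSum₂ (z₁ z₂ : ℂ) : ℂ :=
  Complex.log (1 / (1 - z₁)) + 2 * Complex.log (1 - 1 / z₁) + Complex.log z₂
    + 2 * Complex.log (1 / (1 - z₂))

lemma one_sub_inv_ne_zero {z : ℂ} (hz : 0 < z.im) : 1 - 1 / z ≠ 0 := by
  obtain ⟨h, h'⟩ := im_pos_ne z hz
  rw [one_sub_div h]
  refine div_ne_zero ?_ h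
  rw [← neg_sub]
  exact neg_ne_zero.mpr h'

/-- Both gluing equations exponentiate to this single polynomial relation; the logarithmic form only
adds a choice of branch. -/
lemma exp_gluingSum₁ {z₁ z₂ : ℂ} (h₁ : 0 < z₁.im) (h₂ : 0 < z₂.im)
    (h : (z₁ * (1 - z₂)) ^ 2 = (1 - z₁) * z₂) : Complex.exp (gluingSum₁ z₁ z₂) = 1 := by
  obtain ⟨h3, h3'⟩ := im_pos_ne _ h₁
  obtain ⟨h4, h4'⟩ := im_pos_ne _ h₂
  rw [gluingSum₁, Complex.exp_add, Complex.exp_add, Complex.exp_add, two_mul,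
    two_mul, Complex.exp_add, Complex.exp_add, Complex.exp_log h3,
    Complex.exp_log (one_div_ne_zero h3'), Complex.exp_log h4,
    Complex.exp_log (one_sub_inv_ne_zero h₂)]
  field_simp
  linear_combination h

lemma exp_gluingSum₂ {z₁ z₂ : ℂ} (h₁ : 0 < z₁.im) (h₂ : 0 < z₂.im)
    (h : (z₁ * (1 - z₂)) ^ 2 = (1 - z₁) * z₂) : Complex.exp (gluingSum₂ z₁ z₂) = 1 := by
  obtain ⟨h3, h3'⟩ := im_pos_ne _ h₁
  obtain ⟨h4, h4'⟩ := im_pos_ne _ h₂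
  rw [gluingSum₂, Complex.exp_add, Complex.exp_add, Complex.exp_add, two_mul,
    two_mul, Complex.exp_add, Complex.exp_add,
    Complex.exp_log (one_div_ne_zero h3'), Complex.exp_log h4,
    Complex.exp_log (one_sub_inv_ne_zero h₁), Complex.exp_log (one_div_ne_zero h4')]
  field_simp
  linear_combination -(1 - z₁) * h

/-- The solutions are the multiples of 2πi, spaced by 2π > 1. Continuity at u = 0 thus settles the
branch in the gluing equations. -/
lemma eq_two_pi_mul_I_of_exp_eq_one {L : ℂ} (h : Complex.exp L = 1)
    (hL : ‖L - 2 * Real.pi * Complex.I‖ < 1) : L = 2 * Real.pi * Complex.I := by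
  obtain ⟨n, rfl⟩ := Complex.exp_eq_one_iff.mp h
  have h1 : (n : ℂ) * (2 * Real.pi * Complex.I) - 2 * Real.pi * Complex.I =
      ((n - 1 : ℤ) : ℂ) * (2 * Real.pi * Complex.I) := by
    push_cast
    ring
  have h2 : ‖(2 * Real.pi * Complex.I : ℂ)‖ = 2 * Real.pi := by
    simp [abs_of_pos Real.pi_pos]
  rw [h1, norm_mul, h2, Complex.norm_intCast] at hL
  have h3 : n - 1 = 0 := by
    by_contra hn
    have h4 : (1 : ℝ) ≤ |((n - 1 : ℤ) : ℝ)| := by exact_mod_cast Int.one_le_abs hn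
    nlinarith [Real.pi_gt_three]
  rw [show n = 1 by omega]
  push_cast
  ring

/-- The shape of the second tetrahedron as a function of the parameter. -/
def z₂Of (u : ℂ) : ℂ :=
  let p := Complex.exp u ^ 2 - Complex.exp u + 1
  -- A root of z² - pz + m² with m = exp u. The discriminant p² - 4m² is -3 at u = 0, on the branch
  -- cut, so the root is taken of its negative; the sign before `Complex.I` selects ω rather than
  -- its conjugate.
  (p + Complex.I * Complex.exp (Complex.log (4 * Complex.exp u ^ 2 - p ^ 2) / 2)) / 2

/-- The shape of the first tetrahedron as a function of the parameter. -/
def z₁Of (u : ℂ) : ℂ := Complex.exp u / (1 - z₂Of u)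

lemma z₂Of_zero : z₂Of 0 = ω := by
  have h : Complex.exp (Complex.log 3 / 2) = (√3 : ℝ) := by
    rw [Real.sqrt_eq_rpow, Real.rpow_def_of_pos (by norm_num), Complex.ofReal_exp,
      Complex.ofReal_mul, Complex.ofReal_log (by norm_num)]
    push_cast
    congr 1
    ring
  rw [ω_eq, z₂Of]
  norm_num [h]
  ring

lemma z₁Of_zero : z₁Of 0 = ω := by
  rw [z₁Of, z₂Of_zero, Complex.exp_zero, ω_identities.1]

lemma continuousAt_z₂Of : ContinuousAt z₂Of 0 := by
  have h : (4 * Complex.exp 0 ^ 2 - (Complex.exp 0 ^ 2 - Complex.exp 0 + 1) ^ 2 : ℂ) ∈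
      Complex.slitPlane := by
    norm_num
  have h1 : ContinuousAt (fun u : ℂ => Complex.log
      (4 * Complex.exp u ^ 2 - (Complex.exp u ^ 2 - Complex.exp u + 1) ^ 2)) 0 :=
    ContinuousAt.clog (by fun_prop) h
  unfold z₂Of
  fun_prop

lemma continuousAt_z₁Of : ContinuousAt z₁Of 0 := by
  refine ContinuousAt.div (by fun_prop) (continuousAt_const.sub continuousAt_z₂Of) ?_
  rw [z₂Of_zero]
  exact (im_pos_ne _ ω_im_pos).2

lemma z₂Of_quadratic {u : ℂ} (h : 4 * Complex.exp u ^ 2 -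
    (Complex.exp u ^ 2 - Complex.exp u + 1) ^ 2 ≠ 0) :
    z₂Of u ^ 2 - (Complex.exp u ^ 2 - Complex.exp u + 1) * z₂Of u + Complex.exp u ^ 2 = 0 := by
  set m := Complex.exp u
  have h1 : Complex.exp (Complex.log (4 * m ^ 2 - (m ^ 2 - m + 1) ^ 2) / 2) ^ 2 =
      4 * m ^ 2 - (m ^ 2 - m + 1) ^ 2 := by
    rw [← Complex.exp_nat_mul]
    push_cast
    rw [mul_div_cancel₀ _ two_ne_zero, Complex.exp_log h]
  change ((m ^ 2 - m + 1 + Complex.I *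
    Complex.exp (Complex.log (4 * m ^ 2 - (m ^ 2 - m + 1) ^ 2) / 2)) / 2) ^ 2 -
    (m ^ 2 - m + 1) * ((m ^ 2 - m + 1 + Complex.I *
    Complex.exp (Complex.log (4 * m ^ 2 - (m ^ 2 - m + 1) ^ 2) / 2)) / 2) + m ^ 2 = 0
  linear_combination (Complex.I ^ 2 / 4) * h1 +
    ((4 * m ^ 2 - (m ^ 2 - m + 1) ^ 2) / 4) * Complex.I_sq

lemma eventually_gluing {L : ℂ → ℂ → ℂ} (hL : L ω ω = 2 * Real.pi * Complex.I)
    (hc : ContinuousAt (fun u => L (z₁Of u) (z₂Of u)) 0) :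
    ∀ᶠ u in 𝓝 (0 : ℂ), ‖L (z₁Of u) (z₂Of u) - 2 * Real.pi * Complex.I‖ < 1 := by
  have h := Metric.tendsto_nhds.mp hc 1 one_pos
  simp only [z₁Of_zero, z₂Of_zero, hL, dist_eq_norm] at h
  exact h

/-- The explicit functions `z₁Of` and `z₂Of` solve the multiplicative equation and take the value ω
at 0. By continuity the imaginary parts stay positive and the sums of logarithms stay within 1 of
2πi. -/
lemma eventually_mem_U : ∀ᶠ u in 𝓝 (0 : ℂ), u ∈ U := by
  have c₁ := continuousAt_z₁Of
  have c₂ := continuousAt_z₂Of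
  have hω := mem_slitPlane_of_im_pos ω_im_pos
  have hω1 : (1 : ℂ) - ω ≠ 0 := (im_pos_ne _ ω_im_pos).2
  have hω0 : ω ≠ 0 := (im_pos_ne _ ω_im_pos).1
  have clog : ∀ {f : ℂ → ℂ}, ContinuousAt f 0 → f 0 = ω →
      ContinuousAt (fun u => Complex.log (f u)) 0 :=
    fun hf h0 => hf.clog (by rw [h0]; exact hω)
  have cdiv : ∀ {f : ℂ → ℂ}, ContinuousAt f 0 → f 0 = ω →
      ContinuousAt (fun u => Complex.log (1 / (1 - f u))) 0 ∧
      ContinuousAt (fun u => Complex.log (1 - 1 / f u)) 0 := by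
    intro f hf h0
    constructor
    · exact clog (continuousAt_const.div (continuousAt_const.sub hf) (by rw [h0]; exact hω1))
        (by rw [h0, ω_identities.1])
    · exact clog (continuousAt_const.sub (continuousAt_const.div hf (by rw [h0]; exact hω0)))
        (by rw [h0, ω_identities.2])
  have l₁ := clog c₁ z₁Of_zero
  have l₂ := clog c₂ z₂Of_zero
  obtain ⟨d₁, e₁⟩ := cdiv c₁ z₁Of_zero
  obtain ⟨d₂, e₂⟩ := cdiv c₂ z₂Of_zero
  have g₁ := eventually_gluing (L := gluingSum₁) complete.gluing₁
    ((((l₁.const_mul 2).add d₁).add l₂).add (e₂.const_mul 2))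
  have g₂ := eventually_gluing (L := gluingSum₂) complete.gluing₂
    (((d₁.add (e₁.const_mul 2)).add l₂).add (d₂.const_mul 2))
  have p₁ : ∀ᶠ u in 𝓝 (0 : ℂ), 0 < (z₁Of u).im :=
    (Complex.continuous_im.continuousAt.comp c₁).eventually_const_lt
      (by simpa [z₁Of_zero] using ω_im_pos)
  have p₂ : ∀ᶠ u in 𝓝 (0 : ℂ), 0 < (z₂Of u).im :=
    (Complex.continuous_im.continuousAt.comp c₂).eventually_const_lt
      (by simpa [z₂Of_zero] using ω_im_pos)
  have hD : ∀ᶠ u in 𝓝 (0 : ℂ), 4 * Complex.exp u ^ 2 -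
      (Complex.exp u ^ 2 - Complex.exp u + 1) ^ 2 ≠ 0 := by
    refine ContinuousAt.eventually_ne (by fun_prop) ?_
    norm_num
  have hi₁ : ∀ᶠ u in 𝓝 (0 : ℂ), -Real.pi < u.im :=
    Complex.continuous_im.continuousAt.eventually_const_lt (by simp [Real.pi_pos])
  have hi₂ : ∀ᶠ u in 𝓝 (0 : ℂ), u.im < Real.pi :=
    Complex.continuous_im.continuousAt.eventually_lt_const (by simp [Real.pi_pos])
  filter_upwards [g₁, g₂, p₁, p₂, hD, hi₁, hi₂] with u g₁ g₂ p₁ p₂ hD hi₁ hi₂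
  have h1 := (im_pos_ne _ p₂).2
  have hm : z₁Of u * (1 - z₂Of u) = Complex.exp u := div_mul_cancel₀ _ h1
  have hsq : (z₁Of u * (1 - z₂Of u)) ^ 2 = (1 - z₁Of u) * z₂Of u := by
    refine mul_right_cancel₀ h1 ?_
    have hq := z₂Of_quadratic hD
    rw [← hm] at hq
    rw [hm] at hq ⊢
    linear_combination hq + z₂Of u * hm
  refine ⟨⟨z₁Of u, z₂Of u, p₁, p₂,
    eq_two_pi_mul_I_of_exp_eq_one (exp_gluingSum₁ p₁ p₂ hsq) g₁,
    eq_two_pi_mul_I_of_exp_eq_one (exp_gluingSum₂ p₁ p₂ hsq) g₂⟩, ?_⟩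
  change Complex.log (z₁Of u * (1 - z₂Of u)) = u
  rw [hm, Complex.log_exp hi₁ hi₂.le]

lemma nonempty_invariants_equiv {s : Shape} (hF : Module.finrank ℝ s.repF.invariants = 1)
    (hdF : Module.finrank ℝ s.repdF.invariants = 1) :
    Nonempty (s.repF.invariants ≃ₗ[ℝ] s.repdF.invariants) := by
  have := Module.finite_of_finrank_pos (R := ℝ) (M := s.repF.invariants) (by omega)
  have := Module.finite_of_finrank_pos (R := ℝ) (M := s.repdF.invariants) (by omega)
  exact ⟨LinearEquiv.ofFinrankEq _ _ (hF.trans hdF.symm)⟩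

end Shape

end FigureEight

end

/-! ### The main theorem -/

open FigureEight in
theorem mainTheorem4 :
    (∀ s : Shape,
      (s.repFdF).IsIntertwiningMap s.repF (relToH1 s.adRep F dF) ∧
      IsShortExact s.I.toRepresentation s.repF s.repdF
        s.I.toSubmodule.subtype (res s.adRep dF_le_F)) ∧
    (∃ V : Set ℂ, IsOpen V ∧ 0 ∈ V ∧ V ⊆ Shape.U ∧
      ∀ s : Shape, s.u ∈ V →
        Nonempty (s.repF.invariants ≃ₗ[ℝ] s.repdF.invariants) ∧
        Module.finrank ℝ s.repF.invariants = 1) ∧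
    Shape.complete.u = 0 ∧
    (∀ t : ℝ, LinearMap.det (Shape.complete.repFdF xGen - t • (LinearMap.id : Shape.complete.H1FdF →ₗ[ℝ] _)) =
      -(t - 1) ^ 3 * (t ^ 6 - 15 * t ^ 5 + 27 * t ^ 4 - 42 * t ^ 3 + 27 * t ^ 2 - 15 * t + 1)) ∧
    (∀ t : ℝ, LinearMap.det (Shape.complete.repF xGen - t • (LinearMap.id : Shape.complete.H1F →ₗ[ℝ] _)) =
      -(t - 1) ^ 3 * (t ^ 6 - 15 * t ^ 5 + 27 * t ^ 4 - 42 * t ^ 3 + 27 * t ^ 2 - 15 * t + 1)) := by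
  refine ⟨fun s => ⟨⟨fun k f => relToH1_equivariant s.adRep _ _ k f⟩,
    isShortExact s.adRep s.range_sup_range⟩, ?_, Shape.complete_u, det_repFdF, det_repF⟩
  obtain ⟨W, hW, hWV⟩ := Filter.mem_comap.mp Shape.eventually_finrank_invariants
  -- Since `nearComplete` is pulled back along u, a condition that holds eventually there holds for
  -- every shape with parameter in a neighborhood W of 0; V is an open neighborhood inside both W
  -- and U.
  obtain ⟨V, hV, hVo, hV0⟩ := mem_nhds_iff.mp (Filter.inter_mem hW Shape.eventually_mem_U)
  refine ⟨V, hVo, hV0, fun u hu => (hV hu).2, fun s hs => ?_⟩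
  obtain ⟨h1, h2⟩ := hWV (show s ∈ Shape.u ⁻¹' W from (hV hs).1)
  exact ⟨Shape.nonempty_invariants_equiv h1 h2, h1⟩
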